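/- Let $n\ge 1$ agents solve the bilevel problem $$\min_{x\in\mathbb R^p}\ \Phi(x)=\frac1n\sum_{i=1}^n f_i(x,y^*(x)),\qquad y^*(x)=\arg\min_{y\in\mathbb R^q} g(x,y),\quad g=\frac1n\sum_{i=1}^n g_i,$$ where $f_i(x,y)=\mathbb E_{\phi\sim\mathcal D_{f_i}}[F(x,y;\phi)]$ and $g_i(x,y)=\mathbb E_{\xi\sim\mathcal D_{g_i}}[G(x,y;\xi)]$. Write $\nabla f_i(\cdot;\phi)$, $\nabla g_i(\cdot;\xi)$, $\nabla^2 g_i(\cdot;\xi)$ for the derivatives of $F(\cdot;\phi)$ and $G(\cdot;\xi)$. Assume: (A1) $f_i,\nabla f_i,\nabla g_i,\nabla^2 g_i$ are Lipschitz with constants $L_{f,0},L_{f,1},L_{g,1},L_{g,2}>0$, and $g_i$ is $\mu_g$-strongly convex in $y$, $\mu_g>0$; (A2) $W=(w_{ij})\in\mathbb R^{n\times n}$ is symmetric with nonnegative entries and $W\mathbf 1=\mathbf 1$, and all its eigenvalues except the largest one (counted with multiplicity) are at most $\rho<1$ in absolute value; (A3) $\|\nabla_y g_i(x,y)-\frac1n\sum_l\nabla_y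 g_l(x,y)\|\le\delta$ for all $i,x,y$; (A4) the stochastic derivatives $\nabla f_i(x,y;\phi)$, $\nabla g_i(x,y;\xi)$, $\nabla^2 g_i(x,y;\xi)$ are unbiased with variances at most $\sigma_f^2,\sigma_{g,1}^2,\sigma_{g,2}^2$; (A5) $\Phi$ is bounded below. MA-DSBO with step sizes $\alpha,\beta,\gamma>0$ and loop lengths $K,T,N$ runs as follows, all samples being independent, with laws $\mathcal D_{f_i}$ (for $\phi$) and $\mathcal D_{g_i}$ (for $\xi,\tilde\xi$). Start with $x_{i,0}=r_{i,0}=0$ and $y_i=0$. For $k=0,\dots,K-1$: (i) repeat for $t=0,\dots,T-1$: $y_i\leftarrow\sum_j w_{ij}y_j-\beta\nabla_y g_i(x_{i,k},y_i;\tilde\xi_{i,k}^{(t)})$ (simultaneously for all $i$); (ii) with fresh samples $\phi_{i,t},\xi_{i,t}$ $(0\le t\le N)$, $H_{i,t}=\nabla_y^2 g_i(x_{i,k},y_i;\xi_{i,t})$ and $b_{i,t}=\nabla_y f_i(x_{i,k},y_i;\phi_{i,t})$, set $z_{i,0}=0$, $d_{i,0}=s_{i,0}=-b_{i,0}$ and,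 for $0\le t<N$, $z_{i,t+1}=\sum_j w_{ij}z_{j,t}-\gamma d_{i,t}$, $s_{i,t+1}=H_{i,t+1}z_{i,t+1}-b_{i,t+1}$, $d_{i,t+1}=\sum_j w_{ij}d_{j,t}+s_{i,t+1}-s_{i,t}$; (iii) $u_{i,k}=\nabla_x f_i(x_{i,k},y_i;\phi_{i,0})-\nabla^2_{xy}g_i(x_{i,k},y_i;\xi_{i,0})z_{i,N}$; (iv) $x_{i,k+1}=\sum_j w_{ij}x_{j,k}-\alpha r_{i,k}$ and $r_{i,k+1}=(1-\alpha)r_{i,k}+\alpha u_{i,k}$. Put $\bar x_k=\frac1n\sum_i x_{i,k}$. Then there are constants $0<c_1<c_2$ such that for every $\gamma\in(c_1,c_2)$ there is $r>0$ with the following property. Let $0<a_1\le a_2$ and $0<b_1\le b_2$. There are $C_K,C_N>0$ such that for all $C_K'\ge C_K$ and $C_N'\ge C_N$ there is $M>0$ such that, for every $\varepsilon\in(0,\tfrac12]$, if $T=1$, $$C_K\varepsilon^{-2}\le K\le C_K'\varepsilon^{-2},\qquad C_N\log\tfrac1\varepsilon\le N\le C_N'\log\tfrac1\varepsilon,$$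 $$\frac{a_1}{\sqrt K}\le\alpha\le\frac{a_2}{\sqrt K},\qquad \frac{b_1}{\sqrt K}\le\beta\le\frac{b_2}{\sqrt K},\qquad \alpha\le r\beta,$$ then MA-DSBO finds an $\varepsilon$-stationary point, that is, $\Phi$ is differentiable and $\min_{0\le k\le K}\mathbb E\|\nabla\Phi(\bar x_k)\|^2\le\varepsilon$, and the total number of samples drawn by all agents is at most $M\varepsilon^{-2}\log\frac1\varepsilon$. All these constants depend only on $n,\mu_g,L_{f,0},L_{f,1},L_{g,1},L_{g,2},\sigma_f,\sigma_{g,1},\sigma_{g,2},\delta,\rho$, on upper bounds for $\Phi(0)-\inf\Phi$ and $\|y^*(0)\|$, and on the constants chosen before them; in particular not on $\varepsilon$, $K$, $p$, $q$. -/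

import Mathlib

open MeasureTheory ProbabilityTheory

noncomputable section

namespace DSBO

universe u v w

/-! ### Points, partial gradients, second derivatives -/

/-- `ℝ^d` with the Euclidean norm. -/
abbrev Vec (d : ℕ) : Type := EuclideanSpace ℝ (Fin d)

/-- Pairs `(x, y) ∈ ℝ^p × ℝ^q`, as vectors of `ℝ^(p+q)` with the Euclidean norm. -/
abbrev Pair (p q : ℕ) : Type := EuclideanSpace ℝ (Fin p ⊕ Fin q)

/-- The point `(x, y)`. -/
def pair {p q : ℕ} (x : Vec p) (y : Vec q) : Pair p q := WithLp.toLp 2 (Sum.elim x y)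

/-- The first block `x` of `(x, y)`. -/
def fstBlock {p q : ℕ} (z : Pair p q) : Vec p := WithLp.toLp 2 fun a => z (Sum.inl a)

/-- The second block `y` of `(x, y)`. -/
def sndBlock {p q : ℕ} (z : Pair p q) : Vec q := WithLp.toLp 2 fun b => z (Sum.inr b)

/-- `∇_x h (x, y)`, the first block of the full gradient. -/
def gradX {p q : ℕ} (h : Pair p q → ℝ) (z : Pair p q) : Vec p := fstBlock (gradient h z)

/-- `∇_y h (x, y)`, the second block of the full gradient. -/
def gradY {p q : ℕ} (h : Pair p q → ℝ) (z : Pair p q) : Vec q := sndBlock (gradient h z)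

/-- The Hessian `∇² h (x, y)` in all variables, as a linear map. -/
def hess {p q : ℕ} (h : Pair p q → ℝ) (z : Pair p q) : Pair p q →L[ℝ] Pair p q :=
  fderiv ℝ (gradient h) z

/-- The Hessian-vector product `∇_y² h (x, y) v`. -/
def hessYMul {p q : ℕ} (h : Pair p q → ℝ) (z : Pair p q) (v : Vec q) : Vec q :=
  sndBlock (hess h z (pair 0 v))

/-- The Jacobian-vector product `∇_{xy}² h (x, y) v`, where `∇_{xy}² h` is the `p × q` matrix
of the mixed second derivatives. -/
def jacXYMul {p q : ℕ} (h : Pair p q → ℝ) (z : Pair p q) (v : Vec q) : Vec p :=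
  fstBlock (hess h z (pair 0 v))

/-! ### The bilevel problem -/

/-- Data of a decentralized stochastic bilevel problem with `n` agents: the random losses
`F(x, y; φ)`, `G(x, y; ξ)` and, for each agent, the distributions of `φ` and of `ξ`. -/
structure Problem (n p q : ℕ) (S : Type u) (R : Type v) [MeasurableSpace S]
    [MeasurableSpace R] where
  F : Pair p q → S → ℝ
  G : Pair p q → R → ℝ
  Df : Fin n → Measure S
  Dg : Fin n → Measure R
  prob_Df : ∀ i, IsProbabilityMeasure (Df i)
  prob_Dg : ∀ i, IsProbabilityMeasure (Dg i)

namespace Problem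

variable {n p q : ℕ} {S : Type u} {R : Type v} [MeasurableSpace S] [MeasurableSpace R]

/-- The random upper-level loss `F(·, ·; s)` at the data point `s`. -/
def lossF (B : Problem n p q S R) (s : S) : Pair p q → ℝ := fun z => B.F z s

/-- The random lower-level loss `G(·, ·; s)` at the data point `s`. -/
def lossG (B : Problem n p q S R) (s : R) : Pair p q → ℝ := fun z => B.G z s

/-- `f_i (x, y) = 𝔼 F(x, y; φ)`, `φ ∼ D_{f_i}`. -/
def f (B : Problem n p q S R) (i : Fin n) (z : Pair p q) : ℝ := ∫ s, B.F z s ∂(B.Df i)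

/-- `g_i (x, y) = 𝔼 G(x, y; ξ)`, `ξ ∼ D_{g_i}`. -/
def g (B : Problem n p q S R) (i : Fin n) (z : Pair p q) : ℝ := ∫ s, B.G z s ∂(B.Dg i)

/-- The global lower-level objective `g (x, y) = (1/n) ∑ g_i (x, y)`. -/
def gBar (B : Problem n p q S R) (z : Pair p q) : ℝ := (1 / (n : ℝ)) * ∑ i, B.g i z

/-- `y^*(x)`, the minimizer of `g (x, ·)`; it exists and is unique when `g` is smooth and strongly
convex in `y`. -/
def yStar (B : Problem n p q S R) (x : Vec p) : Vec q :=
  Classical.epsilon fun y => ∀ y', B.gBar (pair x y) ≤ B.gBar (pair x y')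

/-- The objective `Φ (x) = (1/n) ∑ f_i (x, y^*(x))`. -/
def Phi (B : Problem n p q S R) (x : Vec p) : ℝ :=
  (1 / (n : ℝ)) * ∑ i, B.f i (pair x (B.yStar x))

end Problem

/-! ### Assumptions -/

/-- The constants that enter the assumptions: `μ_g`, the Lipschitz constants, the standard
deviations, the heterogeneity bound `δ`, the spectral bound `ρ`, a bound `gap` for
`Φ(0) - inf Φ` and a bound `y0` for the norm of `y^*(0)`. -/
structure Constants where
  mu : ℝ
  Lf0 : ℝ
  Lf1 : ℝ
  Lg1 : ℝ
  Lg2 : ℝ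
  sigF : ℝ
  sigG1 : ℝ
  sigG2 : ℝ
  delta : ℝ
  rho : ℝ
  gap : ℝ
  y0 : ℝ

/-- Sign conditions on the constants. -/
structure Constants.Valid (c : Constants) : Prop where
  mu_pos : 0 < c.mu
  Lf0_pos : 0 < c.Lf0
  Lf1_pos : 0 < c.Lf1
  Lg1_pos : 0 < c.Lg1
  Lg2_pos : 0 < c.Lg2
  sigF_nonneg : 0 ≤ c.sigF
  sigG1_nonneg : 0 ≤ c.sigG1
  sigG2_nonneg : 0 ≤ c.sigG2
  delta_nonneg : 0 ≤ c.delta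
  rho_nonneg : 0 ≤ c.rho
  rho_lt_one : c.rho < 1
  gap_nonneg : 0 ≤ c.gap
  y0_nonneg : 0 ≤ c.y0

/-- `h` is Lipschitz continuous with constant `L`. -/
def IsLip {V H : Type*} [NormedAddCommGroup V] [NormedAddCommGroup H] (L : ℝ) (h : V → H) : Prop :=
  ∀ z z', ‖h z - h z'‖ ≤ L * ‖z - z'‖

/-- `f_i`, `∇f_i`, `∇g_i`, `∇²g_i` exist and are Lipschitz, and `g_i` is strongly convex in `y`.
Second derivatives are measured in the operator norm, which is at most the Frobenius norm. -/
structure Smooth {n p q : ℕ} {S : Type u} {R : Type v} [MeasurableSpace S] [MeasurableSpace R]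
    (c : Constants) (B : Problem n p q S R) : Prop where
  diff_f : ∀ i, Differentiable ℝ (B.f i)
  diff_g : ∀ i, Differentiable ℝ (B.g i)
  diff_grad_g : ∀ i, Differentiable ℝ (gradient (B.g i))
  lip_f : ∀ i, IsLip c.Lf0 (B.f i)
  lip_grad_f : ∀ i, IsLip c.Lf1 (gradient (B.f i))
  lip_grad_g : ∀ i, IsLip c.Lg1 (gradient (B.g i))
  lip_hess_g : ∀ i, IsLip c.Lg2 (hess (B.g i))
  strong : ∀ i x, StrongConvexOn Set.univ c.mu (fun y => B.g i (pair x y))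

/-- `W` is symmetric and doubly stochastic, and all its eigenvalues except the largest one,
counted with multiplicity, are at most `ρ` in absolute value (`eigenvalues₀` lists the
eigenvalues in decreasing order, starting at index `0`). -/
structure Network {n : ℕ} (rho : ℝ) (W : Matrix (Fin n) (Fin n) ℝ) : Prop where
  symm : W.IsHermitian
  nonneg : ∀ i j, 0 ≤ W i j
  row_sum : ∀ i, ∑ j, W i j = 1
  gap : ∀ j, 0 < j.val → |symm.eigenvalues₀ j| ≤ rho

/-- `‖∇_y g_i - (1/n) ∑_l ∇_y g_l‖ ≤ δ` everywhere. -/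
def Heterogeneity {n p q : ℕ} {S : Type u} {R : Type v} [MeasurableSpace S] [MeasurableSpace R]
    (c : Constants) (B : Problem n p q S R) : Prop :=
  ∀ i x y, ‖gradY (B.g i) (pair x y) - (1 / (n : ℝ)) • ∑ l, gradY (B.g l) (pair x y)‖ ≤ c.delta

/-- Under the law `D`, the random element `X` has mean `m` and variance at most `σ²`. -/
structure Unbiased {S V : Type*} [MeasurableSpace S] [NormedAddCommGroup V] [NormedSpace ℝ V]
    (D : Measure S) (X : S → V) (m : V) (sigma : ℝ) : Prop where
  integrable : Integrable X D
  mean : ∫ s, X s ∂D = m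
  integrable_sq : Integrable (fun s => ‖X s - m‖ ^ 2) D
  variance : ∫ s, ‖X s - m‖ ^ 2 ∂D ≤ sigma ^ 2

/-- The random losses are integrable and differentiable as often as needed, their derivatives
are jointly measurable, and the stochastic derivatives are unbiased with bounded variances. -/
structure Stochastic {n p q : ℕ} {S : Type u} {R : Type v} [MeasurableSpace S]
    [MeasurableSpace R] (c : Constants) (B : Problem n p q S R) : Prop where
  integrable_F : ∀ i z, Integrable (B.F z) (B.Df i)
  integrable_G : ∀ i z, Integrable (B.G z) (B.Dg i)
  diff_F : ∀ s, Differentiable ℝ (B.lossF s)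
  diff_G : ∀ s, Differentiable ℝ (B.lossG s)
  diff_grad_G : ∀ s, Differentiable ℝ (gradient (B.lossG s))
  meas_grad_F : Measurable fun a : Pair p q × S => gradient (B.lossF a.2) a.1
  meas_grad_G : Measurable fun a : Pair p q × R => gradient (B.lossG a.2) a.1
  meas_hess_G : Measurable fun a : Pair p q × R => hess (B.lossG a.2) a.1
  grad_F : ∀ i z, Unbiased (B.Df i) (fun s => gradient (B.lossF s) z) (gradient (B.f i) z) c.sigF
  grad_G : ∀ i z, Unbiased (B.Dg i) (fun s => gradient (B.lossG s) z) (gradient (B.g i) z) c.sigG1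
  hess_G : ∀ i z, Unbiased (B.Dg i) (fun s => hess (B.lossG s) z) (hess (B.g i) z) c.sigG2

/-- All standing assumptions on the problem and on the weight matrix. -/
structure Assumptions {n p q : ℕ} {S : Type u} {R : Type v} [MeasurableSpace S]
    [MeasurableSpace R] (c : Constants) (B : Problem n p q S R)
    (W : Matrix (Fin n) (Fin n) ℝ) : Prop where
  smooth : Smooth c B
  network : Network c.rho W
  heterogeneity : Heterogeneity c B
  stochastic : Stochastic c B
  /-- `Φ` is bounded below, with `Φ(0) - inf Φ ≤ gap`. -/
  bounded_below : ∀ x, B.Phi 0 - c.gap ≤ B.Phi x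
  /-- The constant `y0` bounds the distance from the starting point `0` to `y^*(0)`. -/
  y0_bound : ‖B.yStar 0‖ ≤ c.y0

/-! ### The algorithm -/

/-- One realization of the samples: `xiTilde k t i` is the sample of agent `i` at step `t` of the
inner loop of iteration `k`; `xi k t i` and `phi k t i` are those of agent `i` for step `t` of the
hypergradient estimation of iteration `k`. -/
structure Samples (n : ℕ) (S : Type u) (R : Type v) where
  xiTilde : ℕ → ℕ → Fin n → R
  xi : ℕ → ℕ → Fin n → R
  phi : ℕ → ℕ → Fin n → S

/-- The random samples are measurable, mutually independent, and have the prescribed laws. -/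
structure Sampling {n p q : ℕ} {S : Type u} {R : Type v} [mS : MeasurableSpace S]
    [mR : MeasurableSpace R] {Ω : Type w} [MeasurableSpace Ω] (Pr : Measure Ω)
    (B : Problem n p q S R) (X : Ω → Samples n S R) : Prop where
  meas_xiTilde : ∀ k t i, Measurable fun ω => (X ω).xiTilde k t i
  meas_xi : ∀ k t i, Measurable fun ω => (X ω).xi k t i
  meas_phi : ∀ k t i, Measurable fun ω => (X ω).phi k t i
  law_xiTilde : ∀ k t i, Pr.map (fun ω => (X ω).xiTilde k t i) = B.Dg i
  law_xi : ∀ k t i, Pr.map (fun ω => (X ω).xi k t i) = B.Dg i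
  law_phi : ∀ k t i, Pr.map (fun ω => (X ω).phi k t i) = B.Df i
  indep : iIndep
    (Sum.elim (fun a : ℕ × ℕ × Fin n => mR.comap fun ω => (X ω).xiTilde a.1 a.2.1 a.2.2)
      (Sum.elim (fun a : ℕ × ℕ × Fin n => mR.comap fun ω => (X ω).xi a.1 a.2.1 a.2.2)
        (fun a : ℕ × ℕ × Fin n => mS.comap fun ω => (X ω).phi a.1 a.2.1 a.2.2))) Pr

/-- Step sizes and loop lengths. -/
structure Config where
  alpha : ℕ → ℝ
  beta : ℕ → ℝ
  gamma : ℝ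
  T : ℕ
  N : ℕ

/-- One communication round: agent `i` receives `∑_j w_{ij} v_j`. -/
def mix {n d : ℕ} (W : Matrix (Fin n) (Fin n) ℝ) (v : Fin n → Vec d) (i : Fin n) : Vec d :=
  ∑ j, W i j • v j

/-- The average over all agents. -/
def avg {n d : ℕ} (v : Fin n → Vec d) : Vec d := (1 / (n : ℝ)) • ∑ i, v i

/-- State of the Hessian-inverse-gradient-product oracle, with the number of samples drawn. -/
structure HigpState (n q : ℕ) where
  z : Fin n → Vec q
  d : Fin n → Vec q
  s : Fin n → Vec q
  samples : ℕ

/-- State of the inner loop, with the number of samples drawn. -/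
structure InnerState (n q : ℕ) where
  y : Fin n → Vec q
  samples : ℕ

/-- State of the main loop at the start of iteration `k`: `x_{i,k}`, `r_{i,k}`,
`y_{i,k}^{(0)}` and the total number of samples drawn by all agents so far. -/
structure MainState (n p q : ℕ) where
  x : Fin n → Vec p
  r : Fin n → Vec p
  y : Fin n → Vec q
  samples : ℕ

section Algorithm

variable {n p q : ℕ} {S : Type u} {R : Type v} [MeasurableSpace S] [MeasurableSpace R]

/-- `t` steps of the inner loop: stochastic gradient steps in `y`, one sample per agent and
step. -/
def innerLoop (B : Problem n p q S R) (W : Matrix (Fin n) (Fin n) ℝ) (beta : ℝ)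
    (xi : ℕ → Fin n → R) (x : Fin n → Vec p) (y : Fin n → Vec q) : ℕ → InnerState n q
  | 0 => { y := y, samples := 0 }
  | t + 1 =>
    let st := innerLoop B W beta xi x y t
    { y := fun i => mix W st.y i - beta • gradY (B.lossG (xi t i)) (pair (x i) (st.y i))
      samples := st.samples + n }

/-- `t` steps of the Hessian-inverse-gradient-product oracle (gradient tracking) with
`H_{i,t} = ∇_y² G(x_i, y_i; ξ_{i,t})` and `b_{i,t} = ∇_y F(x_i, y_i; φ_{i,t})`: two samples per
agent for the initialization and for every step. -/
def higp (B : Problem n p q S R) (W : Matrix (Fin n) (Fin n) ℝ) (gamma : ℝ)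
    (xi : ℕ → Fin n → R) (phi : ℕ → Fin n → S) (x : Fin n → Vec p) (y : Fin n → Vec q) :
    ℕ → HigpState n q
  | 0 =>
    { z := fun _ => 0
      d := fun i => - gradY (B.lossF (phi 0 i)) (pair (x i) (y i))
      s := fun i => - gradY (B.lossF (phi 0 i)) (pair (x i) (y i))
      samples := 2 * n }
  | t + 1 =>
    let st := higp B W gamma xi phi x y t
    let z' : Fin n → Vec q := fun i => mix W st.z i - gamma • st.d i
    let s' : Fin n → Vec q := fun i =>
      hessYMul (B.lossG (xi (t + 1) i)) (pair (x i) (y i)) (z' i)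
        - gradY (B.lossF (phi (t + 1) i)) (pair (x i) (y i))
    { z := z'
      d := fun i => mix W st.d i + s' i - st.s i
      s := s'
      samples := st.samples + 2 * n }

/-- The hypergradient estimate `u_i = ∇_x F(x_i, y_i; φ_{i,0}) - ∇_{xy}² G(x_i, y_i; ξ_{i,0}) z_i`,
where `z` is the output of the oracle. -/
def hypergrad (B : Problem n p q S R) (xi : ℕ → Fin n → R) (phi : ℕ → Fin n → S)
    (x : Fin n → Vec p) (y : Fin n → Vec q) (z : Fin n → Vec q) (i : Fin n) : Vec p :=
  gradX (B.lossF (phi 0 i)) (pair (x i) (y i))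
    - jacXYMul (B.lossG (xi 0 i)) (pair (x i) (y i)) (z i)

/-- The moving-average decentralized stochastic bilevel method on one realization `X` of the
samples: state at the start of iteration `k`. -/
def maDsbo (B : Problem n p q S R) (W : Matrix (Fin n) (Fin n) ℝ) (cfg : Config)
    (X : Samples n S R) : ℕ → MainState n p q
  | 0 => { x := fun _ => 0, r := fun _ => 0, y := fun _ => 0, samples := 0 }
  | k + 1 =>
    let st := maDsbo B W cfg X k
    let inner := innerLoop B W (cfg.beta k) (X.xiTilde k) st.x st.y cfg.T
    let orc := higp B W cfg.gamma (X.xi k) (X.phi k) st.x inner.y cfg.N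
    let u : Fin n → Vec p := hypergrad B (X.xi k) (X.phi k) st.x inner.y orc.z
    { x := fun i => mix W st.x i - cfg.alpha k • st.r i
      r := fun i => (1 - cfg.alpha k) • st.r i + cfg.alpha k • u i
      y := inner.y
      samples := st.samples + inner.samples + orc.samples }

/-- The averaged iterate `x̄_k`. -/
def xBar (B : Problem n p q S R) (W : Matrix (Fin n) (Fin n) ℝ) (cfg : Config)
    (X : Samples n S R) (k : ℕ) : Vec p :=
  avg (maDsbo B W cfg X k).x

/-- `K` iterations find an `ε`-stationary point: `min_{0 ≤ k ≤ K} 𝔼 ‖∇Φ(x̄_k)‖² ≤ ε`, where the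
gradient and the expectations exist. -/
structure FindsStationary {Ω : Type w} [MeasurableSpace Ω] (Pr : Measure Ω)
    (B : Problem n p q S R) (W : Matrix (Fin n) (Fin n) ℝ) (cfg : Config)
    (X : Ω → Samples n S R) (K : ℕ) (ε : ℝ) : Prop where
  differentiable : Differentiable ℝ B.Phi
  integrable : ∀ k ≤ K, Integrable (fun ω => ‖gradient B.Phi (xBar B W cfg (X ω) k)‖ ^ 2) Pr
  min_le : (Finset.range (K + 1)).inf' Finset.nonempty_range_add_one
    (fun k => ∫ ω, ‖gradient B.Phi (xBar B W cfg (X ω) k)‖ ^ 2 ∂Pr) ≤ ε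

end Algorithm

end DSBO

end

open DSBO

/-!
The gradient of `Φ` is computed by implicit differentiation. Strong convexity makes `y^*` Lipschitz,
and `∇Φ(x)` is the hypergradient at `(x, y^*(x))`: the mean of `∇_x f_i - ∇²_{xy} g_i z`, where `z`
solves the averaged linear system `(∑ ∇²_y g_i) z = ∑ ∇_y f_i`. Hence `∇Φ` exists and is Lipschitz
(`Smooth.hasGradientAt_Phi`, `Smooth.isLip_gradient_Phi`).

The oracle of an iteration is gradient tracking for this linear system, with an operator that is
coercive only after averaging over the agents and with noise that grows with the iterate. Because the
samples are fresh, the noise of a round is orthogonal to everything drawn before (`Centered`), so it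
enters the second moments only at order `γ²`. For all small `γ` a weighted sum of the mean-square
errors of the averaged iterate, of the consensus and of the trackers contracts
(`exists_tracking_contraction`, `exists_trackingBound`). This is used twice. For the stochastic oracle
it bounds the second moments of `z` and of the hypergradients `u`, uniformly in `N`. For the noiseless
oracle, compared with its fixed point, it gives an error of order `θ ^ N`. The two are connected by
linearity: the conditional mean of the stochastic `z` is the noiseless one. The sample `ξ_0` is not
used by `z`, since `z_0 = 0`. So `u` is unbiased for the noiseless hypergradient
(`OracleRun.centered_stochHypergrad_sub`), which differs from the exact one by `O(θ ^ N)` in square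
(`Smooth.norm_avg_meanHypergrad_sub_le`).

The main loop is analysed for the averages over the agents (`MainRun`). By the spectral gap the
consensus errors of `x` and `y` are `O(α²)` and `O(β²)`. For `y` this uses bounded heterogeneity,
as the local gradients need not be small. An inner step contracts the distance of the mean of `y` to
`y^*(x̄)` by `1 - β μ / 2`, up to noise and consensus error of order `β²`, and the motion of `y^*`
costs a multiple of `α² / β` times `‖r̄‖²`. With `α ≤ 1`, the potential `Φ(x̄) + ‖r̄‖² / 2` decreases
by `α / 2` times `‖r̄‖²`, up to `α / 2` times the squared bias and a term of order `α²`. The error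
`‖∇Φ(x̄) - r̄‖²` of the moving average contracts by `1 - α`. When these recursions are summed, the
lower-level error feeds back a multiple of `(α / β)²` times `∑ ‖r̄‖²` into the bias; for
`α ≤ r β` the descent of the potential absorbs it (`sum_le_of_recursions`). The mean over the
iterations of `E ‖∇Φ(x̄_k)‖²` is thus at most `A / (α K) + B β + C θ ^ N`
(`MainRun.sum_norm_gradient_le`). With `α` and `β` of order `1 / √K`, it is at most `ε` as soon as `K`
exceeds a multiple of `ε⁻²` and `N` a multiple of `log (1 / ε)`.
-/

noncomputable section

namespace DSBO

/-! ### Stacks of vectors: averages, deviations, mixing -/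

/-- The squared norm `∑ ‖v_i‖²` of a family of vectors, one for each agent. -/
def sqn {n : ℕ} {E : Type*} [NormedAddCommGroup E] (v : Fin n → E) : ℝ := ∑ i, ‖v i‖ ^ 2

/-- The deviation of a family of vectors from its average (the consensus error). -/
def dev {n d : ℕ} (v : Fin n → Vec d) : Fin n → Vec d := fun i => v i - avg v

/-- Young's inequality for a squared norm, with parameter `c`. -/
lemma norm_add_sq_le_young {E : Type*} [SeminormedAddCommGroup E] {c : ℝ} (hc : 0 < c) (a b : E) :
    ‖a + b‖ ^ 2 ≤ (1 + c) * ‖a‖ ^ 2 + (1 + 1 / c) * ‖b‖ ^ 2 := by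
  have h : ‖a + b‖ ^ 2 ≤ (‖a‖ + ‖b‖) ^ 2 := pow_le_pow_left₀ (norm_nonneg _) (norm_add_le _ _) 2
  have h2 : c * ‖a‖ ^ 2 + 1 / c * ‖b‖ ^ 2 - 2 * ‖a‖ * ‖b‖ = 1 / c * (c * ‖a‖ - ‖b‖) ^ 2 := by
    field_simp; ring
  have h3 : 0 ≤ 1 / c * (c * ‖a‖ - ‖b‖) ^ 2 := by positivity
  nlinarith

lemma norm_add_sq_le_two {E : Type*} [SeminormedAddCommGroup E] (a b : E) :
    ‖a + b‖ ^ 2 ≤ 2 * ‖a‖ ^ 2 + 2 * ‖b‖ ^ 2 := by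
  have := norm_add_sq_le_young one_pos a b
  norm_num at this; linarith

lemma norm_sub_sq_le_two {E : Type*} [SeminormedAddCommGroup E] (a b : E) :
    ‖a - b‖ ^ 2 ≤ 2 * ‖a‖ ^ 2 + 2 * ‖b‖ ^ 2 := by
  have := norm_add_sq_le_two a (-b)
  rwa [norm_neg, ← sub_eq_add_neg] at this

section Stacks

variable {n d : ℕ} {E : Type*} [NormedAddCommGroup E]

lemma sqn_nonneg (v : Fin n → E) : 0 ≤ sqn v := Finset.sum_nonneg fun _ _ => by positivity

lemma sqn_le_of_norm_le {v : Fin n → E} {C : ℝ} (h : ∀ i, ‖v i‖ ≤ C) : sqn v ≤ n * C ^ 2 := by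
  refine (Finset.sum_le_sum fun i _ => pow_le_pow_left₀ (norm_nonneg _) (h i) 2).trans ?_
  simp

lemma sqn_add_le_two (a b : Fin n → E) : sqn (fun i => a i + b i) ≤ 2 * sqn a + 2 * sqn b := by
  simp only [sqn, Finset.mul_sum, ← Finset.sum_add_distrib]
  exact Finset.sum_le_sum fun i _ => norm_add_sq_le_two _ _

lemma sqn_sub_le_two (a b : Fin n → E) : sqn (fun i => a i - b i) ≤ 2 * sqn a + 2 * sqn b := by
  simp only [sqn, Finset.mul_sum, ← Finset.sum_add_distrib]
  exact Finset.sum_le_sum fun i _ => norm_sub_sq_le_two _ _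

lemma sqn_smul [NormedSpace ℝ E] (a : ℝ) (v : Fin n → E) :
    sqn (fun i => a • v i) = a ^ 2 * sqn v := by
  simp only [sqn, Finset.mul_sum, norm_smul, mul_pow, Real.norm_eq_abs, sq_abs]

lemma sqn_le_mul {F : Type*} [NormedAddCommGroup F] {a : Fin n → E} {b : Fin n → F} {C : ℝ}
    (h : ∀ i, ‖a i‖ ≤ C * ‖b i‖) : sqn a ≤ C ^ 2 * sqn b := by
  simp only [sqn, Finset.mul_sum]
  refine Finset.sum_le_sum fun i _ => ?_
  rw [← mul_pow]
  exact pow_le_pow_left₀ (norm_nonneg _) (h i) 2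

/-- Adding a perturbation to a contracted family, with the weights for which the contraction
factor only grows from `ρ²` to `ρ`. -/
lemma sqn_add_le_contraction {ρ V : ℝ} (h0 : 0 < ρ) (h1 : ρ < 1) {a b : Fin n → E}
    (ha : sqn a ≤ ρ ^ 2 * V) : sqn (fun i => a i + b i) ≤ ρ * V + 1 / (1 - ρ) * sqn b := by
  have hc : 0 < (1 - ρ) / ρ := div_pos (by linarith) h0
  have h : sqn (fun i => a i + b i) ≤
      (1 + (1 - ρ) / ρ) * sqn a + (1 + 1 / ((1 - ρ) / ρ)) * sqn b := by
    simp only [sqn, Finset.mul_sum, ← Finset.sum_add_distrib]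
    exact Finset.sum_le_sum fun i _ => norm_add_sq_le_young hc _ _
  have h2 : 1 + (1 - ρ) / ρ = 1 / ρ := by field_simp; ring
  have h3 : 1 + 1 / ((1 - ρ) / ρ) = 1 / (1 - ρ) := by
    have : 1 - ρ ≠ 0 := by linarith
    field_simp; ring
  rw [h2, h3] at h
  have h4 : 1 / ρ * sqn a ≤ 1 / ρ * (ρ ^ 2 * V) := by gcongr
  have h5 : 1 / ρ * (ρ ^ 2 * V) = ρ * V := by field_simp
  linarith

lemma avg_add (a b : Fin n → Vec d) : avg (fun i => a i + b i) = avg a + avg b := by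
  simp [avg, Finset.sum_add_distrib, smul_add]

lemma avg_sub (a b : Fin n → Vec d) : avg (fun i => a i - b i) = avg a - avg b := by
  simp [avg, Finset.sum_sub_distrib, smul_sub]

lemma avg_smul (a : ℝ) (b : Fin n → Vec d) : avg (fun i => a • b i) = a • avg b := by
  simp [avg, ← Finset.smul_sum, smul_comm a]

lemma avg_const (hn : 0 < n) (a : Vec d) : avg (fun _ : Fin n => a) = a := by
  have : (n : ℝ) ≠ 0 := by positivity
  simp [avg, ← Nat.cast_smul_eq_nsmul ℝ, smul_smul, this]

lemma avg_zero : avg (fun _ : Fin n => (0 : Vec d)) = 0 := by simp [avg]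

lemma dev_add (a b : Fin n → Vec d) : dev (fun i => a i + b i) = fun i => dev a i + dev b i := by
  funext i; simp only [dev, avg_add]; abel

lemma dev_smul (a : ℝ) (b : Fin n → Vec d) : dev (fun i => a • b i) = fun i => a • dev b i := by
  funext i; simp only [dev, avg_smul, smul_sub]

lemma dev_sub_const (hn : 0 < n) (a : Fin n → Vec d) (w : Vec d) :
    dev (fun i => a i - w) = dev a := by
  funext i; simp only [dev, avg_sub, avg_const hn]; abel

lemma smul_avg (hn : 0 < n) (v : Fin n → Vec d) : (n : ℝ) • avg v = ∑ i, v i := by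
  have : (n : ℝ) ≠ 0 := by positivity
  rw [avg, smul_smul, mul_one_div_cancel this, one_smul]

lemma sum_dev (hn : 0 < n) (v : Fin n → Vec d) : ∑ i, dev v i = 0 := by
  simp only [dev, Finset.sum_sub_distrib, Finset.sum_const, Finset.card_univ, Fintype.card_fin]
  rw [← smul_avg hn, ← Nat.cast_smul_eq_nsmul ℝ, sub_self]

lemma inner_avg {m : ℕ} (w : Vec d) (v : Fin m → Vec d) :
    inner ℝ w (avg v) = (1 / (m : ℝ)) * ∑ i, inner ℝ w (v i) := by
  rw [avg, inner_smul_right, inner_sum]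

/-- Pythagoras: the squared norm splits into the average and the consensus error. -/
lemma sqn_eq_avg_add_dev (hn : 0 < n) (v : Fin n → Vec d) :
    sqn v = n * ‖avg v‖ ^ 2 + sqn (dev v) := by
  have h : ∀ i, ‖v i‖ ^ 2 = ‖avg v‖ ^ 2 + 2 * inner ℝ (avg v) (dev v i) + ‖dev v i‖ ^ 2 := by
    intro i
    rw [← norm_add_sq_real]; simp [dev]
  simp only [sqn]
  rw [Finset.sum_congr rfl fun i _ => h i, Finset.sum_add_distrib, Finset.sum_add_distrib,
    ← Finset.mul_sum, ← inner_sum, sum_dev hn]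
  simp

lemma sqn_dev_le (hn : 0 < n) (v : Fin n → Vec d) : sqn (dev v) ≤ sqn v := by
  have := sqn_eq_avg_add_dev hn v
  have : 0 ≤ n * ‖avg v‖ ^ 2 := by positivity
  linarith

lemma norm_avg_sq_le (hn : 0 < n) (v : Fin n → Vec d) : n * ‖avg v‖ ^ 2 ≤ sqn v := by
  have := sqn_eq_avg_add_dev hn v
  have := sqn_nonneg (dev v)
  linarith

lemma norm_avg_sq_le_sqn (hn : 0 < n) (v : Fin n → Vec d) : ‖avg v‖ ^ 2 ≤ sqn v := by
  have h := norm_avg_sq_le hn v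
  have : (1 : ℝ) ≤ n := by exact_mod_cast hn
  nlinarith [sq_nonneg ‖avg v‖]

lemma norm_avg_le (v : Fin n → Vec d) : ‖avg v‖ ≤ (1 / (n : ℝ)) * ∑ i, ‖v i‖ := by
  rw [avg, norm_smul]
  simp only [one_div, norm_inv, RCLike.norm_natCast]
  gcongr
  exact norm_sum_le _ _

/-- A bound common to all members of a family holds for the average. -/
lemma norm_avg_le_of_le (hn : 0 < n) {v : Fin n → Vec d} {C : ℝ} (h : ∀ i, ‖v i‖ ≤ C) :
    ‖avg v‖ ≤ C := by
  have hn' : (0 : ℝ) < n := by exact_mod_cast hn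
  refine (norm_avg_le v).trans ?_
  have : ∑ i, ‖v i‖ ≤ n * C := by
    simpa using Finset.sum_le_card_nsmul Finset.univ (fun i => ‖v i‖) C fun i _ => h i
  calc 1 / (n : ℝ) * ∑ i, ‖v i‖ ≤ 1 / (n : ℝ) * (n * C) := by gcongr
    _ = C := by field_simp

variable {W : Matrix (Fin n) (Fin n) ℝ} {ρ : ℝ}

lemma Network.col_sum (h : Network ρ W) (j : Fin n) : ∑ i, W i j = 1 := by
  rw [← h.row_sum j]
  refine Finset.sum_congr rfl fun i _ => ?_
  have := h.symm.apply j i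
  simpa using this

lemma Network.avg_mix (h : Network ρ W) (v : Fin n → Vec d) : avg (mix W v) = avg v := by
  simp only [avg, mix]
  rw [Finset.sum_comm]
  simp only [← Finset.sum_smul, h.col_sum, one_smul]

lemma Network.mix_const (h : Network ρ W) (a : Vec d) : mix W (fun _ => a) = fun _ => a := by
  funext i
  simp only [mix, ← Finset.sum_smul, h.row_sum, one_smul]

lemma mix_sub (a b : Fin n → Vec d) :
    mix W (fun i => a i - b i) = fun i => mix W a i - mix W b i := by
  funext i
  simp [mix, smul_sub, Finset.sum_sub_distrib]

lemma Network.dev_mix (h : Network ρ W) (v : Fin n → Vec d) : dev (mix W v) = mix W (dev v) := by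
  have : dev v = fun i => v i - (fun _ => avg v) i := rfl
  rw [this, mix_sub, h.mix_const]
  funext i
  simp only [dev, h.avg_mix]

/-- On vectors orthogonal to `(1, …, 1)` the weight matrix contracts by the factor `ρ`: the
eigenvector of the simple eigenvalue `1` spans the constants. -/
lemma Network.sum_sq_mulVec_le (h : Network ρ W) (h1 : ρ < 1) (v : Fin n → ℝ)
    (hv : ∑ i, v i = 0) : ∑ i, (∑ j, W i j * v j) ^ 2 ≤ ρ ^ 2 * ∑ i, v i ^ 2 := by
  classical
  rcases Nat.eq_zero_or_pos n with rfl | hn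
  · simp
  set e := h.symm.eigenvectorBasis with he
  set l := h.symm.eigenvalues with hl
  have hW : ∀ j, W.mulVec (e j) = l j • (e j : Fin n → ℝ) := h.symm.mulVec_eigenvectorBasis
  let φ := (Fintype.equivOfCardEq (Fintype.card_fin _) : Fin (Fintype.card (Fin n)) ≃ Fin n)
  have hl0 : ∀ j, l j = h.symm.eigenvalues₀ (φ.symm j) := fun j => rfl
  let j0 : Fin n := φ ⟨0, by simpa using hn⟩
  have hlj : ∀ j, j ≠ j0 → |l j| ≤ ρ := by
    intro j hj
    rw [hl0]
    refine h.gap _ (Nat.pos_of_ne_zero fun h0 => hj ?_)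
    have : φ.symm j = ⟨0, by simpa using hn⟩ := Fin.ext h0
    exact (φ.apply_symm_apply j).symm.trans (congrArg φ this)
  have hWsymm : ∀ i j, W i j = W j i := fun i j => by simpa using h.symm.apply j i
  -- moving the matrix to the other side of the inner product
  have hmove : ∀ (j : Fin n) (u : Fin n → ℝ),
      ∑ i, e j i * (∑ k, W i k * u k) = l j * ∑ i, e j i * u i := by
    intro j u
    have h2 : ∀ k, ∑ i, W k i * e j i = l j * e j k := fun k => by
      have := congrFun (hW j) k
      simpa [Matrix.mulVec, dotProduct] using this
    calc ∑ i, e j i * (∑ k, W i k * u k) = ∑ k, (∑ i, W k i * e j i) * u k := by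
          simp only [Finset.mul_sum, Finset.sum_mul]
          rw [Finset.sum_comm]
          refine Finset.sum_congr rfl fun k _ => Finset.sum_congr rfl fun i _ => ?_
          rw [hWsymm i k]; ring
      _ = l j * ∑ i, e j i * u i := by
          simp only [h2, Finset.mul_sum]
          exact Finset.sum_congr rfl fun k _ => by ring
  have hinner : ∀ (j : Fin n) (u : Fin n → ℝ),
      inner ℝ (e j) (WithLp.toLp 2 u) = ∑ i, e j i * u i := by
    intro j u
    simp [PiLp.inner_apply, mul_comm]
  have hone : ∀ j, j ≠ j0 → inner ℝ (e j) (WithLp.toLp 2 fun _ : Fin n => (1 : ℝ)) = 0 := by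
    intro j hj
    have := hmove j fun _ => 1
    simp only [mul_one, h.row_sum] at this
    rw [hinner]
    simp only [mul_one]
    have h3 := (abs_le.1 (hlj j hj)).2
    have h4 : (1 - l j) * ∑ i, e j i = 0 := by linarith
    rcases mul_eq_zero.1 h4 with h5 | h5
    · linarith
    · exact h5
  have hv0 : inner ℝ (e j0) (WithLp.toLp 2 v) = 0 := by
    have h5 := e.sum_inner_mul_inner (WithLp.toLp 2 fun _ : Fin n => (1 : ℝ)) (WithLp.toLp 2 v)
    have h6 : inner ℝ (WithLp.toLp 2 fun _ : Fin n => (1 : ℝ)) (WithLp.toLp 2 v) = 0 := by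
      simp [PiLp.inner_apply, hv]
    have h7 := e.sum_inner_mul_inner (WithLp.toLp 2 fun _ : Fin n => (1 : ℝ))
      (WithLp.toLp 2 fun _ : Fin n => (1 : ℝ))
    rw [h6, Finset.sum_eq_single j0] at h5
    · rw [Finset.sum_eq_single j0] at h7
      · rcases mul_eq_zero.1 h5 with h8 | h8
        · rw [h8, zero_mul] at h7
          have h9 : (n : ℝ) = 0 := by
            rw [h7, PiLp.inner_apply]; simp
          have : n = 0 := by exact_mod_cast h9
          omega
        · exact h8
      · intro j _ hj
        rw [hone j hj, mul_zero]
      · simp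
    · intro j _ hj
      rw [real_inner_comm, hone j hj, zero_mul]
    · simp
  have hpar : ∀ u : Fin n → ℝ, ∑ i, u i ^ 2 = ∑ j, (inner ℝ (e j) (WithLp.toLp 2 u)) ^ 2 := by
    intro u
    have := e.sum_sq_norm_inner_right (WithLp.toLp 2 u)
    simp only [Real.norm_eq_abs, sq_abs] at this
    rw [this, EuclideanSpace.norm_sq_eq]
    simp
  rw [hpar v, hpar fun i => ∑ j, W i j * v j, Finset.mul_sum]
  refine Finset.sum_le_sum fun j _ => ?_
  have h8 : inner ℝ (e j) (WithLp.toLp 2 fun i => ∑ k, W i k * v k)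
      = l j * inner ℝ (e j) (WithLp.toLp 2 v) := by
    rw [hinner, hmove, hinner]
  rw [h8, mul_pow]
  by_cases hj : j = j0
  · rw [hj, hv0]; simp
  · gcongr ?_ * _
    rw [← sq_abs]
    exact pow_le_pow_left₀ (abs_nonneg _) (hlj j hj) 2

/-- Mixing contracts the consensus error by the factor `ρ`. -/
lemma Network.sqn_mix_dev_le (h : Network ρ W) (h1 : ρ < 1) (hn : 0 < n) (v : Fin n → Vec d) :
    sqn (mix W (dev v)) ≤ ρ ^ 2 * sqn (dev v) := by
  have hcoord : ∀ u : Fin n → Vec d, sqn u = ∑ a, ∑ i, (u i a) ^ 2 := by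
    intro u
    rw [Finset.sum_comm]
    refine Finset.sum_congr rfl fun i _ => ?_
    rw [EuclideanSpace.norm_sq_eq]; simp
  rw [hcoord, hcoord, Finset.mul_sum]
  refine Finset.sum_le_sum fun a _ => ?_
  have h2 := h.sum_sq_mulVec_le h1 (fun i => dev v i a) (by
    have := congrArg (fun w : Vec d => w a) (sum_dev hn v)
    simpa using this)
  simpa [mix] using h2

/-- A step `v ↦ W v + w` in terms of the consensus error. -/
lemma Network.sqn_dev_mix_add_le (h : Network ρ W) (hn : 0 < n) (h0 : 0 < ρ) (h1 : ρ < 1)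
    (v w : Fin n → Vec d) :
    sqn (dev fun i => mix W v i + w i) ≤ ρ * sqn (dev v) + 1 / (1 - ρ) * sqn (dev w) := by
  rw [dev_add, h.dev_mix]
  exact sqn_add_le_contraction h0 h1 (h.sqn_mix_dev_le h1 hn v)

lemma Network.mono {ρ' : ℝ} (h : Network ρ W) (hρ : ρ ≤ ρ') : Network ρ' W :=
  ⟨h.symm, h.nonneg, h.row_sum, fun j hj => (h.gap j hj).trans hρ⟩

end Stacks

/-! ### Blocks of points, gradients and Hessians -/

section Blocks

variable {p q : ℕ}

/-- `fstBlock` as a continuous linear map. -/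
def fstL (p q : ℕ) : Pair p q →L[ℝ] Vec p :=
  LinearMap.toContinuousLinearMap
    { toFun := fstBlock, map_add' := fun _ _ => rfl, map_smul' := fun _ _ => rfl }

/-- `sndBlock` as a continuous linear map. -/
def sndL (p q : ℕ) : Pair p q →L[ℝ] Vec q :=
  LinearMap.toContinuousLinearMap
    { toFun := sndBlock, map_add' := fun _ _ => rfl, map_smul' := fun _ _ => rfl }

/-- The inclusion `x ↦ (x, 0)` as a continuous linear map. -/
def inlL (p q : ℕ) : Vec p →L[ℝ] Pair p q :=
  LinearMap.toContinuousLinearMap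
    { toFun := fun x => pair x 0
      map_add' := fun _ _ => by ext i; rcases i with i | i <;> simp [pair]
      map_smul' := fun _ _ => by ext i; rcases i with i | i <;> simp [pair] }

/-- The inclusion `y ↦ (0, y)` as a continuous linear map. -/
def inrL (p q : ℕ) : Vec q →L[ℝ] Pair p q :=
  LinearMap.toContinuousLinearMap
    { toFun := fun y => pair 0 y
      map_add' := fun _ _ => by ext i; rcases i with i | i <;> simp [pair]
      map_smul' := fun _ _ => by ext i; rcases i with i | i <;> simp [pair] }

lemma fstL_apply (z : Pair p q) : fstL p q z = fstBlock z := rfl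
lemma inlL_apply (x : Vec p) : inlL p q x = pair x 0 := rfl
lemma inrL_apply (y : Vec q) : inrL p q y = pair 0 y := rfl

lemma pair_eq (x : Vec p) (y : Vec q) : pair x y = inlL p q x + inrL p q y := by
  ext i; rcases i with i | i <;> simp [pair, inlL_apply, inrL_apply]

lemma pair_sub (x x' : Vec p) (y y' : Vec q) : pair x y - pair x' y' = pair (x - x') (y - y') := by
  ext i; rcases i with i | i <;> simp [pair]

lemma fstBlock_pair (x : Vec p) (y : Vec q) : fstBlock (pair x y) = x := by
  ext i; simp [pair, fstBlock]

lemma sndBlock_pair (x : Vec p) (y : Vec q) : sndBlock (pair x y) = y := by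
  ext i; simp [pair, sndBlock]

lemma inner_eq_blocks (z w : Pair p q) :
    inner ℝ z w = inner ℝ (fstBlock z) (fstBlock w) + inner ℝ (sndBlock z) (sndBlock w) := by
  simp only [PiLp.inner_apply, Fintype.sum_sum_type, fstBlock, sndBlock]

lemma norm_sq_eq_blocks (z : Pair p q) : ‖z‖ ^ 2 = ‖fstBlock z‖ ^ 2 + ‖sndBlock z‖ ^ 2 := by
  simp only [← real_inner_self_eq_norm_sq, inner_eq_blocks]

lemma norm_sq_pair (x : Vec p) (y : Vec q) : ‖pair x y‖ ^ 2 = ‖x‖ ^ 2 + ‖y‖ ^ 2 := by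
  rw [norm_sq_eq_blocks, fstBlock_pair, sndBlock_pair]

lemma norm_fstBlock_le (z : Pair p q) : ‖fstBlock z‖ ≤ ‖z‖ := by
  refine le_of_sq_le_sq ?_ (norm_nonneg _)
  rw [norm_sq_eq_blocks z]; have := sq_nonneg ‖sndBlock z‖; linarith

lemma norm_sndBlock_le (z : Pair p q) : ‖sndBlock z‖ ≤ ‖z‖ := by
  refine le_of_sq_le_sq ?_ (norm_nonneg _)
  rw [norm_sq_eq_blocks z]; have := sq_nonneg ‖fstBlock z‖; linarith

lemma norm_pair_zero_left (y : Vec q) : ‖pair (0 : Vec p) y‖ = ‖y‖ := by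
  have := norm_sq_pair (0 : Vec p) y
  rw [norm_zero, zero_pow two_ne_zero, zero_add] at this
  exact (sq_eq_sq₀ (norm_nonneg _) (norm_nonneg _)).1 this

lemma norm_pair_le (x : Vec p) (y : Vec q) : ‖pair x y‖ ≤ ‖x‖ + ‖y‖ := by
  refine le_of_sq_le_sq ?_ (by positivity)
  rw [norm_sq_pair]
  nlinarith [norm_nonneg x, norm_nonneg y]

lemma sndBlock_sub (z w : Pair p q) : sndBlock (z - w) = sndBlock z - sndBlock w := rfl
lemma fstBlock_sub (z w : Pair p q) : fstBlock (z - w) = fstBlock z - fstBlock w := rfl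

lemma inner_pair_zero_left (y : Vec q) (z : Pair p q) :
    inner ℝ (pair 0 y) z = inner ℝ y (sndBlock z) := by
  rw [inner_eq_blocks, fstBlock_pair, sndBlock_pair, inner_zero_left, zero_add]

end Blocks

section Functions

variable {p q : ℕ} {h : Pair p q → ℝ} {L : ℝ}

lemma IsLip.lipschitzWith {V H : Type*} [NormedAddCommGroup V] [NormedAddCommGroup H]
    {f : V → H} (hf : IsLip L f) : LipschitzWith (Real.toNNReal L) f := by
  refine LipschitzWith.of_dist_le' fun x y => ?_
  simpa [dist_eq_norm] using hf x y

lemma IsLip.norm_fderiv_le {V H : Type*} [NormedAddCommGroup V] [NormedAddCommGroup H]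
    [NormedSpace ℝ V] [NormedSpace ℝ H] {f : V → H} (hf : IsLip L f) (hL : 0 ≤ L) (z : V) :
    ‖fderiv ℝ f z‖ ≤ L := by
  have := norm_fderiv_le_of_lipschitz ℝ hf.lipschitzWith (x₀ := z)
  rwa [Real.coe_toNNReal _ hL] at this

lemma IsLip.norm_gradient_le (hf : IsLip L h) (hL : 0 ≤ L) (z : Pair p q) :
    ‖gradient h z‖ ≤ L := by
  rw [gradient, LinearIsometryEquiv.norm_map]
  exact hf.norm_fderiv_le hL z

lemma hessYMul_eq (h : Pair p q → ℝ) (z : Pair p q) (v : Vec q) :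
    hessYMul h z v = (sndL p q ∘L hess h z ∘L inrL p q) v := rfl

lemma jacXYMul_eq (h : Pair p q → ℝ) (z : Pair p q) (v : Vec q) :
    jacXYMul h z v = (fstL p q ∘L hess h z ∘L inrL p q) v := rfl

lemma hessYMul_sub (h : Pair p q → ℝ) (z : Pair p q) (v w : Vec q) :
    hessYMul h z (v - w) = hessYMul h z v - hessYMul h z w := by simp only [hessYMul_eq, map_sub]

lemma hessYMul_add (h : Pair p q → ℝ) (z : Pair p q) (v w : Vec q) :
    hessYMul h z (v + w) = hessYMul h z v + hessYMul h z w := by simp only [hessYMul_eq, map_add]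

lemma hessYMul_zero (h : Pair p q → ℝ) (z : Pair p q) : hessYMul h z 0 = 0 := by
  simp only [hessYMul_eq, map_zero]

lemma jacXYMul_sub (h : Pair p q → ℝ) (z : Pair p q) (v w : Vec q) :
    jacXYMul h z (v - w) = jacXYMul h z v - jacXYMul h z w := by simp only [jacXYMul_eq, map_sub]

lemma norm_hess_apply_le {h : Pair p q → ℝ} {z : Pair p q} (hL : ‖hess h z‖ ≤ L) (v : Vec q) :
    ‖hess h z (pair 0 v)‖ ≤ L * ‖v‖ := by
  refine ((hess h z).le_opNorm _).trans ?_
  rw [norm_pair_zero_left]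
  gcongr

lemma norm_hessYMul_le {h : Pair p q → ℝ} {z : Pair p q} (hL : ‖hess h z‖ ≤ L) (v : Vec q) :
    ‖hessYMul h z v‖ ≤ L * ‖v‖ := (norm_sndBlock_le _).trans (norm_hess_apply_le hL v)

lemma norm_jacXYMul_le {h : Pair p q → ℝ} {z : Pair p q} (hL : ‖hess h z‖ ≤ L) (v : Vec q) :
    ‖jacXYMul h z v‖ ≤ L * ‖v‖ := (norm_fstBlock_le _).trans (norm_hess_apply_le hL v)

lemma norm_hess_sub_apply_le {z z' : Pair p q} (hL : IsLip L (hess h)) (v : Vec q) :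
    ‖hess h z (pair 0 v) - hess h z' (pair 0 v)‖ ≤ L * ‖z - z'‖ * ‖v‖ := by
  rw [← _root_.sub_apply]
  refine ((hess h z - hess h z').le_opNorm _).trans ?_
  rw [norm_pair_zero_left]
  gcongr
  exact hL z z'

lemma norm_hessYMul_sub_le {z z' : Pair p q} (hL : IsLip L (hess h)) (v : Vec q) :
    ‖hessYMul h z v - hessYMul h z' v‖ ≤ L * ‖z - z'‖ * ‖v‖ :=
  (norm_sndBlock_le (hess h z (pair 0 v) - hess h z' (pair 0 v))).trans
    (norm_hess_sub_apply_le hL v)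

lemma norm_jacXYMul_sub_le {z z' : Pair p q} (hL : IsLip L (hess h)) (v : Vec q) :
    ‖jacXYMul h z v - jacXYMul h z' v‖ ≤ L * ‖z - z'‖ * ‖v‖ :=
  (norm_fstBlock_le (hess h z (pair 0 v) - hess h z' (pair 0 v))).trans
    (norm_hess_sub_apply_le hL v)

lemma hasFDerivAt_inner_gradient (hd : Differentiable ℝ h) (z : Pair p q) :
    HasFDerivAt h (InnerProductSpace.toDual ℝ _ (gradient h z)) z :=
  (hd z).hasGradientAt.hasFDerivAt

/-- The Hessian is symmetric. -/
lemma inner_hess_symm (hd : Differentiable ℝ h) (hd2 : Differentiable ℝ (gradient h))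
    (z u v : Pair p q) : inner ℝ (hess h z u) v = inner ℝ u (hess h z v) := by
  let ip := (isBoundedBilinearMap_inner (𝕜 := ℝ) (E := Pair p q)).toContinuousLinearMap
  have h0 : ∀ y, HasFDerivAt h (ip (gradient h y)) y := fun y =>
    (hasFDerivAt_inner_gradient hd y).congr_fderiv (by ext; rfl)
  have h1 : HasFDerivAt (fun y => ip (gradient h y)) (ip ∘L hess h z) z :=
    ip.hasFDerivAt.comp z (hd2 z).hasFDerivAt
  have := second_derivative_symmetric h0 h1 u v
  change inner ℝ (hess h z u) v = inner ℝ (hess h z v) u at this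
  rw [this, real_inner_comm]

lemma hasDerivAt_line (hd : Differentiable ℝ h) (z v : Pair p q) :
    HasDerivAt (fun t : ℝ => h (z + t • v)) (inner ℝ (gradient h z) v) 0 := by
  have h1 : HasDerivAt (fun t : ℝ => z + t • v) v 0 := by
    simpa using ((hasDerivAt_id (0 : ℝ)).smul_const v).const_add z
  have h2 := hasFDerivAt_inner_gradient hd z
  refine HasFDerivAt.comp_hasDerivAt_of_eq (f := fun t : ℝ => z + t • v) (0 : ℝ) h2 h1 ?_
  simp

lemma hasDerivAt_gradient_line (hd : Differentiable ℝ (gradient h)) (z v : Pair p q) :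
    HasDerivAt (fun t : ℝ => gradient h (z + t • v)) (hess h z v) 0 := by
  have h1 : HasDerivAt (fun t : ℝ => z + t • v) v 0 := by
    simpa using ((hasDerivAt_id (0 : ℝ)).smul_const v).const_add z
  have h2 := (hd z).hasFDerivAt
  refine HasFDerivAt.comp_hasDerivAt_of_eq (f := fun t : ℝ => z + t • v) (0 : ℝ) h2 h1 ?_
  simp

variable {μ : ℝ} {x : Vec p}

/-- The first-order lower bound of a function that is strongly convex in `y`. -/
lemma StrongConvexOn.le_of_gradY (hsc : StrongConvexOn Set.univ μ fun y => h (pair x y))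
    (hd : Differentiable ℝ h) (y y' : Vec q) :
    h (pair x y) + inner ℝ (gradY h (pair x y)) (y' - y) + μ / 2 * ‖y' - y‖ ^ 2
      ≤ h (pair x y') := by
  have h1 := hasDerivAt_line hd (pair x y) (pair 0 (y' - y))
  have hline : ∀ t : ℝ, pair x y + t • pair 0 (y' - y) = pair x (y + t • (y' - y)) := by
    intro t
    ext i; rcases i with i | i <;> simp [pair]
  have h2 : inner ℝ (gradient h (pair x y)) (pair 0 (y' - y))
      = inner ℝ (gradY h (pair x y)) (y' - y) := by
    rw [real_inner_comm, inner_pair_zero_left, real_inner_comm]; rfl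
  rw [h2] at h1
  have h3 := h1.tendsto_slope_zero_right
  have h4 : Filter.Tendsto (fun t : ℝ => h (pair x y') - h (pair x y)
      - (1 - t) * (μ / 2 * ‖y' - y‖ ^ 2)) (nhdsWithin 0 (Set.Ioi 0))
      (nhds (h (pair x y') - h (pair x y) - (1 - 0) * (μ / 2 * ‖y' - y‖ ^ 2))) := by
    refine Filter.Tendsto.mono_left ?_ nhdsWithin_le_nhds
    exact Continuous.tendsto (by fun_prop) 0
  have h5 := le_of_tendsto_of_tendsto h3 h4 (by
    filter_upwards [Ioo_mem_nhdsGT (show (0 : ℝ) < 1 by norm_num)] with t ht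
    have h6 := hsc.2 (Set.mem_univ y) (Set.mem_univ y') (show 0 ≤ 1 - t by linarith [ht.2]) ht.1.le
      (by ring)
    have h7 : (1 - t) • y + t • y' = y + t • (y' - y) := by module
    simp only [h7, smul_eq_mul] at h6
    have h8 : ‖y - y'‖ = ‖y' - y‖ := norm_sub_rev _ _
    rw [h8] at h6
    simp only [zero_add, hline, zero_smul, add_zero, smul_eq_mul]
    rw [inv_mul_le_iff₀ ht.1]
    linarith)
  linarith

/-- Strong monotonicity of the partial gradient. -/
lemma StrongConvexOn.inner_gradY_sub_ge (hsc : StrongConvexOn Set.univ μ fun y => h (pair x y))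
    (hd : Differentiable ℝ h) (y y' : Vec q) :
    μ * ‖y - y'‖ ^ 2 ≤ inner ℝ (gradY h (pair x y) - gradY h (pair x y')) (y - y') := by
  have h1 := StrongConvexOn.le_of_gradY hsc hd y y'
  have h2 := StrongConvexOn.le_of_gradY hsc hd y' y
  have h3 : ‖y' - y‖ = ‖y - y'‖ := norm_sub_rev _ _
  have h4 : inner ℝ (gradY h (pair x y)) (y' - y) = - inner ℝ (gradY h (pair x y)) (y - y') := by
    rw [← inner_neg_right, neg_sub]
  rw [h3, h4] at h1
  rw [inner_sub_left]
  linarith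

/-- The `yy` block of the Hessian is coercive. -/
lemma StrongConvexOn.inner_hessYMul_ge {y : Vec q}
    (hsc : StrongConvexOn Set.univ μ fun y => h (pair x y))
    (hd : Differentiable ℝ h) (hd2 : Differentiable ℝ (gradient h)) (v : Vec q) :
    μ * ‖v‖ ^ 2 ≤ inner ℝ v (hessYMul h (pair x y) v) := by
  have h1 := (hasDerivAt_gradient_line hd2 (pair x y) (pair 0 v)).tendsto_slope_zero_right
  have h2 : Filter.Tendsto (fun t : ℝ => inner ℝ (pair (0 : Vec p) v)
      (t⁻¹ • (gradient h (pair x y + (0 + t) • pair 0 v)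
        - gradient h (pair x y + (0 : ℝ) • pair 0 v))))
      (nhdsWithin 0 (Set.Ioi 0)) (nhds (inner ℝ (pair (0 : Vec p) v) (hess h (pair x y) (pair 0 v)))) :=
    Filter.Tendsto.inner tendsto_const_nhds h1
  rw [inner_pair_zero_left] at h2
  refine ge_of_tendsto h2 ?_
  filter_upwards [self_mem_nhdsWithin] with t ht
  have ht : 0 < t := ht
  have hline : pair x y + t • pair 0 v = pair x (y + t • v) := by
    ext i; rcases i with i | i <;> simp [pair]
  simp only [zero_add, zero_smul, add_zero, hline]
  have h3 := StrongConvexOn.inner_gradY_sub_ge hsc hd (y + t • v) y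
  have h4 : y + t • v - y = t • v := by abel
  rw [h4, norm_smul, Real.norm_eq_abs, abs_of_pos ht, inner_smul_right, real_inner_comm] at h3
  rw [inner_smul_right, inner_pair_zero_left, sndBlock_sub]
  change _ ≤ t⁻¹ * inner ℝ v (gradY h (pair x (y + t • v)) - gradY h (pair x y))
  have h5 : μ * (t * ‖v‖) ^ 2 = t * (t * (μ * ‖v‖ ^ 2)) := by ring
  rw [h5] at h3
  have h6 := le_of_mul_le_mul_left h3 ht
  rw [le_inv_mul_iff₀ ht]
  exact h6

end Functions

/-! ### The lower-level solution and the hypergradient -/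

section Hypergradient

variable {n p q : ℕ} {S : Type*} {R : Type*} [MeasurableSpace S] [MeasurableSpace R]
  {c : Constants} {B : Problem n p q S R}

lemma pair_blocks (z : Pair p q) : pair (fstBlock z) (sndBlock z) = z := by
  ext i; rcases i with i | i <;> simp [pair, fstBlock, sndBlock]

lemma norm_avg_le_of_le_mul {m d : ℕ} {v : Fin m → Vec d} {e : Fin m → ℝ} {C : ℝ}
    (h : ∀ i, ‖v i‖ ≤ C * e i) : ‖avg v‖ ≤ C * ((1 / (m : ℝ)) * ∑ i, e i) := by
  refine (norm_avg_le v).trans ?_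
  calc 1 / (m : ℝ) * ∑ i, ‖v i‖ ≤ 1 / (m : ℝ) * ∑ i, C * e i := by
        gcongr with i; exact h i
    _ = C * ((1 / (m : ℝ)) * ∑ i, e i) := by rw [← Finset.mul_sum]; ring

namespace Smooth

lemma norm_hess_le (hs : Smooth c B) (hc : c.Valid) (i : Fin n) (z : Pair p q) :
    ‖hess (B.g i) z‖ ≤ c.Lg1 := (hs.lip_grad_g i).norm_fderiv_le hc.Lg1_pos.le z

lemma norm_gradY_f_le (hs : Smooth c B) (hc : c.Valid) (i : Fin n) (z : Pair p q) :
    ‖gradY (B.f i) z‖ ≤ c.Lf0 :=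
  (norm_sndBlock_le _).trans ((hs.lip_f i).norm_gradient_le hc.Lf0_pos.le z)

lemma norm_gradX_f_le (hs : Smooth c B) (hc : c.Valid) (i : Fin n) (z : Pair p q) :
    ‖gradX (B.f i) z‖ ≤ c.Lf0 :=
  (norm_fstBlock_le _).trans ((hs.lip_f i).norm_gradient_le hc.Lf0_pos.le z)

lemma norm_gradY_f_sub_le (hs : Smooth c B) (i : Fin n) (z z' : Pair p q) :
    ‖gradY (B.f i) z - gradY (B.f i) z'‖ ≤ c.Lf1 * ‖z - z'‖ :=
  (norm_sndBlock_le (gradient (B.f i) z - gradient (B.f i) z')).trans (hs.lip_grad_f i z z')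

lemma norm_gradX_f_sub_le (hs : Smooth c B) (i : Fin n) (z z' : Pair p q) :
    ‖gradX (B.f i) z - gradX (B.f i) z'‖ ≤ c.Lf1 * ‖z - z'‖ :=
  (norm_fstBlock_le (gradient (B.f i) z - gradient (B.f i) z')).trans (hs.lip_grad_f i z z')

lemma norm_gradY_g_sub_le (hs : Smooth c B) (i : Fin n) (z z' : Pair p q) :
    ‖gradY (B.g i) z - gradY (B.g i) z'‖ ≤ c.Lg1 * ‖z - z'‖ :=
  (norm_sndBlock_le (gradient (B.g i) z - gradient (B.g i) z')).trans (hs.lip_grad_g i z z')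

lemma inner_hessYMul_ge (hs : Smooth c B) (i : Fin n) (z : Pair p q) (v : Vec q) :
    c.mu * ‖v‖ ^ 2 ≤ inner ℝ v (hessYMul (B.g i) z v) := by
  rw [← pair_blocks z]
  exact StrongConvexOn.inner_hessYMul_ge (hs.strong i _) (hs.diff_g i) (hs.diff_grad_g i) v

/-- A bound that holds for each term of an average of inner products. -/
lemma le_avg_of_le {m : ℕ} (hm : 0 < m) {a : ℝ} {e : Fin m → ℝ} (h : ∀ i, a ≤ e i) :
    a ≤ (1 / (m : ℝ)) * ∑ i, e i := by
  have hm' : (0 : ℝ) < m := by exact_mod_cast hm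
  have h1 : m * a ≤ ∑ i, e i := by
    simpa using Finset.card_nsmul_le_sum Finset.univ e a fun i _ => h i
  calc a = 1 / (m : ℝ) * (m * a) := by field_simp
    _ ≤ _ := by gcongr

lemma inner_avg_hessYMul_ge (hs : Smooth c B) (hn : 0 < n) (w : Fin n → Pair p q) (v : Vec q) :
    c.mu * ‖v‖ ^ 2 ≤ inner ℝ v (avg fun i => hessYMul (B.g i) (w i) v) := by
  rw [inner_avg]
  exact le_avg_of_le hn fun i => hs.inner_hessYMul_ge i _ v

lemma inner_avg_gradY_sub_ge (hs : Smooth c B) (hn : 0 < n) (x : Vec p) (y y' : Vec q) :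
    c.mu * ‖y - y'‖ ^ 2 ≤ inner ℝ (y - y') ((avg fun i => gradY (B.g i) (pair x y))
      - avg fun i => gradY (B.g i) (pair x y')) := by
  rw [← avg_sub, inner_avg]
  refine le_avg_of_le hn fun i => ?_
  rw [real_inner_comm]
  exact StrongConvexOn.inner_gradY_sub_ge (hs.strong i x) (hs.diff_g i) y y'

/-- The averaged `yy` block of the Hessians is onto, since it is coercive. -/
lemma exists_avg_hessYMul_eq (hs : Smooth c B) (hc : c.Valid) (hn : 0 < n) (w : Fin n → Pair p q)
    (b : Vec q) : ∃ z, (avg fun i => hessYMul (B.g i) (w i) z) = b := by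
  let A : Vec q →ₗ[ℝ] Vec q :=
    { toFun := fun z => avg fun i => hessYMul (B.g i) (w i) z
      map_add' := fun z z' => by simp only [hessYMul_add, avg_add]
      map_smul' := fun a z => by
        simp only [hessYMul_eq, map_smul, avg_smul, RingHom.id_apply] }
  have hinj : Function.Injective A := by
    rw [injective_iff_map_eq_zero]
    intro v hv
    have h := hs.inner_avg_hessYMul_ge hn w v
    change c.mu * ‖v‖ ^ 2 ≤ inner ℝ v (A v) at h
    rw [hv, inner_zero_right] at h
    have : ‖v‖ ^ 2 ≤ 0 := by
      by_contra h3
      have := mul_pos hc.mu_pos (not_le.1 h3)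
      linarith
    simpa using le_antisymm this (sq_nonneg _)
  exact (LinearMap.injective_iff_surjective.1 hinj) b

end Smooth

/-- The solution `z` of the averaged linear system `(∑ ∇_y² g_i (w_i)) z = ∑ ∇_y f_i (w_i)`, where
each agent `i` has its own point `w_i`. -/
def zSol (B : Problem n p q S R) (w : Fin n → Pair p q) : Vec q :=
  Classical.epsilon fun z =>
    (avg fun i => hessYMul (B.g i) (w i) z) = avg fun i => gradY (B.f i) (w i)

/-- The hypergradient formed from local points `w_i`; for `w_i = (x, y^*(x))` it is `∇Φ(x)`. -/
def hyperGrad (B : Problem n p q S R) (w : Fin n → Pair p q) : Vec p :=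
  avg fun i => gradX (B.f i) (w i) - jacXYMul (B.g i) (w i) (zSol B w)

/-- The average distance between two families of points. -/
def meanDist (w w' : Fin n → Pair p q) : ℝ := (1 / (n : ℝ)) * ∑ i, ‖w i - w' i‖

/-- A Lipschitz constant of `zSol`. -/
def Constants.Lz (c : Constants) : ℝ := (c.Lf1 + c.Lg2 * (c.Lf0 / c.mu)) / c.mu

/-- A Lipschitz constant of `hyperGrad`. -/
def Constants.Lh (c : Constants) : ℝ := c.Lf1 + c.Lg2 * (c.Lf0 / c.mu) + c.Lg1 * c.Lz

lemma Constants.Valid.Lz_pos (hc : c.Valid) : 0 < c.Lz := by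
  obtain ⟨h1, h2, h3, h4, h5, -⟩ := hc; unfold Constants.Lz; positivity

lemma Constants.Valid.Lh_pos (hc : c.Valid) : 0 < c.Lh := by
  have := hc.Lz_pos
  obtain ⟨h1, h2, h3, h4, h5, -⟩ := hc; unfold Constants.Lh; positivity

lemma meanDist_nonneg (w w' : Fin n → Pair p q) : 0 ≤ meanDist w w' := by
  unfold meanDist; positivity

lemma meanDist_sq_le (hn : 0 < n) (w w' : Fin n → Pair p q) :
    meanDist w w' ^ 2 ≤ sqn fun i => w i - w' i := by
  have hn' : (1 : ℝ) ≤ n := by exact_mod_cast hn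
  have h := sq_sum_le_card_mul_sum_sq (s := Finset.univ) (f := fun i => ‖w i - w' i‖)
  simp only [Finset.card_univ, Fintype.card_fin] at h
  rw [meanDist, mul_pow, div_pow, one_pow, div_mul_eq_mul_div, one_mul, div_le_iff₀ (by positivity)]
  refine h.trans ?_
  have h2 := sqn_nonneg fun i => w i - w' i
  have h3 : (n : ℝ) ≤ (n : ℝ) ^ 2 := by nlinarith
  rw [mul_comm (sqn _)]
  exact mul_le_mul_of_nonneg_right h3 h2

namespace Smooth

lemma zSol_spec (hs : Smooth c B) (hc : c.Valid) (hn : 0 < n) (w : Fin n → Pair p q) :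
    (avg fun i => hessYMul (B.g i) (w i) (zSol B w)) = avg fun i => gradY (B.f i) (w i) :=
  Classical.epsilon_spec (hs.exists_avg_hessYMul_eq hc hn w _)

lemma norm_zSol_le (hs : Smooth c B) (hc : c.Valid) (hn : 0 < n) (w : Fin n → Pair p q) :
    ‖zSol B w‖ ≤ c.Lf0 / c.mu := by
  have h := hs.inner_avg_hessYMul_ge hn w (zSol B w)
  rw [hs.zSol_spec hc hn] at h
  have h2 : inner ℝ (zSol B w) (avg fun i => gradY (B.f i) (w i)) ≤ ‖zSol B w‖ * c.Lf0 :=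
    (real_inner_le_norm _ _).trans (by
      gcongr; exact norm_avg_le_of_le hn fun i => hs.norm_gradY_f_le hc i _)
  rw [le_div_iff₀ hc.mu_pos]
  rcases eq_or_lt_of_le (norm_nonneg (zSol B w)) with h0 | h0
  · rw [← h0, zero_mul]; exact hc.Lf0_pos.le
  · refine le_of_mul_le_mul_left ?_ h0
    nlinarith

lemma norm_zSol_sub_le (hs : Smooth c B) (hc : c.Valid) (hn : 0 < n) (w w' : Fin n → Pair p q) :
    ‖zSol B w - zSol B w'‖ ≤ c.Lz * meanDist w w' := by
  set d := zSol B w - zSol B w' with hd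
  have h := hs.inner_avg_hessYMul_ge hn w d
  have h1 : (avg fun i => hessYMul (B.g i) (w i) d)
      = (avg fun i => gradY (B.f i) (w i) - gradY (B.f i) (w' i))
        - avg fun i => hessYMul (B.g i) (w i) (zSol B w') - hessYMul (B.g i) (w' i) (zSol B w') := by
    simp only [hd, hessYMul_sub, avg_sub, hs.zSol_spec hc hn]
    abel
  have h2 : ‖avg fun i => gradY (B.f i) (w i) - gradY (B.f i) (w' i)‖ ≤ c.Lf1 * meanDist w w' :=
    norm_avg_le_of_le_mul fun i => hs.norm_gradY_f_sub_le i _ _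
  have h3 : ‖avg fun i => hessYMul (B.g i) (w i) (zSol B w')
      - hessYMul (B.g i) (w' i) (zSol B w')‖ ≤ c.Lg2 * (c.Lf0 / c.mu) * meanDist w w' := by
    refine norm_avg_le_of_le_mul fun i => (norm_hessYMul_sub_le (hs.lip_hess_g i) _).trans ?_
    have := hs.norm_zSol_le hc hn w'
    have h4 := hc.Lg2_pos.le
    calc c.Lg2 * ‖w i - w' i‖ * ‖zSol B w'‖ ≤ c.Lg2 * ‖w i - w' i‖ * (c.Lf0 / c.mu) := by gcongr
      _ = _ := by ring
  have h4 : c.mu * ‖d‖ ^ 2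
      ≤ ‖d‖ * (c.Lf1 * meanDist w w' + c.Lg2 * (c.Lf0 / c.mu) * meanDist w w') := by
    refine h.trans ((real_inner_le_norm _ _).trans ?_)
    gcongr
    rw [h1]
    exact (norm_sub_le _ _).trans (add_le_add h2 h3)
  have hmd := meanDist_nonneg w w'
  rcases eq_or_lt_of_le (norm_nonneg d) with h0 | h0
  · rw [← h0]; exact mul_nonneg hc.Lz_pos.le hmd
  · have h5 : c.mu * ‖d‖ ≤ c.Lf1 * meanDist w w' + c.Lg2 * (c.Lf0 / c.mu) * meanDist w w' := by
      refine le_of_mul_le_mul_left ?_ h0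
      nlinarith
    have h6 : c.Lz * meanDist w w'
        = (c.Lf1 * meanDist w w' + c.Lg2 * (c.Lf0 / c.mu) * meanDist w w') / c.mu := by
      unfold Constants.Lz; ring
    rw [h6, le_div_iff₀ hc.mu_pos]
    linarith

/-- Replacing the solutions `zSol` by approximate ones perturbs the hypergradient in proportion. -/
lemma norm_avg_hypergrad_sub_le (hs : Smooth c B) (hc : c.Valid) (w : Fin n → Pair p q)
    (z : Fin n → Vec q) :
    ‖(avg fun i => gradX (B.f i) (w i) - jacXYMul (B.g i) (w i) (z i)) - hyperGrad B w‖
      ≤ c.Lg1 * ((1 / (n : ℝ)) * ∑ i, ‖z i - zSol B w‖) := by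
  rw [hyperGrad, ← avg_sub]
  refine norm_avg_le_of_le_mul fun i => ?_
  rw [sub_sub_sub_cancel_left, ← jacXYMul_sub, norm_sub_rev (z i)]
  exact norm_jacXYMul_le (hs.norm_hess_le hc i _) _

lemma norm_hyperGrad_sub_le (hs : Smooth c B) (hc : c.Valid) (hn : 0 < n)
    (w w' : Fin n → Pair p q) :
    ‖hyperGrad B w - hyperGrad B w'‖ ≤ c.Lh * meanDist w w' := by
  have h1 := hs.norm_avg_hypergrad_sub_le hc w fun _ => zSol B w'
  have h2 : ‖(avg fun i => gradX (B.f i) (w i) - jacXYMul (B.g i) (w i) (zSol B w'))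
      - hyperGrad B w'‖ ≤ (c.Lf1 + c.Lg2 * (c.Lf0 / c.mu)) * meanDist w w' := by
    rw [hyperGrad, ← avg_sub]
    refine norm_avg_le_of_le_mul fun i => ?_
    rw [sub_sub_sub_comm]
    refine (norm_sub_le _ _).trans ?_
    have h3 := hs.norm_gradX_f_sub_le i (w i) (w' i)
    have h4 := norm_jacXYMul_sub_le (z := w i) (z' := w' i) (hs.lip_hess_g i) (zSol B w')
    have h5 := hs.norm_zSol_le hc hn w'
    have h6 := hc.Lg2_pos.le
    have h7 : c.Lg2 * ‖w i - w' i‖ * ‖zSol B w'‖ ≤ c.Lg2 * ‖w i - w' i‖ * (c.Lf0 / c.mu) := by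
      gcongr
    nlinarith
  have h3 : (1 / (n : ℝ)) * ∑ _i : Fin n, ‖zSol B w' - zSol B w‖ = ‖zSol B w - zSol B w'‖ := by
    have : (n : ℝ) ≠ 0 := by positivity
    simp [norm_sub_rev (zSol B w'), this]
  rw [h3] at h1
  have h4 := hs.norm_zSol_sub_le hc hn w w'
  have h5 := mul_le_mul_of_nonneg_left h4 hc.Lg1_pos.le
  have h6 : hyperGrad B w - hyperGrad B w'
      = ((avg fun i => gradX (B.f i) (w i) - jacXYMul (B.g i) (w i) (zSol B w'))
        - hyperGrad B w')
        - ((avg fun i => gradX (B.f i) (w i) - jacXYMul (B.g i) (w i) (zSol B w'))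
        - hyperGrad B w) := by abel
  rw [h6]
  refine (norm_sub_le _ _).trans ?_
  unfold Constants.Lh
  nlinarith

lemma norm_hyperGrad_le (hs : Smooth c B) (hc : c.Valid) (hn : 0 < n) (w : Fin n → Pair p q) :
    ‖hyperGrad B w‖ ≤ c.Lf0 + c.Lg1 * (c.Lf0 / c.mu) := by
  refine norm_avg_le_of_le hn fun i => (norm_sub_le _ _).trans ?_
  refine add_le_add (hs.norm_gradX_f_le hc i _) ?_
  refine (norm_jacXYMul_le (hs.norm_hess_le hc i _) _).trans ?_
  have := hc.Lg1_pos.le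
  gcongr
  exact hs.norm_zSol_le hc hn w

/-! ### The lower-level minimizer and the gradient of `Φ` -/

lemma gBar_ge (hs : Smooth c B) (hn : 0 < n) (x : Vec p) (y y' : Vec q) :
    B.gBar (pair x y) + inner ℝ (avg fun i => gradY (B.g i) (pair x y)) (y' - y)
      + c.mu / 2 * ‖y' - y‖ ^ 2 ≤ B.gBar (pair x y') := by
  have hn' : (0 : ℝ) < n := by exact_mod_cast hn
  have h := le_avg_of_le hn (a := c.mu / 2 * ‖y' - y‖ ^ 2) (e := fun i => B.g i (pair x y')
    - B.g i (pair x y) - inner ℝ (y' - y) (gradY (B.g i) (pair x y))) fun i => by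
      have := StrongConvexOn.le_of_gradY (hs.strong i x) (hs.diff_g i) y y'
      rw [real_inner_comm] at this
      linarith
  rw [Finset.sum_sub_distrib, Finset.sum_sub_distrib] at h
  rw [real_inner_comm, inner_avg, Problem.gBar, Problem.gBar]
  linarith

lemma continuous_gBar (hs : Smooth c B) (x : Vec p) : Continuous fun y => B.gBar (pair x y) := by
  have h : Continuous fun y : Vec q => pair x y := by
    simp only [pair_eq]; fun_prop
  unfold Problem.gBar
  refine continuous_const.mul (continuous_finsetSum _ fun i _ => ?_)
  exact (hs.diff_g i).continuous.comp h

lemma yStar_spec (hs : Smooth c B) (hc : c.Valid) (hn : 0 < n) (x : Vec p) :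
    ∀ y', B.gBar (pair x (B.yStar x)) ≤ B.gBar (pair x y') := by
  refine Classical.epsilon_spec (p := fun y => ∀ y', B.gBar (pair x y) ≤ B.gBar (pair x y')) ?_
  refine (hs.continuous_gBar x).exists_forall_le ?_
  set g0 := avg fun i => gradY (B.g i) (pair x 0)
  have h : ∀ y, B.gBar (pair x 0) + ‖y‖ * (c.mu / 2 * ‖y‖ - ‖g0‖) ≤ B.gBar (pair x y) := by
    intro y
    have h1 := hs.gBar_ge hn x 0 y
    rw [sub_zero] at h1
    have h2 : -(‖g0‖ * ‖y‖) ≤ inner ℝ g0 y := neg_le_of_abs_le (abs_real_inner_le_norm _ _)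
    nlinarith
  refine Filter.tendsto_atTop_mono h ?_
  refine Filter.tendsto_atTop_add_const_left _ _ ?_
  have h3 : Filter.Tendsto (fun y : Vec q => ‖y‖) (Filter.cocompact _) Filter.atTop :=
    tendsto_norm_cocompact_atTop
  refine h3.atTop_mul_atTop₀ ?_
  refine Filter.tendsto_atTop_add_const_right _ (-‖g0‖) ?_
  exact h3.const_mul_atTop (half_pos hc.mu_pos)

/-- The first-order condition that characterizes `y^*`. -/
lemma avg_gradY_yStar (hs : Smooth c B) (hc : c.Valid) (hn : 0 < n) (x : Vec p) :
    (avg fun i => gradY (B.g i) (pair x (B.yStar x))) = 0 := by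
  set y := B.yStar x
  set v := avg fun i => gradY (B.g i) (pair x y) with hv
  -- the minimizer minimizes along the line in direction `v`
  have h1 : HasDerivAt (fun t : ℝ => B.gBar (pair x y + t • pair 0 v))
      ((1 / (n : ℝ)) * ∑ i, inner ℝ (gradient (B.g i) (pair x y)) (pair 0 v)) 0 := by
    refine HasDerivAt.const_mul _ (HasDerivAt.fun_sum fun i _ => ?_)
    exact hasDerivAt_line (hs.diff_g i) _ _
  have h2 : IsLocalMin (fun t : ℝ => B.gBar (pair x y + t • pair 0 v)) 0 := by
    refine Filter.Eventually.of_forall fun t => ?_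
    have hline : pair x y + t • pair 0 v = pair x (y + t • v) := by
      ext i; rcases i with i | i <;> simp [pair]
    simp only [hline, zero_smul, add_zero]
    exact hs.yStar_spec hc hn x _
  have h3 := h2.hasDerivAt_eq_zero h1
  have h4 : ∀ i, inner ℝ (gradient (B.g i) (pair x y)) (pair 0 v)
      = inner ℝ v (gradY (B.g i) (pair x y)) := fun i => by
    rw [real_inner_comm, inner_pair_zero_left]; rfl
  simp only [h4] at h3
  rw [← inner_avg, ← hv, real_inner_self_eq_norm_sq] at h3
  simpa using h3

/-- Lipschitz continuity of `y^*`. -/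
lemma norm_yStar_sub_le (hs : Smooth c B) (hc : c.Valid) (hn : 0 < n) (x x' : Vec p) :
    ‖B.yStar x - B.yStar x'‖ ≤ c.Lg1 / c.mu * ‖x - x'‖ := by
  set y := B.yStar x with hy
  set y' := B.yStar x' with hy'
  have h1 := hs.inner_avg_gradY_sub_ge hn x y y'
  have h2 : ((avg fun i => gradY (B.g i) (pair x y)) - avg fun i => gradY (B.g i) (pair x y'))
      = avg fun i => gradY (B.g i) (pair x' y') - gradY (B.g i) (pair x y') := by
    rw [avg_sub, hy, hy', hs.avg_gradY_yStar hc hn, hs.avg_gradY_yStar hc hn]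
  have h3 : ‖avg fun i => gradY (B.g i) (pair x' y') - gradY (B.g i) (pair x y')‖
      ≤ c.Lg1 * ‖x - x'‖ := by
    refine norm_avg_le_of_le hn fun i => (hs.norm_gradY_g_sub_le i _ _).trans ?_
    have := hc.Lg1_pos.le
    gcongr
    rw [pair_sub, sub_self]
    refine (norm_pair_le _ _).trans ?_
    rw [norm_zero, add_zero, norm_sub_rev]
  have h4 : c.mu * ‖y - y'‖ ^ 2 ≤ ‖y - y'‖ * (c.Lg1 * ‖x - x'‖) := by
    refine h1.trans ((real_inner_le_norm _ _).trans ?_)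
    rw [h2]; gcongr
  rw [div_mul_eq_mul_div, le_div_iff₀ hc.mu_pos]
  rcases eq_or_lt_of_le (norm_nonneg (y - y')) with h0 | h0
  · rw [← h0, zero_mul]; have := hc.Lg1_pos; positivity
  · refine le_of_mul_le_mul_left ?_ h0
    nlinarith

/-- A Lipschitz constant of `x ↦ (x, y^*(x))`. -/
def _root_.DSBO.Constants.Lw (c : Constants) : ℝ := 1 + c.Lg1 / c.mu

lemma _root_.DSBO.Constants.Valid.Lw_pos (hc : c.Valid) : 0 < c.Lw := by
  obtain ⟨h1, h2, h3, h4, h5, -⟩ := hc; unfold Constants.Lw; positivity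

lemma norm_pair_yStar_sub_le (hs : Smooth c B) (hc : c.Valid) (hn : 0 < n) (x x' : Vec p) :
    ‖pair x (B.yStar x) - pair x' (B.yStar x')‖ ≤ c.Lw * ‖x - x'‖ := by
  rw [pair_sub]
  refine (norm_pair_le _ _).trans ?_
  have := hs.norm_yStar_sub_le hc hn x x'
  unfold Constants.Lw; linarith

/-- The implicit differentiation formula: `∇Φ(x)` is the hypergradient at `(x, y^*(x))`. The
differential of `y^*` is not needed: testing the increment of `∇_y g`, which vanishes along
`(x, y^*(x))`, against `zSol` expresses the `y` part of the increment of `f` through the `x` part. -/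
lemma hasGradientAt_Phi (hs : Smooth c B) (hc : c.Valid) (hn : 0 < n) (x : Vec p) :
    HasGradientAt B.Phi (hyperGrad B fun _ => pair x (B.yStar x)) x := by
  set Z : Vec p → Pair p q := fun x' => pair x' (B.yStar x') with hZ
  set z := zSol B fun _ => Z x with hz
  rw [hasGradientAt_iff_isLittleO]
  have hZO : (fun x' => Z x' - Z x) =O[nhds x] fun x' => x' - x :=
    Asymptotics.IsBigO.of_bound c.Lw (Filter.Eventually.of_forall fun x' =>
      hs.norm_pair_yStar_sub_le hc hn x' x)
  have hZt : Filter.Tendsto Z (nhds x) (nhds (Z x)) := by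
    have : LipschitzWith (Real.toNNReal c.Lw) Z := IsLip.lipschitzWith (L := c.Lw) fun x' x'' =>
      hs.norm_pair_yStar_sub_le hc hn x' x''
    exact this.continuous.tendsto x
  have h1 : ∀ i, (fun x' => B.f i (Z x') - B.f i (Z x)
      - inner ℝ (gradient (B.f i) (Z x)) (Z x' - Z x)) =o[nhds x] fun x' => x' - x := by
    intro i
    have := (hasFDerivAt_inner_gradient (hs.diff_f i) (Z x)).isLittleO
    exact (this.comp_tendsto hZt).trans_isBigO hZO
  have h2 : ∀ i, (fun x' => inner ℝ (pair 0 z) (gradient (B.g i) (Z x') - gradient (B.g i) (Z x)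
      - hess (B.g i) (Z x) (Z x' - Z x))) =o[nhds x] fun x' => x' - x := by
    intro i
    have := ((hs.diff_grad_g i) (Z x)).hasFDerivAt.isLittleO
    have h3 := (this.comp_tendsto hZt).trans_isBigO hZO
    refine Asymptotics.IsBigO.trans_isLittleO ?_ h3
    refine Asymptotics.IsBigO.of_bound ‖pair (0 : Vec p) z‖ (Filter.Eventually.of_forall fun x' => ?_)
    exact norm_inner_le_norm _ _
  have h3 : (fun x' => (1 / (n : ℝ)) * ∑ i, ((B.f i (Z x') - B.f i (Z x)
      - inner ℝ (gradient (B.f i) (Z x)) (Z x' - Z x))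
      - inner ℝ (pair 0 z) (gradient (B.g i) (Z x') - gradient (B.g i) (Z x)
      - hess (B.g i) (Z x) (Z x' - Z x)))) =o[nhds x] fun x' => x' - x := by
    refine Asymptotics.IsLittleO.const_mul_left ?_ _
    exact Asymptotics.IsLittleO.fun_sum fun i _ => (h1 i).sub (h2 i)
  refine h3.congr_left fun x' => ?_
  have hgrad : ∀ x'', (1 / (n : ℝ)) * ∑ i, inner ℝ (pair 0 z) (gradient (B.g i) (Z x'')) = 0 := by
    intro x''
    simp only [inner_pair_zero_left]
    have := hs.avg_gradY_yStar hc hn x''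
    have h5 := inner_avg z fun i => gradY (B.g i) (pair x'' (B.yStar x''))
    rw [this, inner_zero_right] at h5
    exact h5.symm
  have hterm : ∀ i, inner ℝ (gradient (B.f i) (Z x)) (Z x' - Z x)
      - inner ℝ (pair 0 z) (hess (B.g i) (Z x) (Z x' - Z x))
      = inner ℝ (x' - x) (gradX (B.f i) (Z x) - jacXYMul (B.g i) (Z x) z)
        + inner ℝ (B.yStar x' - B.yStar x) (gradY (B.f i) (Z x) - hessYMul (B.g i) (Z x) z) := by
    intro i
    rw [← inner_hess_symm (hs.diff_g i) (hs.diff_grad_g i), ← inner_sub_left, real_inner_comm,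
      inner_eq_blocks]
    simp only [hZ, pair_sub, fstBlock_pair, sndBlock_pair]
    rfl
  have hsum : (1 / (n : ℝ)) * ∑ i, (inner ℝ (gradient (B.f i) (Z x)) (Z x' - Z x)
      - inner ℝ (pair 0 z) (hess (B.g i) (Z x) (Z x' - Z x)))
      = inner ℝ (hyperGrad B fun _ => Z x) (x' - x) := by
    simp only [hterm]
    rw [Finset.sum_add_distrib, mul_add, ← inner_avg, ← inner_avg, avg_sub (fun i => gradY _ _),
      hs.zSol_spec hc hn, sub_self, inner_zero_right, add_zero, real_inner_comm]
    rfl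
  have hg1 := hgrad x'
  have hg2 := hgrad x
  rw [← hsum]
  simp only [Problem.Phi, inner_sub_right, Finset.sum_sub_distrib, mul_sub] at hg1 hg2 ⊢
  linarith

lemma differentiable_Phi (hs : Smooth c B) (hc : c.Valid) (hn : 0 < n) :
    Differentiable ℝ B.Phi := fun x => (hs.hasGradientAt_Phi hc hn x).differentiableAt

lemma gradient_Phi (hs : Smooth c B) (hc : c.Valid) (hn : 0 < n) (x : Vec p) :
    gradient B.Phi x = hyperGrad B fun _ => pair x (B.yStar x) :=
  (hs.hasGradientAt_Phi hc hn x).gradient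

/-- A Lipschitz constant of `∇Φ`. -/
def _root_.DSBO.Constants.LPhi (c : Constants) : ℝ := c.Lh * c.Lw

lemma _root_.DSBO.Constants.Valid.LPhi_pos (hc : c.Valid) : 0 < c.LPhi :=
  mul_pos hc.Lh_pos hc.Lw_pos

/-- A bound for `‖∇Φ‖`. -/
def _root_.DSBO.Constants.GPhi (c : Constants) : ℝ := c.Lf0 + c.Lg1 * (c.Lf0 / c.mu)

lemma norm_gradient_Phi_le (hs : Smooth c B) (hc : c.Valid) (hn : 0 < n) (x : Vec p) :
    ‖gradient B.Phi x‖ ≤ c.GPhi := by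
  rw [hs.gradient_Phi hc hn]; exact hs.norm_hyperGrad_le hc hn _

lemma isLip_gradient_Phi (hs : Smooth c B) (hc : c.Valid) (hn : 0 < n) :
    IsLip c.LPhi (gradient B.Phi) := by
  intro x x'
  rw [hs.gradient_Phi hc hn, hs.gradient_Phi hc hn]
  refine (hs.norm_hyperGrad_sub_le hc hn _ _).trans ?_
  have hn' : (n : ℝ) ≠ 0 := by positivity
  have : meanDist (fun _ : Fin n => pair x (B.yStar x)) (fun _ => pair x' (B.yStar x'))
      = ‖pair x (B.yStar x) - pair x' (B.yStar x')‖ := by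
    simp [meanDist, hn']
  rw [this, Constants.LPhi, mul_assoc]
  exact mul_le_mul_of_nonneg_left (hs.norm_pair_yStar_sub_le hc hn x x') hc.Lh_pos.le

/-- The descent inequality for `Φ`. -/
lemma Phi_le (hs : Smooth c B) (hc : c.Valid) (hn : 0 < n) (x x' : Vec p) :
    B.Phi x' ≤ B.Phi x + inner ℝ (gradient B.Phi x) (x' - x) + c.LPhi * ‖x' - x‖ ^ 2 := by
  have h := (convex_segment x x').norm_image_sub_le_of_norm_hasFDerivWithin_le' (𝕜 := ℝ)
    (f := B.Phi) (φ := InnerProductSpace.toDual ℝ (Vec p) (gradient B.Phi x))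
    (f' := fun y => InnerProductSpace.toDual ℝ (Vec p) (gradient B.Phi y))
    (C := c.LPhi * ‖x' - x‖)
    (fun y _ => ((hs.differentiable_Phi hc hn y).hasGradientAt.hasFDerivAt).hasFDerivWithinAt)
    (fun y hy => by
      rw [← map_sub, LinearIsometryEquiv.norm_map]
      refine (hs.isLip_gradient_Phi hc hn y x).trans ?_
      have := hc.LPhi_pos.le
      gcongr
      obtain ⟨a, b, ha, hb, hab, rfl⟩ := hy
      have : a • x + b • x' - x = b • (x' - x) := by
        rw [← eq_sub_iff_add_eq] at hab; subst hab; module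
      rw [this, norm_smul, Real.norm_eq_abs, abs_of_nonneg hb]
      have : b ≤ 1 := by linarith
      nlinarith [norm_nonneg (x' - x)])
    (left_mem_segment ℝ x x') (right_mem_segment ℝ x x')
  have h2 := (abs_le.1 (Real.norm_eq_abs _ ▸ h)).2
  simp only [InnerProductSpace.toDual_apply_apply] at h2
  nlinarith

end Smooth

end Hypergradient

/-! ### Square-integrable families -/

section MemL2

variable {Ω : Type*} {m0 : MeasurableSpace Ω} {P : Measure Ω} {n d : ℕ}

/-- Every member of the random family `Y` is square-integrable. -/
def MemL2 (P : Measure Ω) (Y : Ω → Fin n → Vec d) : Prop := ∀ i, MemLp (fun ω => Y ω i) 2 P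

lemma integrable_norm_sq {E : Type*} [NormedAddCommGroup E] {Y : Ω → E} (h : MemLp Y 2 P) :
    Integrable (fun ω => ‖Y ω‖ ^ 2) P :=
  (memLp_two_iff_integrable_sq_norm h.1).1 h

lemma integrable_inner {E : Type*} [NormedAddCommGroup E] [InnerProductSpace ℝ E] {Y Z : Ω → E}
    (hY : MemLp Y 2 P) (hZ : MemLp Z 2 P) : Integrable (fun ω => inner ℝ (Y ω) (Z ω)) P := by
  refine ((integrable_norm_sq hY).add (integrable_norm_sq hZ)).mono' (hY.1.inner hZ.1)
    (Filter.Eventually.of_forall fun ω => ?_)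
  refine (norm_inner_le_norm _ _).trans ?_
  simp only [Pi.add_apply]
  nlinarith [sq_nonneg (‖Y ω‖ - ‖Z ω‖), sq_nonneg ‖Y ω‖, sq_nonneg ‖Z ω‖]

lemma MemL2.add {Y Z : Ω → Fin n → Vec d} (hY : MemL2 P Y) (hZ : MemL2 P Z) :
    MemL2 P fun ω i => Y ω i + Z ω i := fun i => (hY i).add (hZ i)

lemma MemL2.sub {Y Z : Ω → Fin n → Vec d} (hY : MemL2 P Y) (hZ : MemL2 P Z) :
    MemL2 P fun ω i => Y ω i - Z ω i := fun i => (hY i).sub (hZ i)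

lemma MemL2.smul {Y : Ω → Fin n → Vec d} (hY : MemL2 P Y) (a : ℝ) :
    MemL2 P fun ω i => a • Y ω i := fun i => (hY i).const_smul a

lemma MemL2.mix {Y : Ω → Fin n → Vec d} (hY : MemL2 P Y) (W : Matrix (Fin n) (Fin n) ℝ) :
    MemL2 P fun ω => mix W (Y ω) := fun i =>
  memLp_finsetSum Finset.univ fun j _ => (hY j).const_smul (W i j)

lemma MemL2.avg {Y : Ω → Fin n → Vec d} (hY : MemL2 P Y) : MemLp (fun ω => avg (Y ω)) 2 P :=
  (memLp_finsetSum Finset.univ fun j _ => hY j).const_smul (1 / (n : ℝ))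

lemma MemL2.dev {Y : Ω → Fin n → Vec d} (hY : MemL2 P Y) : MemL2 P fun ω => dev (Y ω) :=
  fun i => (hY i).sub hY.avg

lemma MemL2.integrable_sqn {Y : Ω → Fin n → Vec d} (hY : MemL2 P Y) :
    Integrable (fun ω => sqn (Y ω)) P :=
  integrable_finsetSum Finset.univ fun i _ => integrable_norm_sq (hY i)

/-- Pythagoras for square-integrable random vectors with vanishing correlation. -/
lemma integral_norm_add_sq_of_orthogonal {E : Type*} [NormedAddCommGroup E]
    [InnerProductSpace ℝ E] {Y Z : Ω → E} (hY : MemLp Y 2 P) (hZ : MemLp Z 2 P)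
    (h : ∫ ω, inner ℝ (Y ω) (Z ω) ∂P = 0) :
    ∫ ω, ‖Y ω + Z ω‖ ^ 2 ∂P = ∫ ω, ‖Y ω‖ ^ 2 ∂P + ∫ ω, ‖Z ω‖ ^ 2 ∂P := by
  simp only [norm_add_sq_real]
  have h1 := integrable_norm_sq hY
  have h2 := (integrable_inner hY hZ).const_mul 2
  have h3 := integrable_norm_sq hZ
  rw [integral_add (f := fun ω => ‖Y ω‖ ^ 2 + 2 * inner ℝ (Y ω) (Z ω)) (h1.add h2) h3,
    integral_add h1 h2, integral_const_mul, h]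
  ring

/-- Integration of a pointwise bound by a linear combination of three integrable functions. -/
lemma integral_le_of_le₃ [IsProbabilityMeasure P] {f g₁ g₂ g₃ : Ω → ℝ} {a₁ a₂ a₃ e : ℝ}
    (hf : Integrable f P) (h₁ : Integrable g₁ P) (h₂ : Integrable g₂ P) (h₃ : Integrable g₃ P)
    (h : ∀ ω, f ω ≤ a₁ * g₁ ω + a₂ * g₂ ω + a₃ * g₃ ω + e) :
    ∫ ω, f ω ∂P ≤ a₁ * ∫ ω, g₁ ω ∂P + a₂ * ∫ ω, g₂ ω ∂P + a₃ * ∫ ω, g₃ ω ∂P + e := by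
  have i₁ := h₁.const_mul a₁
  have i₂ := h₂.const_mul a₂
  have i₃ := h₃.const_mul a₃
  have i₁₂ : Integrable (fun ω => a₁ * g₁ ω + a₂ * g₂ ω) P := i₁.add i₂
  have i₁₃ : Integrable (fun ω => a₁ * g₁ ω + a₂ * g₂ ω + a₃ * g₃ ω) P := i₁₂.add i₃
  have i : Integrable (fun ω => a₁ * g₁ ω + a₂ * g₂ ω + a₃ * g₃ ω + e) P :=
    i₁₃.add (integrable_const e)
  have h0 := integral_mono hf i h
  rw [integral_add i₁₃ (integrable_const e), integral_add i₁₂ i₃, integral_add i₁ i₂,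
    integral_const_mul, integral_const_mul, integral_const_mul] at h0
  simpa using h0

lemma integral_le_of_le₂ [IsProbabilityMeasure P] {f g₁ g₂ : Ω → ℝ} {a₁ a₂ e : ℝ}
    (hf : Integrable f P) (h₁ : Integrable g₁ P) (h₂ : Integrable g₂ P)
    (h : ∀ ω, f ω ≤ a₁ * g₁ ω + a₂ * g₂ ω + e) :
    ∫ ω, f ω ∂P ≤ a₁ * ∫ ω, g₁ ω ∂P + a₂ * ∫ ω, g₂ ω ∂P + e := by
  have := integral_le_of_le₃ (a₃ := 0) (e := e) hf h₁ h₂ (integrable_const (0 : ℝ))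
    (fun ω => by simpa using h ω)
  simpa using this

lemma integral_le_of_le₁ [IsProbabilityMeasure P] {f g₁ : Ω → ℝ} {a₁ e : ℝ}
    (hf : Integrable f P) (h₁ : Integrable g₁ P) (h : ∀ ω, f ω ≤ a₁ * g₁ ω + e) :
    ∫ ω, f ω ∂P ≤ a₁ * ∫ ω, g₁ ω ∂P + e := by
  have := integral_le_of_le₂ (a₂ := 0) (e := e) hf h₁ (integrable_const (0 : ℝ))
    (fun ω => by simpa using h ω)
  simpa using this

end MemL2

/-! ### Gradient tracking with multiplicative noise -/

/-- All the smallness conditions on a step size are linear. -/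
lemma exists_pos_forall_mul_le (a e : Fin 8 → ℝ) (he : ∀ i, 0 < e i) :
    ∃ x : ℝ, 0 < x ∧ ∀ i, x * a i ≤ e i := by
  have key : ∀ i, ∀ᶠ x in nhdsWithin (0 : ℝ) (Set.Ioi 0), x * a i ≤ e i := by
    intro i
    have : Filter.Tendsto (fun x : ℝ => x * a i) (nhdsWithin 0 (Set.Ioi 0)) (nhds (0 * a i)) :=
      (Continuous.tendsto (by fun_prop) 0).mono_left nhdsWithin_le_nhds
    rw [zero_mul] at this
    exact this.eventually_le_const (he i)
  have h0 : ∀ᶠ x in nhdsWithin (0 : ℝ) (Set.Ioi 0), 0 < x := self_mem_nhdsWithin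
  exact (h0.and (Filter.eventually_all.2 key)).exists

/-- The weighted sum of the three errors of gradient tracking contracts: `Z` is the error of the
average, `C` the consensus error and `D` the tracking error. -/
lemma tracking_contraction {μ L σ ρ cs w b γ : ℝ} (hμ : 0 < μ) (hcs : 0 < cs) (hρ : ρ = 1 - w)
    (hw0 : 0 < w) (hb0 : 0 < b) (hbc : b * (2 * cs / w) = μ / 16) (hγ : 0 < γ)
    (g3 : γ * σ ^ 2 ≤ μ / 4) (g4 : γ * (6 * L ^ 2 / μ + μ / 4) ≤ 1)
    (g5 : γ * (6 * L ^ 2 / μ + μ / 4 + 3 * μ / 16) ≤ w / 2) (g6 : γ ≤ 1)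
    (g7 : γ * (1 / (w * b) + 2 * cs / w ^ 2) ≤ w / 2) (g8 : γ * (μ / 8) ≤ w / 2)
    {Z C D Z' C' D' τ₁ τ₂ : ℝ} (hZ : 0 ≤ Z) (hC : 0 ≤ C) (hD : 0 ≤ D) (hτ₁ : 0 ≤ τ₁)
    (hτ₂ : 0 ≤ τ₂)
    (eZ : Z' ≤ (1 - γ * μ / 2 + γ ^ 2 * σ ^ 2) * Z
      + (6 * γ * L ^ 2 / μ + γ ^ 2 * σ ^ 2) * C + τ₁)
    (eC : C' ≤ ρ * C + 1 / w * γ ^ 2 * D)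
    (eD : D' ≤ ρ * D + 1 / w * (2 * (cs * (Z' + C') + τ₂) + 2 * (cs * (Z + C) + τ₂))) :
    Z' + C' + b * γ * D' ≤ (1 - γ * μ / 8) * (Z + C + b * γ * D)
      + (1 + b * γ * (2 * cs / w) + b * γ * (4 / w)) * (τ₁ + τ₂) := by
  obtain ⟨k, hk⟩ : ∃ k, k = 6 * L ^ 2 / μ + μ / 4 := ⟨_, rfl⟩
  have hk0 : 0 < k := by rw [hk]; positivity
  rw [← hk] at g4 g5
  have hcγ : γ * (γ * σ ^ 2) ≤ γ * (μ / 4) := mul_le_mul_of_nonneg_left g3 hγ.le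
  have eZ' : Z' ≤ (1 - γ * μ / 4) * Z + γ * k * C + τ₁ := by
    have e1 : (1 - γ * μ / 2 + γ ^ 2 * σ ^ 2) * Z ≤ (1 - γ * μ / 4) * Z :=
      mul_le_mul_of_nonneg_right (by linarith) hZ
    have e2 : (6 * γ * L ^ 2 / μ + γ ^ 2 * σ ^ 2) * C ≤ γ * k * C := by
      refine mul_le_mul_of_nonneg_right ?_ hC
      have : γ * k = 6 * γ * L ^ 2 / μ + γ * (μ / 4) := by rw [hk]; ring
      linarith
    linarith
  have hsum : Z' + C' + (Z + C) ≤ 2 * Z + (2 + γ * k) * C + γ ^ 2 / w * D + τ₁ := by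
    have h1 : 0 ≤ γ * μ / 4 * Z := by positivity
    have h2 : 1 / w * γ ^ 2 * D = γ ^ 2 / w * D := by ring
    have h3 : ρ * C = C - w * C := by rw [hρ]; ring
    have h4 : 0 ≤ w * C := by positivity
    linarith
  have eD' : D' ≤ ρ * D + 2 * cs / w * (2 * Z + (2 + γ * k) * C + γ ^ 2 / w * D + τ₁)
      + 4 / w * τ₂ := by
    have e1 : 1 / w * (2 * (cs * (Z' + C') + τ₂) + 2 * (cs * (Z + C) + τ₂))
        = 2 * cs / w * (Z' + C' + (Z + C)) + 4 / w * τ₂ := by ring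
    have e2 := mul_le_mul_of_nonneg_left hsum (show 0 ≤ 2 * cs / w by positivity)
    linarith
  have eDb := mul_le_mul_of_nonneg_left eD' (show 0 ≤ b * γ by positivity)
  have hexp : b * γ * (ρ * D + 2 * cs / w * (2 * Z + (2 + γ * k) * C + γ ^ 2 / w * D + τ₁)
      + 4 / w * τ₂) = γ * (μ / 8) * Z + γ * (μ / 16) * (2 + γ * k) * C
        + b * γ * (ρ + 2 * cs / w * (γ ^ 2 / w)) * D
        + b * γ * (2 * cs / w) * τ₁ + b * γ * (4 / w) * τ₂ := by
    linear_combination (γ * (2 * Z + (2 + γ * k) * C)) * hbc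
  have cC : (ρ + γ * k + γ * (μ / 16) * (2 + γ * k)) * C ≤ (1 - γ * μ / 8) * C := by
    refine mul_le_mul_of_nonneg_right ?_ hC
    have : γ * (μ / 16) * (γ * k) ≤ γ * (μ / 16) * 1 :=
      mul_le_mul_of_nonneg_left g4 (by positivity)
    linarith
  have cD : γ ^ 2 / w * D + b * γ * (ρ + 2 * cs / w * (γ ^ 2 / w)) * D
      ≤ (1 - γ * μ / 8) * (b * γ * D) := by
    have e1 : γ ^ 2 / w * D + b * γ * (ρ + 2 * cs / w * (γ ^ 2 / w)) * D
        = (γ * (1 / (w * b)) + ρ + γ * (γ * (2 * cs / w ^ 2))) * (b * γ * D) := by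
      field_simp; ring
    rw [e1]
    refine mul_le_mul_of_nonneg_right ?_ (by positivity)
    have e2 : γ * (γ * (2 * cs / w ^ 2)) ≤ 1 * (γ * (2 * cs / w ^ 2)) :=
      mul_le_mul_of_nonneg_right g6 (by positivity)
    linarith
  have t1 : 0 ≤ b * γ * (2 * cs / w) * τ₂ := by positivity
  have t2 : 0 ≤ b * γ * (4 / w) * τ₁ := by positivity
  have eC2 : 1 / w * γ ^ 2 * D = γ ^ 2 / w * D := by ring
  linarith

/-- For all small `γ` the weighted sum `Z + C + b γ D` of the errors of gradient tracking contracts,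
because the loop `Z → D → C → Z` of their mutual influence has gain `O(γ)`. -/
lemma exists_tracking_contraction {μ L σ ρ cs : ℝ} (hμ : 0 < μ) (hcs : 0 < cs) (hρ1 : ρ < 1) :
    ∃ γ₀ b : ℝ, 0 < γ₀ ∧ 0 < b ∧ γ₀ * L ^ 2 ≤ μ ∧ γ₀ * μ ≤ 1 ∧ ∀ γ, 0 < γ → γ ≤ γ₀ →
      ∃ cV : ℝ, 0 < cV ∧ ∀ (Z C D Z' C' D' τ₁ τ₂ : ℝ), 0 ≤ Z → 0 ≤ C → 0 ≤ D → 0 ≤ τ₁ →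
        0 ≤ τ₂ →
        Z' ≤ (1 - γ * μ / 2 + γ ^ 2 * σ ^ 2) * Z + (6 * γ * L ^ 2 / μ + γ ^ 2 * σ ^ 2) * C + τ₁ →
        C' ≤ ρ * C + 1 / (1 - ρ) * γ ^ 2 * D →
        D' ≤ ρ * D + 1 / (1 - ρ) * (2 * (cs * (Z' + C') + τ₂) + 2 * (cs * (Z + C) + τ₂)) →
        Z' + C' + b * γ * D' ≤ (1 - γ * μ / 8) * (Z + C + b * γ * D) + cV * (τ₁ + τ₂) := by
  obtain ⟨w, hw⟩ : ∃ w, w = 1 - ρ := ⟨_, rfl⟩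
  have hw0 : 0 < w := by linarith
  obtain ⟨b, hb⟩ : ∃ b, b = μ * w / (32 * cs) := ⟨_, rfl⟩
  have hb0 : 0 < b := by rw [hb]; positivity
  have hbc : b * (2 * cs / w) = μ / 16 := by rw [hb]; field_simp; norm_num
  obtain ⟨γ₀, hγ₀, h⟩ := exists_pos_forall_mul_le
    ![L ^ 2, μ, σ ^ 2, 6 * L ^ 2 / μ + μ / 4, 6 * L ^ 2 / μ + μ / 4 + 3 * μ / 16, 1,
      1 / (w * b) + 2 * cs / w ^ 2, μ / 8]
    ![μ, 1, μ / 4, 1, w / 2, 1, w / 2, w / 2] (by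
      intro i; fin_cases i <;> simp <;> linarith)
  have g1 : γ₀ * L ^ 2 ≤ μ := h 0
  have g2 : γ₀ * μ ≤ 1 := h 1
  have g3 : γ₀ * σ ^ 2 ≤ μ / 4 := h 2
  have g4 : γ₀ * (6 * L ^ 2 / μ + μ / 4) ≤ 1 := h 3
  have g5 : γ₀ * (6 * L ^ 2 / μ + μ / 4 + 3 * μ / 16) ≤ w / 2 := h 4
  have g6 : γ₀ * 1 ≤ 1 := h 5
  have g7 : γ₀ * (1 / (w * b) + 2 * cs / w ^ 2) ≤ w / 2 := h 6
  have g8 : γ₀ * (μ / 8) ≤ w / 2 := h 7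
  refine ⟨γ₀, b, hγ₀, hb0, g1, g2, fun γ hγ hγγ => ?_⟩
  have down : ∀ {a e : ℝ}, 0 ≤ a → γ₀ * a ≤ e → γ * a ≤ e := fun ha h =>
    (mul_le_mul_of_nonneg_right hγγ ha).trans h
  refine ⟨1 + b * γ * (2 * cs / w) + b * γ * (4 / w), by positivity, ?_⟩
  intro Z C D Z' C' D' τ₁ τ₂ hZ hC hD hτ₁ hτ₂ eZ eC eD
  rw [← hw] at eC eD
  exact tracking_contraction hμ hcs (by linarith) hw0 hb0 hbc hγ (down (sq_nonneg σ) g3)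
    (down (by positivity) g4) (down (by positivity) g5) (by linarith)
    (down (by positivity) g7) (down (by positivity) g8) hZ hC hD hτ₁ hτ₂ eZ eC eD

lemma geometric_bound {V : ℕ → ℝ} {θ τ : ℝ} (h0 : 0 ≤ θ) (h1 : θ < 1)
    (h : ∀ t, V (t + 1) ≤ θ * V t + τ) (hτ : 0 ≤ τ) (t : ℕ) :
    V t ≤ θ ^ t * V 0 + τ / (1 - θ) := by
  have hp : 0 < 1 - θ := by linarith
  induction t with
  | zero => simp; positivity
  | succ t ih =>
    have h2 := mul_le_mul_of_nonneg_left ih h0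
    have h3 : θ * (τ / (1 - θ)) + τ = τ / (1 - θ) := by field_simp; ring
    have h4 : θ ^ (t + 1) * V 0 = θ * (θ ^ t * V 0) := by ring
    linarith [h t]

/-- One step of the averaged iterate for coercive local operators `H_i`. -/
lemma avg_step_le {n q : ℕ} (hn : 0 < n) {μ L γ : ℝ} (hμ : 0 < μ) (hγ : 0 < γ)
    (hγL : γ * L ^ 2 ≤ μ) (hγμ : γ * μ ≤ 1) (H : Fin n → Vec q →L[ℝ] Vec q)
    (hL : ∀ i v, ‖H i v‖ ≤ L * ‖v‖)
    (hco : ∀ v, μ * ‖v‖ ^ 2 ≤ inner ℝ v (avg fun i => H i v)) (z b : Fin n → Vec q) :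
    n * ‖avg z - γ • avg (fun i => H i (z i) - b i)‖ ^ 2
      ≤ (1 - γ * μ / 2) * (n * ‖avg z‖ ^ 2)
        + 3 * γ / μ * (2 * L ^ 2 * sqn (dev z) + 2 * sqn b) := by
  set a := avg z with ha
  set u := a - γ • avg (fun i => H i a) with hu
  set w := avg (fun i => b i - H i (dev z i)) with hw
  have e1 : a - γ • avg (fun i => H i (z i) - b i) = u + γ • w := by
    have : ∀ i, H i (z i) = H i a + H i (dev z i) := fun i => by
      rw [← map_add]; simp [dev, ha]
    simp only [hu, hw, this, avg_sub, avg_add, smul_sub, smul_add]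
    abel
  have hu2 : ‖u‖ ^ 2 ≤ (1 - γ * μ) * ‖a‖ ^ 2 := by
    rw [hu, norm_sub_sq_real, inner_smul_right, norm_smul, mul_pow, Real.norm_eq_abs, sq_abs]
    have h1 := hco a
    have h2 : ‖avg fun i => H i a‖ ^ 2 ≤ (L * ‖a‖) ^ 2 :=
      pow_le_pow_left₀ (norm_nonneg _) (norm_avg_le_of_le hn fun i => hL i a) 2
    have h3 : γ ^ 2 * ‖avg fun i => H i a‖ ^ 2 ≤ γ ^ 2 * (L * ‖a‖) ^ 2 := by gcongr
    have h4 : γ ^ 2 * (L * ‖a‖) ^ 2 = γ * (γ * L ^ 2) * ‖a‖ ^ 2 := by ring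
    have h5 : γ * (γ * L ^ 2) * ‖a‖ ^ 2 ≤ γ * μ * ‖a‖ ^ 2 := by gcongr
    nlinarith
  have hw2 : n * ‖w‖ ^ 2 ≤ 2 * L ^ 2 * sqn (dev z) + 2 * sqn b := by
    refine (norm_avg_sq_le hn _).trans ((sqn_sub_le_two _ _).trans ?_)
    have := sqn_le_mul (a := fun i => H i (dev z i)) (b := dev z) fun i => hL i (dev z i)
    linarith
  have hy := norm_add_sq_le_young (show 0 < γ * μ / 2 by positivity) u (γ • w)
  rw [norm_smul, mul_pow, Real.norm_eq_abs, sq_abs] at hy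
  have c1 : (1 + γ * μ / 2) * ‖u‖ ^ 2 ≤ (1 - γ * μ / 2) * ‖a‖ ^ 2 := by
    have := mul_le_mul_of_nonneg_left hu2 (show 0 ≤ 1 + γ * μ / 2 by positivity)
    have h6 : 0 ≤ (γ * μ) ^ 2 * ‖a‖ ^ 2 := by positivity
    nlinarith
  have c2 : (1 + 1 / (γ * μ / 2)) * (γ ^ 2 * ‖w‖ ^ 2) ≤ 3 * γ / μ * ‖w‖ ^ 2 := by
    have h7 : (1 + 1 / (γ * μ / 2)) * (γ ^ 2 * ‖w‖ ^ 2) = (γ * μ + 2) * (γ / μ * ‖w‖ ^ 2) := by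
      field_simp
    have h8 : 0 ≤ γ / μ * ‖w‖ ^ 2 := by positivity
    have h9 : 3 * γ / μ * ‖w‖ ^ 2 = 3 * (γ / μ * ‖w‖ ^ 2) := by ring
    rw [h7, h9]
    exact mul_le_mul_of_nonneg_right (by linarith) h8
  rw [e1]
  have hn0 : (0 : ℝ) ≤ n := by positivity
  have h10 := mul_le_mul_of_nonneg_left (hy.trans (add_le_add c1 c2)) hn0
  have h11 := mul_le_mul_of_nonneg_left hw2 (show 0 ≤ 3 * γ / μ by positivity)
  refine h10.trans ?_
  nlinarith

/-- A realization of noisy gradient tracking for the system `(∑ H_i) z = ∑ b_i` on a probability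
space: `z` are the iterates, `s` the local residuals with noise `η`, and `d` tracks the average
of `s`. -/
structure Tracking {Ω : Type*} [MeasurableSpace Ω] (P : Measure Ω) {n q : ℕ}
    (W : Matrix (Fin n) (Fin n) ℝ) (γ μ L σ τ : ℝ) (H : Ω → Fin n → Vec q →L[ℝ] Vec q)
    (b : Ω → Fin n → Vec q) (z d s η : ℕ → Ω → Fin n → Vec q) : Prop where
  step_z : ∀ t ω i, z (t + 1) ω i = mix W (z t ω) i - γ • d t ω i
  step_d : ∀ t ω i, d (t + 1) ω i = mix W (d t ω) i + s (t + 1) ω i - s t ω i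
  avg_zero : ∀ ω, avg (d 0 ω) = avg (s 0 ω)
  residual : ∀ t ω i, s t ω i = H ω i (z t ω i) - b ω i + η t ω i
  norm_le : ∀ ω i v, ‖H ω i v‖ ≤ L * ‖v‖
  coercive : ∀ ω v, μ * ‖v‖ ^ 2 ≤ inner ℝ v (avg fun i => H ω i v)
  sqn_b_le : ∀ ω, sqn (b ω) ≤ τ
  memL2_z : ∀ t, MemL2 P (z t)
  memL2_d : ∀ t, MemL2 P (d t)
  memL2_s : ∀ t, MemL2 P (s t)
  memL2_noise : ∀ t, MemL2 P (η t)
  noise_le : ∀ t, ∫ ω, sqn (η t ω) ∂P ≤ σ ^ 2 * ∫ ω, sqn (z t ω) ∂P + τ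
  orthogonal : ∀ t, ∫ ω, inner ℝ (avg (z t ω) - γ • avg (fun i => s t ω i - η t ω i))
    (avg (η t ω)) ∂P = 0

namespace Tracking

variable {Ω : Type*} [MeasurableSpace Ω] {P : Measure Ω} {n q : ℕ}
  {W : Matrix (Fin n) (Fin n) ℝ} {γ μ L σ τ ρ : ℝ} {H : Ω → Fin n → Vec q →L[ℝ] Vec q}
  {b : Ω → Fin n → Vec q} {z d s η : ℕ → Ω → Fin n → Vec q}

/-- The invariant of gradient tracking: the trackers `d` average to the mean residual. -/
lemma avg_d_eq (h : Tracking P W γ μ L σ τ H b z d s η) (hW : Network ρ W) (t : ℕ) (ω : Ω) :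
    avg (d t ω) = avg (s t ω) := by
  induction t with
  | zero => exact h.avg_zero ω
  | succ t ih =>
    have : d (t + 1) ω = fun i => mix W (d t ω) i + s (t + 1) ω i - s t ω i :=
      funext (h.step_d t ω)
    rw [this, avg_sub, avg_add]
    change avg (mix W (d t ω)) + _ - _ = _
    rw [hW.avg_mix, ih]; abel

/-- The averaged iterate contracts in mean square, up to consensus error and noise. The noise is
orthogonal to the rest of the step, so it enters only at order `γ²`. -/
lemma integral_avg_step_le [IsProbabilityMeasure P]
    (h : Tracking P W γ μ L σ τ H b z d s η) (hW : Network ρ W)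
    (hn : 0 < n) (hμ : 0 < μ) (hγ : 0 < γ) (hγL : γ * L ^ 2 ≤ μ) (hγμ : γ * μ ≤ 1)
    (t : ℕ) :
    ∫ ω, n * ‖avg (z (t + 1) ω)‖ ^ 2 ∂P
      ≤ (1 - γ * μ / 2 + γ ^ 2 * σ ^ 2) * ∫ ω, n * ‖avg (z t ω)‖ ^ 2 ∂P
        + (6 * γ * L ^ 2 / μ + γ ^ 2 * σ ^ 2) * ∫ ω, sqn (dev (z t ω)) ∂P
        + (6 * γ / μ + γ ^ 2) * τ := by
  have hz := h.memL2_z t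
  have hη := h.memL2_noise t
  have hm : MemL2 P fun ω i => s t ω i - η t ω i := (h.memL2_s t).sub hη
  have hY : MemLp (fun ω => avg (z t ω) - γ • avg (fun i => s t ω i - η t ω i)) 2 P :=
    hz.avg.sub (hm.avg.const_smul γ)
  have hE : ∀ ω, avg (z (t + 1) ω)
      = (avg (z t ω) - γ • avg (fun i => s t ω i - η t ω i)) + (-γ) • avg (η t ω) := by
    intro ω
    have : z (t + 1) ω = fun i => mix W (z t ω) i - γ • d t ω i := funext (h.step_z t ω)
    rw [this, avg_sub, avg_smul, h.avg_d_eq hW, avg_sub]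
    change avg (mix W (z t ω)) - _ = _
    rw [hW.avg_mix]; module
  have hpyth := integral_norm_add_sq_of_orthogonal (Z := fun ω => (-γ) • avg (η t ω)) hY
    (hη.avg.const_smul (-γ)) (by
    simp only [inner_smul_right, integral_const_mul, h.orthogonal t, mul_zero])
  have hpt : ∀ ω, n * ‖avg (z t ω) - γ • avg (fun i => s t ω i - η t ω i)‖ ^ 2
      ≤ (1 - γ * μ / 2) * (n * ‖avg (z t ω)‖ ^ 2)
        + 3 * γ / μ * (2 * L ^ 2 * sqn (dev (z t ω)) + 2 * τ) := by
    intro ω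
    have h1 := avg_step_le hn hμ hγ hγL hγμ (H ω) (h.norm_le ω) (h.coercive ω) (z t ω) (b ω)
    have h2 : (fun i => s t ω i - η t ω i) = fun i => H ω i (z t ω i) - b ω i := by
      funext i; rw [h.residual]; abel
    rw [h2]
    refine h1.trans ?_
    have := h.sqn_b_le ω
    gcongr
  have hi1 : Integrable (fun ω => (n : ℝ) * ‖avg (z t ω)‖ ^ 2) P :=
    (integrable_norm_sq hz.avg).const_mul _
  have hi2 : Integrable (fun ω => sqn (dev (z t ω))) P := hz.dev.integrable_sqn
  have hint : ∫ ω, n * ‖avg (z t ω) - γ • avg (fun i => s t ω i - η t ω i)‖ ^ 2 ∂P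
      ≤ (1 - γ * μ / 2) * ∫ ω, n * ‖avg (z t ω)‖ ^ 2 ∂P
        + 3 * γ / μ * (2 * L ^ 2 * ∫ ω, sqn (dev (z t ω)) ∂P + 2 * τ) := by
    have h3 := integral_le_of_le₂ (a₁ := 1 - γ * μ / 2) (a₂ := 3 * γ / μ * (2 * L ^ 2))
      (e := 3 * γ / μ * (2 * τ)) ((integrable_norm_sq hY).const_mul (n : ℝ)) hi1 hi2
      (fun ω => (hpt ω).trans (le_of_eq (by ring)))
    exact h3.trans (le_of_eq (by ring))
  have hnoise : n * ∫ ω, ‖(-γ) • avg (η t ω)‖ ^ 2 ∂P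
      ≤ γ ^ 2 * (σ ^ 2 * (∫ ω, n * ‖avg (z t ω)‖ ^ 2 ∂P + ∫ ω, sqn (dev (z t ω)) ∂P) + τ) := by
    have h4 : ∫ ω, sqn (z t ω) ∂P
        = ∫ ω, n * ‖avg (z t ω)‖ ^ 2 ∂P + ∫ ω, sqn (dev (z t ω)) ∂P := by
      rw [← integral_add hi1 hi2]
      exact integral_congr_ae (Filter.Eventually.of_forall fun ω => sqn_eq_avg_add_dev hn _)
    rw [← h4]
    refine le_trans ?_ (mul_le_mul_of_nonneg_left (h.noise_le t) (sq_nonneg γ))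
    rw [← integral_const_mul, ← integral_const_mul]
    refine integral_mono ((integrable_norm_sq (hη.avg.const_smul (-γ))).const_mul _)
      (hη.integrable_sqn.const_mul _) fun ω => ?_
    rw [norm_smul, mul_pow, norm_neg, Real.norm_eq_abs, sq_abs]
    have := mul_le_mul_of_nonneg_left (norm_avg_sq_le hn (η t ω)) (sq_nonneg γ)
    linarith
  have hfin : ∫ ω, n * ‖avg (z (t + 1) ω)‖ ^ 2 ∂P
      = ∫ ω, n * ‖avg (z t ω) - γ • avg (fun i => s t ω i - η t ω i)‖ ^ 2 ∂P
        + n * ∫ ω, ‖(-γ) • avg (η t ω)‖ ^ 2 ∂P := by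
    simp only [hE, integral_const_mul]
    rw [hpyth]; ring
  rw [hfin]
  refine (add_le_add hint hnoise).trans (le_of_eq ?_)
  ring

lemma integral_dev_z_le [IsProbabilityMeasure P]
    (h : Tracking P W γ μ L σ τ H b z d s η) (hW : Network ρ W) (hn : 0 < n) (h0 : 0 < ρ) (h1 : ρ < 1) (t : ℕ) :
    ∫ ω, sqn (dev (z (t + 1) ω)) ∂P ≤ ρ * ∫ ω, sqn (dev (z t ω)) ∂P
      + 1 / (1 - ρ) * γ ^ 2 * ∫ ω, sqn (dev (d t ω)) ∂P := by
  have hi1 := (h.memL2_z t).dev.integrable_sqn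
  have hi2 := (h.memL2_d t).dev.integrable_sqn
  have key := integral_le_of_le₂ (a₁ := ρ) (a₂ := 1 / (1 - ρ) * γ ^ 2) (e := 0)
    (h.memL2_z (t + 1)).dev.integrable_sqn hi1 hi2 (fun ω => ?_)
  · exact key.trans (le_of_eq (by ring))
  have h2 := hW.sqn_dev_mix_add_le hn h0 h1 (z t ω) fun i => (-γ) • d t ω i
  rw [dev_smul, sqn_smul, neg_sq, ← mul_assoc] at h2
  have : z (t + 1) ω = fun i => mix W (z t ω) i + (-γ) • d t ω i := by
    funext i; rw [h.step_z]; module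
  rw [this]
  exact h2.trans (le_of_eq (by ring))

lemma integral_sqn_s_le [IsProbabilityMeasure P] (h : Tracking P W γ μ L σ τ H b z d s η) (t : ℕ) :
    ∫ ω, sqn (s t ω) ∂P ≤ (4 * L ^ 2 + 2 * σ ^ 2) * ∫ ω, sqn (z t ω) ∂P + 6 * τ := by
  have hi1 := (h.memL2_z t).integrable_sqn
  have hi2 := (h.memL2_noise t).integrable_sqn
  have hpt : ∀ ω, sqn (s t ω) ≤ 4 * L ^ 2 * sqn (z t ω) + 4 * τ + 2 * sqn (η t ω) := by
    intro ω
    have e : s t ω = fun i => (H ω i (z t ω i) - b ω i) + η t ω i := funext (h.residual t ω)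
    have h1 := sqn_add_le_two (fun i => H ω i (z t ω i) - b ω i) (η t ω)
    have h2 := sqn_sub_le_two (fun i => H ω i (z t ω i)) (b ω)
    have h3 := sqn_le_mul (a := fun i => H ω i (z t ω i)) (b := z t ω) fun i => h.norm_le ω i _
    have h4 := h.sqn_b_le ω
    rw [e]; linarith
  have h5 := integral_le_of_le₂ (a₁ := 4 * L ^ 2) (a₂ := 2) (e := 4 * τ)
    (h.memL2_s t).integrable_sqn hi1 hi2 (fun ω => (hpt ω).trans (le_of_eq (by ring)))
  have := h.noise_le t
  linarith

lemma integral_dev_d_le [IsProbabilityMeasure P]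
    (h : Tracking P W γ μ L σ τ H b z d s η) (hW : Network ρ W) (hn : 0 < n) (h0 : 0 < ρ) (h1 : ρ < 1) (t : ℕ) :
    ∫ ω, sqn (dev (d (t + 1) ω)) ∂P ≤ ρ * ∫ ω, sqn (dev (d t ω)) ∂P
      + 1 / (1 - ρ) * (2 * ∫ ω, sqn (s (t + 1) ω) ∂P + 2 * ∫ ω, sqn (s t ω) ∂P) := by
  have hi1 := (h.memL2_d t).dev.integrable_sqn
  have hi2 := (h.memL2_s t).integrable_sqn
  have hi3 := (h.memL2_s (t + 1)).integrable_sqn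
  have key := integral_le_of_le₃ (a₁ := ρ) (a₂ := 1 / (1 - ρ) * 2) (a₃ := 1 / (1 - ρ) * 2) (e := 0)
    (h.memL2_d (t + 1)).dev.integrable_sqn hi1 hi3 hi2 (fun ω => ?_)
  · exact key.trans (le_of_eq (by ring))
  have h2 := hW.sqn_dev_mix_add_le hn h0 h1 (d t ω) fun i => s (t + 1) ω i - s t ω i
  have e : d (t + 1) ω = fun i => mix W (d t ω) i + (s (t + 1) ω i - s t ω i) := by
    funext i; rw [h.step_d]; abel
  rw [e]
  refine h2.trans ?_
  have h3 := (sqn_dev_le hn fun i => s (t + 1) ω i - s t ω i).trans (sqn_sub_le_two _ _)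
  have h4 : 0 < 1 / (1 - ρ) := one_div_pos.2 (by linarith)
  have h5 := mul_le_mul_of_nonneg_left h3 h4.le
  linarith

end Tracking

/-- Noisy gradient tracking with step size `γ` forgets its initial state at the geometric rate `θ`,
up to a multiple of the bound `τ` for the data and the additive noise. -/
def TrackingBound.{u} (μ L σ ρ γ θ A : ℝ) : Prop :=
  ∀ {Ω : Type u} [MeasurableSpace Ω] (P : Measure Ω) [IsProbabilityMeasure P] {n q : ℕ}
    (_ : 0 < n) {W : Matrix (Fin n) (Fin n) ℝ} (_ : Network ρ W) {τ : ℝ} (_ : 0 ≤ τ)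
    {H : Ω → Fin n → Vec q →L[ℝ] Vec q} {b : Ω → Fin n → Vec q}
    {z d s η : ℕ → Ω → Fin n → Vec q} (_ : Tracking P W γ μ L σ τ H b z d s η) (t : ℕ),
    ∫ ω, sqn (z t ω) ∂P ≤ A * (θ ^ t * (∫ ω, sqn (z 0 ω) ∂P + ∫ ω, sqn (d 0 ω) ∂P) + τ)

/-- For small `γ` a weighted sum of the mean-square errors of the averaged iterate, the consensus
and the trackers contracts, which gives the tracking bound. -/
theorem exists_trackingBound.{u} {μ L σ ρ : ℝ} (hμ : 0 < μ) (hL : 0 < L) (hρ0 : 0 < ρ)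
    (hρ1 : ρ < 1) : ∃ γ₀ : ℝ, 0 < γ₀ ∧ ∀ γ, 0 < γ → γ ≤ γ₀ →
      ∃ θ A : ℝ, 0 < θ ∧ θ < 1 ∧ 0 < A ∧ TrackingBound.{u} μ L σ ρ γ θ A := by
  obtain ⟨γ₀, b₀, hγ₀, hb₀, g1, g2, hrec⟩ := exists_tracking_contraction (μ := μ) (L := L) (σ := σ)
    (ρ := ρ) (cs := 4 * L ^ 2 + 2 * σ ^ 2) hμ (by positivity) hρ1
  refine ⟨γ₀, hγ₀, fun γ hγ hγγ => ?_⟩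
  obtain ⟨cV, hcV, hrec⟩ := hrec γ hγ hγγ
  have g1' : γ * L ^ 2 ≤ μ := (mul_le_mul_of_nonneg_right hγγ (sq_nonneg L)).trans g1
  have g2' : γ * μ ≤ 1 := (mul_le_mul_of_nonneg_right hγγ hμ.le).trans g2
  set θ := 1 - γ * μ / 8 with hθ
  have hθ0 : 0 < θ := by linarith
  have hθ1 : θ < 1 := by have := mul_pos hγ hμ; linarith
  have h1θ : 0 < 1 - θ := by linarith
  set c1 := cV * ((6 * γ / μ + γ ^ 2) + 6) / (1 - θ) with hc1
  have hc10 : 0 < c1 := by positivity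
  refine ⟨θ, 1 + b₀ * γ + c1, hθ0, hθ1, by positivity, ?_⟩
  intro Ω _ P _ n q hn W hW τ hτ H b z d s η h t
  have hsplit : ∀ t, ∫ ω, sqn (z t ω) ∂P
      = ∫ ω, n * ‖avg (z t ω)‖ ^ 2 ∂P + ∫ ω, sqn (dev (z t ω)) ∂P := by
    intro t
    rw [← integral_add ((integrable_norm_sq (h.memL2_z t).avg).const_mul _)
      (h.memL2_z t).dev.integrable_sqn]
    exact integral_congr_ae (Filter.Eventually.of_forall fun ω => sqn_eq_avg_add_dev hn _)
  have hnn : ∀ Y : Ω → Fin n → Vec q, 0 ≤ ∫ ω, sqn (Y ω) ∂P := fun Y =>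
    integral_nonneg fun ω => sqn_nonneg _
  set V : ℕ → ℝ := fun t => ∫ ω, n * ‖avg (z t ω)‖ ^ 2 ∂P + ∫ ω, sqn (dev (z t ω)) ∂P
    + b₀ * γ * ∫ ω, sqn (dev (d t ω)) ∂P with hV
  have hstep : ∀ t, V (t + 1) ≤ θ * V t + cV * ((6 * γ / μ + γ ^ 2) * τ + 6 * τ) := by
    intro t
    refine hrec _ _ _ _ _ _ _ _ (integral_nonneg fun ω => by positivity) (hnn _) (hnn _)
      (by positivity) (by positivity)
      (h.integral_avg_step_le hW hn hμ hγ g1' g2' t) (h.integral_dev_z_le hW hn hρ0 hρ1 t) ?_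
    refine (h.integral_dev_d_le hW hn hρ0 hρ1 t).trans ?_
    have h1 := h.integral_sqn_s_le t
    have h2 := h.integral_sqn_s_le (t + 1)
    rw [hsplit] at h1 h2
    have h3 : 0 < 1 - ρ := by linarith
    gcongr
  have hbd := geometric_bound hθ0.le hθ1 hstep (by positivity) t
  have hV0 : V 0 ≤ (1 + b₀ * γ) * (∫ ω, sqn (z 0 ω) ∂P + ∫ ω, sqn (d 0 ω) ∂P) := by
    simp only [hV]
    rw [← hsplit]
    have h1 : ∫ ω, sqn (dev (d 0 ω)) ∂P ≤ ∫ ω, sqn (d 0 ω) ∂P :=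
      integral_mono (h.memL2_d 0).dev.integrable_sqn (h.memL2_d 0).integrable_sqn fun ω =>
        sqn_dev_le hn _
    have h2 := hnn (z 0)
    have h3 := hnn (d 0)
    have h4 : b₀ * γ * ∫ ω, sqn (dev (d 0 ω)) ∂P ≤ b₀ * γ * ∫ ω, sqn (d 0 ω) ∂P := by gcongr
    have h5 : 0 ≤ b₀ * γ * ∫ ω, sqn (z 0 ω) ∂P := by positivity
    nlinarith
  have hVz : ∫ ω, sqn (z t ω) ∂P ≤ V t := by
    rw [hsplit]
    have := hnn fun ω => dev (d t ω)
    have : 0 ≤ b₀ * γ * ∫ ω, sqn (dev (d t ω)) ∂P := by positivity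
    simp only [hV]; linarith
  have hc : cV * ((6 * γ / μ + γ ^ 2) * τ + 6 * τ) / (1 - θ) = c1 * τ := by rw [hc1]; ring
  rw [hc] at hbd
  have h6 : θ ^ t * V 0 ≤ θ ^ t * ((1 + b₀ * γ) * (∫ ω, sqn (z 0 ω) ∂P + ∫ ω, sqn (d 0 ω) ∂P)) := by
    gcongr
  have h7 : 0 ≤ c1 * (θ ^ t * (∫ ω, sqn (z 0 ω) ∂P + ∫ ω, sqn (d 0 ω) ∂P)) := by
    have := hnn (z 0); have := hnn (d 0); positivity
  have h8 : 0 ≤ (1 + b₀ * γ) * τ := by positivity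
  refine hVz.trans (hbd.trans ?_)
  nlinarith

/-! ### Conditionally centered random vectors and fresh samples -/

section Centered

variable {Ω : Type*} {𝓕 𝓖 m0 : MeasurableSpace Ω} {P : Measure Ω}
  {E F : Type*} [NormedAddCommGroup E] [InnerProductSpace ℝ E] [MeasurableSpace E]
  [NormedAddCommGroup F] [InnerProductSpace ℝ F] [MeasurableSpace F]

/-- `Y` is square-integrable with conditional mean zero given `𝓕`, expressed by duality: it is
orthogonal to all square-integrable `𝓕`-measurable vectors. -/
structure Centered (P : Measure Ω) (𝓕 : MeasurableSpace Ω) (Y : Ω → E) : Prop where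
  memLp : MemLp Y 2 P
  orthogonal : ∀ A : Ω → E, Measurable[𝓕] A → MemLp A 2 P → ∫ ω, inner ℝ (A ω) (Y ω) ∂P = 0

lemma Centered.mono {Y : Ω → E} (h : Centered P 𝓖 Y) (hle : 𝓕 ≤ 𝓖) : Centered P 𝓕 Y :=
  ⟨h.memLp, fun A hA => h.orthogonal A (hA.mono hle le_rfl)⟩

lemma Centered.zero : Centered P 𝓕 fun _ : Ω => (0 : E) :=
  ⟨MemLp.zero', fun A _ _ => by simp⟩

lemma Centered.add {Y Z : Ω → E} (hY : Centered P 𝓕 Y) (hZ : Centered P 𝓕 Z) :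
    Centered P 𝓕 fun ω => Y ω + Z ω := by
  refine ⟨hY.memLp.add hZ.memLp, fun A hA hA2 => ?_⟩
  simp only [inner_add_right]
  rw [integral_add (integrable_inner hA2 hY.memLp) (integrable_inner hA2 hZ.memLp),
    hY.orthogonal A hA hA2, hZ.orthogonal A hA hA2, add_zero]

lemma Centered.smul {Y : Ω → E} (hY : Centered P 𝓕 Y) (a : ℝ) :
    Centered P 𝓕 fun ω => a • Y ω := by
  refine ⟨hY.memLp.const_smul a, fun A hA hA2 => ?_⟩
  simp only [inner_smul_right, integral_const_mul, hY.orthogonal A hA hA2, mul_zero]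

lemma Centered.sub {Y Z : Ω → E} (hY : Centered P 𝓕 Y) (hZ : Centered P 𝓕 Z) :
    Centered P 𝓕 fun ω => Y ω - Z ω := by
  have := hY.add (hZ.smul (-1))
  simpa [sub_eq_add_neg] using this

lemma Centered.sum {ι : Type*} {s : Finset ι} {Y : ι → Ω → E} (h : ∀ i ∈ s, Centered P 𝓕 (Y i)) :
    Centered P 𝓕 fun ω => ∑ i ∈ s, Y i ω := by
  classical
  induction s using Finset.induction_on with
  | empty => simpa using Centered.zero
  | insert a s ha ih =>
    simp only [Finset.sum_insert ha]
    exact (h a (Finset.mem_insert_self a s)).add (ih fun i hi => h i (Finset.mem_insert_of_mem hi))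

variable [FiniteDimensional ℝ E] [BorelSpace E] [BorelSpace F]

lemma measurable_clm_apply {α : Type*} {m : MeasurableSpace α} {T : α → E →L[ℝ] F} {v : α → E}
    (hT : Measurable T) (hv : Measurable v) : Measurable fun a => T a (v a) := by
  have : Continuous fun x : (E →L[ℝ] F) × E => x.1 x.2 := isBoundedBilinearMap_apply.continuous
  exact this.measurable.comp (hT.prodMk hv)

variable [FiniteDimensional ℝ F]

/-- Applying a bounded `𝓕`-measurable operator preserves conditional mean zero. -/
lemma Centered.clm_apply {Y : Ω → E} (hY : Centered P 𝓕 Y) (h𝓕 : 𝓕 ≤ m0) {T : Ω → E →L[ℝ] F}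
    (hT : Measurable[𝓕] T) {C : ℝ} (hC : ∀ ω, ‖T ω‖ ≤ C) : Centered P 𝓕 fun ω => T ω (Y ω) := by
  have happ : Continuous fun x : (E →L[ℝ] F) × E => x.1 x.2 := isBoundedBilinearMap_apply.continuous
  have hT0 : Measurable T := hT.mono h𝓕 le_rfl
  refine ⟨hY.memLp.of_le_mul (c := C) ?_ (Filter.Eventually.of_forall fun ω => ?_),
    fun A hA hA2 => ?_⟩
  · exact happ.comp_aestronglyMeasurable (hT0.aestronglyMeasurable.prodMk hY.memLp.1)
  · exact ((T ω).le_opNorm _).trans (by gcongr; exact hC ω)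
  · have hTa : Measurable[𝓕] fun ω => ContinuousLinearMap.adjoint (T ω) :=
      (ContinuousLinearMap.adjoint (𝕜 := ℝ) (E := E) (F := F)).continuous.measurable.comp hT
    have hm := measurable_clm_apply (m := 𝓕) hTa hA
    have := hY.orthogonal (fun ω => ContinuousLinearMap.adjoint (T ω) (A ω)) hm
      (hA2.of_le_mul (c := C) (hm.mono h𝓕 le_rfl).aestronglyMeasurable
        (Filter.Eventually.of_forall fun ω => by
          refine ((ContinuousLinearMap.adjoint (T ω)).le_opNorm _).trans ?_
          rw [LinearIsometryEquiv.norm_map]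
          gcongr; exact hC ω))
    simpa only [ContinuousLinearMap.adjoint_inner_left] using this

lemma Centered.clm {Y : Ω → E} (hY : Centered P 𝓕 Y) (h𝓕 : 𝓕 ≤ m0) (T : E →L[ℝ] F) :
    Centered P 𝓕 fun ω => T (Y ω) :=
  hY.clm_apply h𝓕 (T := fun _ => T) (@measurable_const _ _ _ 𝓕 _) (C := ‖T‖) fun _ => le_rfl

variable {R : Type*} [mR : MeasurableSpace R]

variable {Ω' : Type*} [MeasurableSpace Ω'] {V : Ω → Ω'} {ξ : Ω → R}

/-- Second moments of a function of a state `V` and of an independent sample `ξ`. -/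
lemma memLp_of_indepFun [IsProbabilityMeasure P] (hV : Measurable V) (hξ : Measurable ξ)
    (hind : IndepFun V ξ P) {Ψ : Ω' × R → E} (hΨ : Measurable Ψ) {v : Ω' → ℝ}
    (hv : Measurable v) (hvi : Integrable (fun ω => v (V ω)) P)
    (hint : ∀ x, Integrable (fun s => ‖Ψ (x, s)‖ ^ 2) (P.map ξ))
    (hle : ∀ x, ∫ s, ‖Ψ (x, s)‖ ^ 2 ∂(P.map ξ) ≤ v x) :
    MemLp (fun ω => Ψ (V ω, ξ ω)) 2 P ∧ ∫ ω, ‖Ψ (V ω, ξ ω)‖ ^ 2 ∂P ≤ ∫ ω, v (V ω) ∂P := by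
  have hpair : Measurable fun ω => (V ω, ξ ω) := hV.prodMk hξ
  have hmeas : Measurable fun ω => Ψ (V ω, ξ ω) := hΨ.comp hpair
  have : IsProbabilityMeasure (P.map ξ) := Measure.isProbabilityMeasure_map hξ.aemeasurable
  have : IsProbabilityMeasure (P.map V) := Measure.isProbabilityMeasure_map hV.aemeasurable
  have hv0 : ∀ x, 0 ≤ v x := fun x => (integral_nonneg fun s => by positivity).trans (hle x)
  have hsq : Measurable fun x : Ω' × R => ENNReal.ofReal (‖Ψ x‖ ^ 2) :=
    ENNReal.measurable_ofReal.comp (hΨ.norm.pow_const 2)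
  have key : ∫⁻ ω, ENNReal.ofReal (‖Ψ (V ω, ξ ω)‖ ^ 2) ∂P
      ≤ ENNReal.ofReal (∫ ω, v (V ω) ∂P) := by
    have h1 : ∫⁻ ω, ENNReal.ofReal (‖Ψ (V ω, ξ ω)‖ ^ 2) ∂P
        = ∫⁻ x, ENNReal.ofReal (‖Ψ x‖ ^ 2) ∂(P.map fun ω => (V ω, ξ ω)) :=
      (lintegral_map hsq hpair).symm
    rw [h1, (indepFun_iff_map_prod_eq_prod_map_map hV.aemeasurable hξ.aemeasurable).1 hind,
      lintegral_prod _ hsq.aemeasurable]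
    calc ∫⁻ x, ∫⁻ s, ENNReal.ofReal (‖Ψ (x, s)‖ ^ 2) ∂(P.map ξ) ∂(P.map V)
        ≤ ∫⁻ x, ENNReal.ofReal (v x) ∂(P.map V) := by
          refine lintegral_mono fun x => ?_
          simp only
          rw [← ofReal_integral_eq_lintegral_ofReal (hint x)
            (Filter.Eventually.of_forall fun s => by positivity)]
          exact ENNReal.ofReal_le_ofReal (hle x)
      _ = ∫⁻ ω, ENNReal.ofReal (v (V ω)) ∂P := lintegral_map hv.ennreal_ofReal hV
      _ = ENNReal.ofReal (∫ ω, v (V ω) ∂P) :=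
          (ofReal_integral_eq_lintegral_ofReal hvi
            (Filter.Eventually.of_forall fun ω => hv0 _)).symm
  have hi : Integrable (fun ω => ‖Ψ (V ω, ξ ω)‖ ^ 2) P := by
    refine ⟨(hmeas.norm.pow_const 2).aestronglyMeasurable, ?_⟩
    rw [hasFiniteIntegral_iff_ofReal (Filter.Eventually.of_forall fun ω => by positivity)]
    exact key.trans_lt ENNReal.ofReal_lt_top
  refine ⟨(memLp_two_iff_integrable_sq_norm hmeas.aestronglyMeasurable).2 hi, ?_⟩
  rw [← ofReal_integral_eq_lintegral_ofReal hi (Filter.Eventually.of_forall fun ω => by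
    positivity)] at key
  exact (ENNReal.ofReal_le_ofReal_iff (integral_nonneg fun ω => hv0 _)).1 key

/-- A function of a state and an independent sample whose mean over the sample vanishes is
orthogonal to all functions of the state. -/
lemma integral_inner_eq_zero_of_indepFun [IsProbabilityMeasure P] (hV : Measurable V)
    (hξ : Measurable ξ) (hind : IndepFun V ξ P) {Ψ : Ω' × R → E} (hΨ : Measurable Ψ)
    (hmem : MemLp (fun ω => Ψ (V ω, ξ ω)) 2 P)
    (hint : ∀ x, Integrable (fun s => Ψ (x, s)) (P.map ξ))
    (hmean : ∀ x, ∫ s, Ψ (x, s) ∂(P.map ξ) = 0) {A : Ω' → E} (hA : Measurable A)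
    (hA2 : MemLp (fun ω => A (V ω)) 2 P) :
    ∫ ω, inner ℝ (A (V ω)) (Ψ (V ω, ξ ω)) ∂P = 0 := by
  have hpair : Measurable fun ω => (V ω, ξ ω) := hV.prodMk hξ
  have : IsProbabilityMeasure (P.map ξ) := Measure.isProbabilityMeasure_map hξ.aemeasurable
  have : IsProbabilityMeasure (P.map V) := Measure.isProbabilityMeasure_map hV.aemeasurable
  let f : Ω' × R → ℝ := fun x => inner ℝ (A x.1) (Ψ x)
  have hf : Measurable f := (hA.comp measurable_fst).inner hΨ
  have hi : Integrable (fun ω => f (V ω, ξ ω)) P := integrable_inner hA2 hmem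
  have h1 := integral_map (μ := P) hpair.aemeasurable (f := f) hf.aestronglyMeasurable
  have h2 := (integrable_map_measure (μ := P) (g := f) hf.aestronglyMeasurable
    hpair.aemeasurable).2 hi
  rw [(indepFun_iff_map_prod_eq_prod_map_map hV.aemeasurable hξ.aemeasurable).1 hind] at h1 h2
  change ∫ ω, f (V ω, ξ ω) ∂P = 0
  rw [← h1, integral_prod f h2]
  have h3 : ∀ x, ∫ s, f (x, s) ∂(P.map ξ) = 0 := fun x => by
    simp only [f]
    rw [integral_inner (hint x), hmean, inner_zero_right]
  simp [h3]

/-- A σ-algebra independent of `ξ`, as independence of the identity map into the coarser space. -/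
lemma indepFun_id (hind : Indep 𝓕 (mR.comap ξ) P) : @IndepFun Ω Ω R m0 𝓕 mR id ξ P :=
  (@IndepFun_iff_Indep Ω Ω R m0 𝓕 mR id ξ P).2 (by rw [MeasurableSpace.comap_id]; exact hind)

end Centered

section Noise

variable {R : Type*} [mR : MeasurableSpace R] {p q : ℕ} {σ : ℝ} {D : Measure R}

/-- The noise of an unbiased stochastic operator applied to a vector, both evaluated at points that
depend on a state `V` independent of the sample. -/
lemma Unbiased.noise_apply_of_indepFun {Ω Ω' : Type*} [MeasurableSpace Ω] [MeasurableSpace Ω']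
    {P : Measure Ω} [IsProbabilityMeasure P]
    {G : Pair p q → R → Pair p q →L[ℝ] Pair p q} {m : Pair p q → Pair p q →L[ℝ] Pair p q}
    (hU : ∀ z, Unbiased D (G z) (m z) σ) (hG : Measurable fun a : Pair p q × R => G a.1 a.2)
    (hm : Measurable m) {V : Ω → Ω'} (hV : Measurable V) {ξ : Ω → R} (hξ : Measurable ξ)
    (hlaw : P.map ξ = D) (hind : IndepFun V ξ P) {w : Ω' → Pair p q} (hw : Measurable w)
    {v : Ω' → Pair p q} (hv : Measurable v) (hv2 : MemLp (fun ω => v (V ω)) 2 P) :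
    MemLp (fun ω => G (w (V ω)) (ξ ω) (v (V ω)) - m (w (V ω)) (v (V ω))) 2 P ∧
    (∀ A : Ω' → Pair p q, Measurable A → MemLp (fun ω => A (V ω)) 2 P →
      ∫ ω, inner ℝ (A (V ω)) (G (w (V ω)) (ξ ω) (v (V ω)) - m (w (V ω)) (v (V ω))) ∂P = 0) ∧
    ∫ ω, ‖G (w (V ω)) (ξ ω) (v (V ω)) - m (w (V ω)) (v (V ω))‖ ^ 2 ∂P
      ≤ σ ^ 2 * ∫ ω, ‖v (V ω)‖ ^ 2 ∂P := by
  subst hlaw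
  have : IsProbabilityMeasure (P.map ξ) := Measure.isProbabilityMeasure_map hξ.aemeasurable
  let Ψ : Ω' × R → Pair p q := fun x => G (w x.1) x.2 (v x.1) - m (w x.1) (v x.1)
  have hw1 : Measurable fun x : Ω' × R => w x.1 := hw.comp measurable_fst
  have hv1 : Measurable fun x : Ω' × R => v x.1 := hv.comp measurable_fst
  have hΨ : Measurable Ψ :=
    (measurable_clm_apply (hG.comp (hw1.prodMk measurable_snd)) hv1).sub
      (measurable_clm_apply (hm.comp hw1) hv1)
  have hbd : ∀ x s, ‖Ψ (x, s)‖ ^ 2 ≤ ‖G (w x) s - m (w x)‖ ^ 2 * ‖v x‖ ^ 2 := by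
    intro x s
    rw [← mul_pow]
    refine pow_le_pow_left₀ (norm_nonneg _) ?_ 2
    simpa [Ψ] using (G (w x) s - m (w x)).le_opNorm (v x)
  have hdiff : ∀ x, Integrable (fun s => G (w x) s - m (w x)) (P.map ξ) := fun x =>
    (hU (w x)).integrable.sub (integrable_const (m (w x)))
  have hint : ∀ x, Integrable (fun s => Ψ (x, s)) (P.map ξ) := fun x => by
    simpa [Ψ] using (hdiff x).apply_continuousLinearMap (v x)
  have hint2 : ∀ x, Integrable (fun s => ‖Ψ (x, s)‖ ^ 2) (P.map ξ) := fun x => by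
    refine ((hU (w x)).integrable_sq.mul_const (‖v x‖ ^ 2)).mono'
      ((hint x).1.norm.pow 2) (Filter.Eventually.of_forall fun s => ?_)
    rw [Real.norm_eq_abs, abs_of_nonneg (by positivity)]
    exact hbd x s
  have h1 := memLp_of_indepFun hV hξ hind hΨ (v := fun x => σ ^ 2 * ‖v x‖ ^ 2)
    ((hv.norm.pow_const 2).const_mul _) ((integrable_norm_sq hv2).const_mul _) hint2 (fun x => by
      refine (integral_mono (hint2 x) ((hU (w x)).integrable_sq.mul_const (‖v x‖ ^ 2))
        (hbd x)).trans ?_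
      rw [integral_mul_const]
      exact mul_le_mul_of_nonneg_right (hU (w x)).variance (sq_nonneg _))
  have hmean : ∀ x, ∫ s, Ψ (x, s) ∂(P.map ξ) = 0 := fun x => by
    have h2 : ∫ s, (G (w x) s - m (w x)) ∂(P.map ξ) = 0 := by
      rw [integral_sub (hU (w x)).integrable (integrable_const _), (hU (w x)).mean]
      simp
    have h3 := ContinuousLinearMap.integral_apply (hdiff x) (v x)
    rw [h2] at h3
    simpa [Ψ] using h3.symm
  refine ⟨h1.1, fun A hA hA2 =>
    integral_inner_eq_zero_of_indepFun hV hξ hind hΨ h1.1 hint hmean hA hA2, ?_⟩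
  rw [integral_const_mul] at h1
  exact h1.2

/-- The noise of an unbiased stochastic vector field, evaluated at a point that depends on a state
independent of the sample. -/
lemma Unbiased.noise_of_indepFun {Ω Ω' : Type*} [MeasurableSpace Ω] [MeasurableSpace Ω']
    {P : Measure Ω} [IsProbabilityMeasure P]
    {G : Pair p q → R → Pair p q} {m : Pair p q → Pair p q}
    (hU : ∀ z, Unbiased D (G z) (m z) σ) (hG : Measurable fun a : Pair p q × R => G a.1 a.2)
    (hm : Measurable m) {V : Ω → Ω'} (hV : Measurable V) {ξ : Ω → R} (hξ : Measurable ξ)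
    (hlaw : P.map ξ = D) (hind : IndepFun V ξ P) {w : Ω' → Pair p q} (hw : Measurable w) :
    MemLp (fun ω => G (w (V ω)) (ξ ω) - m (w (V ω))) 2 P ∧
    (∀ A : Ω' → Pair p q, Measurable A → MemLp (fun ω => A (V ω)) 2 P →
      ∫ ω, inner ℝ (A (V ω)) (G (w (V ω)) (ξ ω) - m (w (V ω))) ∂P = 0) ∧
    ∫ ω, ‖G (w (V ω)) (ξ ω) - m (w (V ω))‖ ^ 2 ∂P ≤ σ ^ 2 := by
  subst hlaw
  have : IsProbabilityMeasure (P.map ξ) := Measure.isProbabilityMeasure_map hξ.aemeasurable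
  let Ψ : Ω' × R → Pair p q := fun x => G (w x.1) x.2 - m (w x.1)
  have hw1 : Measurable fun x : Ω' × R => w x.1 := hw.comp measurable_fst
  have hΨ : Measurable Ψ := (hG.comp (hw1.prodMk measurable_snd)).sub (hm.comp hw1)
  have hint : ∀ x, Integrable (fun s => Ψ (x, s)) (P.map ξ) := fun x =>
    (hU (w x)).integrable.sub (integrable_const (m (w x)))
  have h1 := memLp_of_indepFun hV hξ hind hΨ (v := fun _ => σ ^ 2) measurable_const
    (integrable_const _) (fun x => (hU (w x)).integrable_sq) (fun x => (hU (w x)).variance)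
  have hmean : ∀ x, ∫ s, Ψ (x, s) ∂(P.map ξ) = 0 := fun x => by
    simp only [Ψ]
    rw [integral_sub (hU (w x)).integrable (integrable_const _), (hU (w x)).mean]
    simp
  refine ⟨h1.1, fun A hA hA2 =>
    integral_inner_eq_zero_of_indepFun hV hξ hind hΨ h1.1 hint hmean hA hA2, ?_⟩
  simpa using h1.2

variable {Ω : Type*} {𝓕 m0 : MeasurableSpace Ω} {P : Measure Ω} [IsProbabilityMeasure P]

/-- The noise of an unbiased stochastic vector field at a point that depends on the past `𝓕` is
conditionally centered, and bounded by the variance. -/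
lemma Unbiased.centered_noise {G : Pair p q → R → Pair p q} {m : Pair p q → Pair p q}
    (hU : ∀ z, Unbiased D (G z) (m z) σ) (hG : Measurable fun a : Pair p q × R => G a.1 a.2)
    (hm : Measurable m) (h𝓕 : 𝓕 ≤ m0) {ξ : Ω → R} (hξ : Measurable ξ) (hlaw : P.map ξ = D)
    (hind : Indep 𝓕 (mR.comap ξ) P) {w : Ω → Pair p q} (hw : Measurable[𝓕] w) :
    Centered P 𝓕 (fun ω => G (w ω) (ξ ω) - m (w ω)) ∧
      ∫ ω, ‖G (w ω) (ξ ω) - m (w ω)‖ ^ 2 ∂P ≤ σ ^ 2 := by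
  have h := @Unbiased.noise_of_indepFun R mR p q σ D Ω Ω m0 𝓕 P _ G m hU hG hm id
    (measurable_id'' h𝓕) ξ hξ hlaw (indepFun_id hind) w hw
  exact ⟨⟨h.1, h.2.1⟩, h.2.2⟩

/-- The noise of an unbiased stochastic operator, applied to a vector that depends on the past `𝓕`,
is conditionally centered, and bounded in mean square by the second moment of this vector. -/
lemma Unbiased.centered_noise_apply {G : Pair p q → R → Pair p q →L[ℝ] Pair p q}
    {m : Pair p q → Pair p q →L[ℝ] Pair p q}
    (hU : ∀ z, Unbiased D (G z) (m z) σ) (hG : Measurable fun a : Pair p q × R => G a.1 a.2)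
    (hm : Measurable m) (h𝓕 : 𝓕 ≤ m0) {ξ : Ω → R} (hξ : Measurable ξ) (hlaw : P.map ξ = D)
    (hind : Indep 𝓕 (mR.comap ξ) P) {w : Ω → Pair p q} (hw : Measurable[𝓕] w)
    {v : Ω → Pair p q} (hv : Measurable[𝓕] v) (hv2 : MemLp v 2 P) :
    Centered P 𝓕 (fun ω => G (w ω) (ξ ω) (v ω) - m (w ω) (v ω)) ∧
      ∫ ω, ‖G (w ω) (ξ ω) (v ω) - m (w ω) (v ω)‖ ^ 2 ∂P ≤ σ ^ 2 * ∫ ω, ‖v ω‖ ^ 2 ∂P := by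
  have h := @Unbiased.noise_apply_of_indepFun R mR p q σ D Ω Ω m0 𝓕 P _ G m hU hG hm id
    (measurable_id'' h𝓕) ξ hξ hlaw (indepFun_id hind) w hw v hv hv2
  exact ⟨⟨h.1, h.2.1⟩, h.2.2⟩

end Noise

/-! ### Measurability of the algorithm -/

section Measurability

variable {Ω : Type*} {m : MeasurableSpace Ω} {n p q : ℕ} {S : Type*} {R : Type*}
  [MeasurableSpace S] [MeasurableSpace R]

lemma measurable_pair {x : Ω → Vec p} {y : Ω → Vec q} (hx : Measurable x) (hy : Measurable y) :
    Measurable fun ω => pair (x ω) (y ω) := by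
  simp only [pair_eq]
  exact ((inlL p q).measurable.comp hx).add ((inrL p q).measurable.comp hy)

lemma measurable_mix {d : ℕ} {v : Ω → Fin n → Vec d} (hv : ∀ i, Measurable fun ω => v ω i)
    (W : Matrix (Fin n) (Fin n) ℝ) (i : Fin n) : Measurable fun ω => mix W (v ω) i := by
  unfold mix
  exact Finset.measurable_fun_sum _ fun j _ => (hv j).const_smul (W i j)

lemma measurable_avg {d : ℕ} {v : Ω → Fin n → Vec d} (hv : ∀ i, Measurable fun ω => v ω i) :
    Measurable fun ω => avg (v ω) := by
  unfold avg
  exact (Finset.measurable_fun_sum Finset.univ fun j _ => hv j).const_smul (1 / (n : ℝ))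

/-- Joint measurability of the stochastic derivatives. -/
structure MeasurableLoss (B : Problem n p q S R) : Prop where
  gradF : Measurable fun a : Pair p q × S => gradient (B.lossF a.2) a.1
  gradG : Measurable fun a : Pair p q × R => gradient (B.lossG a.2) a.1
  hessG : Measurable fun a : Pair p q × R => hess (B.lossG a.2) a.1

namespace MeasurableLoss

variable {B : Problem n p q S R} {w : Ω → Pair p q} {ξ : Ω → R} {φ : Ω → S} {v : Ω → Vec q}

lemma gradX_F (hB : MeasurableLoss B) (hφ : Measurable φ) (hw : Measurable w) :
    Measurable fun ω => gradX (B.lossF (φ ω)) (w ω) :=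
  (fstL p q).measurable.comp (hB.gradF.comp (hw.prodMk hφ))

lemma gradY_F (hB : MeasurableLoss B) (hφ : Measurable φ) (hw : Measurable w) :
    Measurable fun ω => gradY (B.lossF (φ ω)) (w ω) :=
  (sndL p q).measurable.comp (hB.gradF.comp (hw.prodMk hφ))

lemma gradY_G (hB : MeasurableLoss B) (hξ : Measurable ξ) (hw : Measurable w) :
    Measurable fun ω => gradY (B.lossG (ξ ω)) (w ω) :=
  (sndL p q).measurable.comp (hB.gradG.comp (hw.prodMk hξ))

lemma hessYMul_G (hB : MeasurableLoss B) (hξ : Measurable ξ) (hw : Measurable w)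
    (hv : Measurable v) : Measurable fun ω => hessYMul (B.lossG (ξ ω)) (w ω) (v ω) :=
  (sndL p q).measurable.comp (measurable_clm_apply (hB.hessG.comp (hw.prodMk hξ))
    ((inrL p q).measurable.comp hv))

lemma jacXYMul_G (hB : MeasurableLoss B) (hξ : Measurable ξ) (hw : Measurable w)
    (hv : Measurable v) : Measurable fun ω => jacXYMul (B.lossG (ξ ω)) (w ω) (v ω) :=
  (fstL p q).measurable.comp (measurable_clm_apply (hB.hessG.comp (hw.prodMk hξ))
    ((inrL p q).measurable.comp hv))

variable {W : Matrix (Fin n) (Fin n) ℝ}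

lemma innerLoop (hB : MeasurableLoss B) {β : ℝ} {xi : Ω → ℕ → Fin n → R}
    {x : Ω → Fin n → Vec p} {y : Ω → Fin n → Vec q} (hx : ∀ i, Measurable fun ω => x ω i)
    (hy : ∀ i, Measurable fun ω => y ω i) (t : ℕ)
    (hxi : ∀ t' < t, ∀ i, Measurable fun ω => xi ω t' i) (i : Fin n) :
    Measurable fun ω => (innerLoop B W β (xi ω) (x ω) (y ω) t).y i := by
  induction t generalizing i with
  | zero => exact hy i
  | succ t ih =>
    have ih' := ih fun t' ht' => hxi t' (ht'.trans t.lt_succ_self)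
    exact (measurable_mix ih' W i).sub ((hB.gradY_G (hxi t t.lt_succ_self i)
      (measurable_pair (hx i) (ih' i))).const_smul β)

section Oracle

variable {γ : ℝ} {xi : Ω → ℕ → Fin n → R} {phi : Ω → ℕ → Fin n → S}
  {x : Ω → Fin n → Vec p} {y : Ω → Fin n → Vec q}

/-- After `t` steps the oracle has used the samples `ξ_1, …, ξ_t` and `φ_0, …, φ_t`, and its
iterate `z_t` only depends on those with smaller index than `t`. -/
lemma higp (hB : MeasurableLoss B) (hx : ∀ i, Measurable fun ω => x ω i)
    (hy : ∀ i, Measurable fun ω => y ω i) (t : ℕ)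
    (hxi : ∀ t' < t, 0 < t' → ∀ i, Measurable fun ω => xi ω t' i)
    (hphi : ∀ t' < t, ∀ i, Measurable fun ω => phi ω t' i) :
    (∀ i, Measurable fun ω => (higp B W γ (xi ω) (phi ω) (x ω) (y ω) t).z i) ∧
      ((∀ i, 0 < t → Measurable fun ω => xi ω t i) → (∀ i, Measurable fun ω => phi ω t i) →
      (∀ i, Measurable fun ω => (DSBO.higp B W γ (xi ω) (phi ω) (x ω) (y ω) t).s i) ∧
      (∀ i, Measurable fun ω => (DSBO.higp B W γ (xi ω) (phi ω) (x ω) (y ω) t).d i)) := by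
  have hw : ∀ i, Measurable fun ω => pair (x ω i) (y ω i) := fun i => measurable_pair (hx i) (hy i)
  induction t with
  | zero =>
    refine ⟨fun i => measurable_const, fun _ h2 => ⟨fun i => ?_, fun i => ?_⟩⟩
    · exact (hB.gradY_F (h2 i) (hw i)).neg
    · exact (hB.gradY_F (h2 i) (hw i)).neg
  | succ t ih =>
    obtain ⟨iz, ih2⟩ := ih (fun t' ht' => hxi t' (ht'.trans t.lt_succ_self))
      (fun t' ht' => hphi t' (ht'.trans t.lt_succ_self))
    obtain ⟨is, id⟩ := ih2 (fun i h0 => hxi t t.lt_succ_self h0 i) (hphi t t.lt_succ_self)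
    have hz : ∀ i, Measurable fun ω =>
        (DSBO.higp B W γ (xi ω) (phi ω) (x ω) (y ω) (t + 1)).z i := fun i =>
      (measurable_mix iz W i).sub ((id i).const_smul γ)
    refine ⟨hz, fun h1 h2 => ?_⟩
    have hs : ∀ i, Measurable fun ω =>
        (DSBO.higp B W γ (xi ω) (phi ω) (x ω) (y ω) (t + 1)).s i := fun i =>
      (hB.hessYMul_G (h1 i t.succ_pos) (hw i) (hz i)).sub (hB.gradY_F (h2 i) (hw i))
    exact ⟨hs, fun i => ((measurable_mix id W i).add (hs i)).sub (is i)⟩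

end Oracle

/-- The state at the start of iteration `k` is a function of the samples of earlier iterations. -/
lemma maDsbo (hB : MeasurableLoss B) {cfg : Config} {X : Ω → Samples n S R} (k : ℕ)
    (h1 : ∀ k' < k, ∀ t i, Measurable fun ω => (X ω).xiTilde k' t i)
    (h2 : ∀ k' < k, ∀ t i, Measurable fun ω => (X ω).xi k' t i)
    (h3 : ∀ k' < k, ∀ t i, Measurable fun ω => (X ω).phi k' t i) (i : Fin n) :
    (Measurable fun ω => (maDsbo B W cfg (X ω) k).x i) ∧
    (Measurable fun ω => (DSBO.maDsbo B W cfg (X ω) k).r i) ∧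
    (Measurable fun ω => (DSBO.maDsbo B W cfg (X ω) k).y i) := by
  induction k generalizing i with
  | zero => exact ⟨measurable_const, measurable_const, measurable_const⟩
  | succ k ih =>
    have hk := k.lt_succ_self
    have ih' := ih (fun k' h => h1 k' (h.trans hk)) (fun k' h => h2 k' (h.trans hk))
      (fun k' h => h3 k' (h.trans hk))
    have hx := fun i => (ih' i).1
    have hr := fun i => (ih' i).2.1
    have hy := fun i => (ih' i).2.2
    have hy' := hB.innerLoop (W := W) (β := cfg.beta k) (xi := fun ω => (X ω).xiTilde k) hx hy cfg.T
      (fun t _ i => h1 k hk t i)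
    have hz := (hB.higp (W := W) (γ := cfg.gamma) (xi := fun ω => (X ω).xi k)
      (phi := fun ω => (X ω).phi k) hx hy' cfg.N (fun t _ _ i => h2 k hk t i)
      (fun t _ i => h3 k hk t i)).1
    have hw := measurable_pair (hx i) (hy' i)
    have hu := (hB.gradX_F (h3 k hk 0 i) hw).sub (hB.jacXYMul_G (h2 k hk 0 i) hw (hz i))
    have hr' := ((hr i).const_smul (1 - cfg.alpha k)).add (hu.const_smul (cfg.alpha k))
    exact ⟨(measurable_mix hx W i).sub ((hr i).const_smul (cfg.alpha k)), hr', hy' i⟩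

end MeasurableLoss

end Measurability

/-! ### The σ-algebras generated by the samples -/

section Past

variable {Ω : Type*} {n p q : ℕ} {S : Type*} {R : Type*}
  [mS : MeasurableSpace S] [mR : MeasurableSpace R]

/-- The labels `(k, t, i)` of the samples `ξ̃`, `ξ` and `φ`, in this order. -/
abbrev SampleIdx (n : ℕ) : Type := (ℕ × ℕ × Fin n) ⊕ ((ℕ × ℕ × Fin n) ⊕ (ℕ × ℕ × Fin n))

/-- The σ-algebra generated by one sample. -/
@[reducible] def sampleSigma (X : Ω → Samples n S R) : SampleIdx n → MeasurableSpace Ω :=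
  Sum.elim (fun a : ℕ × ℕ × Fin n => mR.comap fun ω => (X ω).xiTilde a.1 a.2.1 a.2.2)
    (Sum.elim (fun a : ℕ × ℕ × Fin n => mR.comap fun ω => (X ω).xi a.1 a.2.1 a.2.2)
      (fun a : ℕ × ℕ × Fin n => mS.comap fun ω => (X ω).phi a.1 a.2.1 a.2.2))

/-- The σ-algebra generated by the samples with labels in `J`. -/
@[reducible] def sigmaOf (X : Ω → Samples n S R) (J : Set (SampleIdx n)) : MeasurableSpace Ω :=
  ⨆ i ∈ J, sampleSigma X i

/-- The samples of the iterations before `k`. -/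
def pastIdx (n k : ℕ) : Set (SampleIdx n) :=
  {a | Sum.elim (fun a => a.1 < k) (Sum.elim (fun a => a.1 < k) fun a => a.1 < k) a}

/-- The samples that determine the `t`-th iterate of the oracle in iteration `k`: those of earlier
iterations, those of the inner loop, `ξ_1, …, ξ_{t-1}` and `φ_0, …, φ_{t-1}`. The sample `ξ_0` is
never used by the oracle. -/
def oracleIdx (n k t : ℕ) : Set (SampleIdx n) :=
  {a | Sum.elim (fun a => a.1 ≤ k)
    (Sum.elim (fun a => a.1 < k ∨ a.1 = k ∧ 0 < a.2.1 ∧ a.2.1 < t)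
      fun a => a.1 < k ∨ a.1 = k ∧ a.2.1 < t) a}

variable {X : Ω → Samples n S R}

lemma sigmaOf_mono {J J' : Set (SampleIdx n)} (h : J ⊆ J') : sigmaOf X J ≤ sigmaOf X J' :=
  biSup_mono h

lemma sampleSigma_le_sigmaOf {J : Set (SampleIdx n)} {a : SampleIdx n} (h : a ∈ J) :
    sampleSigma X a ≤ sigmaOf X J := le_biSup (sampleSigma X) h

lemma measurable_xiTilde {J : Set (SampleIdx n)} {k t : ℕ} {i : Fin n}
    (h : Sum.inl (k, t, i) ∈ J) : Measurable[sigmaOf X J] fun ω => (X ω).xiTilde k t i :=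
  Measurable.of_comap_le (sampleSigma_le_sigmaOf h)

lemma measurable_xi {J : Set (SampleIdx n)} {k t : ℕ} {i : Fin n}
    (h : Sum.inr (Sum.inl (k, t, i)) ∈ J) : Measurable[sigmaOf X J] fun ω => (X ω).xi k t i :=
  Measurable.of_comap_le (sampleSigma_le_sigmaOf h)

lemma measurable_phi {J : Set (SampleIdx n)} {k t : ℕ} {i : Fin n}
    (h : Sum.inr (Sum.inr (k, t, i)) ∈ J) : Measurable[sigmaOf X J] fun ω => (X ω).phi k t i :=
  Measurable.of_comap_le (sampleSigma_le_sigmaOf h)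

lemma pastIdx_subset_oracleIdx (k t : ℕ) : pastIdx n k ⊆ oracleIdx n k t := by
  rintro (a | a | a) h
  · exact Nat.le_of_lt h
  · exact Or.inl h
  · exact Or.inl h

lemma oracleIdx_mono (k : ℕ) {t t' : ℕ} (h : t ≤ t') : oracleIdx n k t ⊆ oracleIdx n k t' := by
  rintro (a | a | a) h'
  · exact h'
  · exact h'.imp id fun h2 => ⟨h2.1, h2.2.1, h2.2.2.trans_le h⟩
  · exact h'.imp id fun h2 => ⟨h2.1, h2.2.trans_le h⟩

variable [m0 : MeasurableSpace Ω] {P : Measure Ω} {B : Problem n p q S R}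

namespace Sampling

lemma sampleSigma_le (hX : Sampling P B X) (a : SampleIdx n) : sampleSigma X a ≤ m0 := by
  rcases a with a | a | a
  · exact (hX.meas_xiTilde _ _ _).comap_le
  · exact (hX.meas_xi _ _ _).comap_le
  · exact (hX.meas_phi _ _ _).comap_le

lemma sigmaOf_le (hX : Sampling P B X) (J : Set (SampleIdx n)) : sigmaOf X J ≤ m0 :=
  iSup₂_le fun a _ => hX.sampleSigma_le a

/-- A sample is independent of all samples with other labels. -/
lemma indep_sigmaOf (hX : Sampling P B X) {J : Set (SampleIdx n)} {a : SampleIdx n} (ha : a ∉ J) :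
    Indep (sigmaOf X J) (sampleSigma X a) P := by
  have h := indep_iSup_of_disjoint hX.sampleSigma_le hX.indep (S := J) (T := {a})
    (Set.disjoint_singleton_right.2 ha)
  rwa [iSup_singleton] at h

end Sampling

end Past

/-! ### The mean dynamics of the oracle -/

section MeanProblem

variable {n p q : ℕ} {S : Type*} {R : Type*} [MeasurableSpace S] [MeasurableSpace R]

/-- The problem without noise, in which agent `i` always draws the data point `i` and has the losses
`f_i` and `g_i`. Running the oracle on it gives the expectation of the stochastic oracle. -/
def meanProblem (B : Problem n p q S R) : Problem n p q (Fin n) (Fin n) where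
  F := fun z i => B.f i z
  G := fun z i => B.g i z
  Df := fun i => Measure.dirac i
  Dg := fun i => Measure.dirac i
  prob_Df := fun _ => inferInstance
  prob_Dg := fun _ => inferInstance

variable {c : Constants} {B : Problem n p q S R}

lemma IsLip.measurable {V H : Type*} [NormedAddCommGroup V] [NormedAddCommGroup H]
    [MeasurableSpace V] [BorelSpace V] [MeasurableSpace H] [BorelSpace H] {L : ℝ} {f : V → H}
    (h : IsLip L f) : Measurable f := h.lipschitzWith.continuous.measurable

lemma Smooth.measurableLoss_meanProblem (hs : Smooth c B) : MeasurableLoss (meanProblem B) where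
  gradF := measurable_from_prod_countable_left fun i => (hs.lip_grad_f i).measurable
  gradG := measurable_from_prod_countable_left fun i => (hs.lip_grad_g i).measurable
  hessG := measurable_from_prod_countable_left fun i => (hs.lip_hess_g i).measurable

lemma Stochastic.measurableLoss (hs : Stochastic c B) : MeasurableLoss B :=
  ⟨hs.meas_grad_F, hs.meas_grad_G, hs.meas_hess_G⟩

end MeanProblem

/-! ### One run of the oracle -/

section Oracle

universe w

variable {Ω : Type w} {n p q : ℕ} {S : Type*} {R : Type*}
  [mS : MeasurableSpace S] [mR : MeasurableSpace R]

/-- The oracle of iteration `k`, started from random points. -/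
def oracle (B : Problem n p q S R) (W : Matrix (Fin n) (Fin n) ℝ) (γ : ℝ) (X : Ω → Samples n S R)
    (k : ℕ) (x : Ω → Fin n → Vec p) (y : Ω → Fin n → Vec q) (t : ℕ) (ω : Ω) : HigpState n q :=
  higp B W γ ((X ω).xi k) ((X ω).phi k) (x ω) (y ω) t

/-- The noiseless oracle, which computes the conditional expectation of `oracle`. -/
def meanOracle (B : Problem n p q S R) (W : Matrix (Fin n) (Fin n) ℝ) (γ : ℝ)
    (x : Fin n → Vec p) (y : Fin n → Vec q) (t : ℕ) : HigpState n q :=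
  higp (meanProblem B) W γ (fun _ i => i) (fun _ i => i) x y t

/-- The hypergradient estimate formed with the noiseless oracle and without sampling. -/
def meanHypergrad (B : Problem n p q S R) (W : Matrix (Fin n) (Fin n) ℝ) (γ : ℝ)
    (x : Fin n → Vec p) (y : Fin n → Vec q) (N : ℕ) : Fin n → Vec p :=
  hypergrad (meanProblem B) (fun _ i => i) (fun _ i => i) x y (meanOracle B W γ x y N).z

/-- The points `(x_i, y_i)` of the agents. -/
def points (x : Fin n → Vec p) (y : Fin n → Vec q) : Fin n → Pair p q := fun i => pair (x i) (y i)

/-- The noise of `∇F(x_i, y_i; φ_{i,t})`. -/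
def gradNoise (B : Problem n p q S R) (X : Ω → Samples n S R) (k : ℕ) (x : Ω → Fin n → Vec p)
    (y : Ω → Fin n → Vec q) (t : ℕ) (i : Fin n) (ω : Ω) : Pair p q :=
  gradient (B.lossF ((X ω).phi k t i)) (pair (x ω i) (y ω i))
    - gradient (B.f i) (pair (x ω i) (y ω i))

/-- The noise of `∇²G(x_i, y_i; ξ_{i,t}) (0, v)`. -/
def hessNoise (B : Problem n p q S R) (X : Ω → Samples n S R) (k : ℕ) (x : Ω → Fin n → Vec p)
    (y : Ω → Fin n → Vec q) (t : ℕ) (i : Fin n) (v : Ω → Vec q) (ω : Ω) : Pair p q :=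
  hess (B.lossG ((X ω).xi k t i)) (pair (x ω i) (y ω i)) (pair 0 (v ω))
    - hess (B.g i) (pair (x ω i) (y ω i)) (pair 0 (v ω))

/-- The noise in the residual `s_{i,t}`. -/
def residualNoise (B : Problem n p q S R) (W : Matrix (Fin n) (Fin n) ℝ) (γ : ℝ)
    (X : Ω → Samples n S R) (k : ℕ) (x : Ω → Fin n → Vec p) (y : Ω → Fin n → Vec q) (t : ℕ) (ω : Ω)
    (i : Fin n) : Vec q :=
  sndBlock (hessNoise B X k x y t i (fun ω => (oracle B W γ X k x y t ω).z i) ω)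
    - sndBlock (gradNoise B X k x y t i ω)

lemma residual_eq (B : Problem n p q S R) (W : Matrix (Fin n) (Fin n) ℝ) (γ : ℝ)
    (X : Ω → Samples n S R) (k : ℕ) (x : Ω → Fin n → Vec p) (y : Ω → Fin n → Vec q)
    (t : ℕ) (ω : Ω) (i : Fin n) :
    (oracle B W γ X k x y t ω).s i
      = hessYMul (B.g i) (pair (x ω i) (y ω i)) ((oracle B W γ X k x y t ω).z i)
        - gradY (B.f i) (pair (x ω i) (y ω i)) + residualNoise B W γ X k x y t ω i := by
  have h1 : (oracle B W γ X k x y t ω).s i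
      = hessYMul (B.lossG ((X ω).xi k t i)) (pair (x ω i) (y ω i))
          ((oracle B W γ X k x y t ω).z i)
        - gradY (B.lossF ((X ω).phi k t i)) (pair (x ω i) (y ω i)) := by
    cases t with
    | zero =>
      change - gradY (B.lossF ((X ω).phi k 0 i)) (pair (x ω i) (y ω i))
        = hessYMul (B.lossG ((X ω).xi k 0 i)) (pair (x ω i) (y ω i)) 0 - _
      rw [hessYMul_zero, zero_sub]
    | succ t => rfl
  rw [h1, residualNoise, hessNoise, gradNoise, sndBlock_sub, sndBlock_sub]
  simp only [hessYMul, gradY]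
  abel

variable [m0 : MeasurableSpace Ω]

/-- The setting of one run of the oracle: standing assumptions, and starting points that only depend
on earlier samples. -/
structure OracleRun (c : Constants) (ρ : ℝ) (B : Problem n p q S R) (W : Matrix (Fin n) (Fin n) ℝ)
    (P : Measure Ω) (X : Ω → Samples n S R) (k : ℕ) (x : Ω → Fin n → Vec p)
    (y : Ω → Fin n → Vec q) : Prop where
  pos : 0 < n
  valid : c.Valid
  smooth : Smooth c B
  network : Network ρ W
  stochastic : Stochastic c B
  sampling : Sampling P B X
  meas_x : ∀ i, Measurable[sigmaOf X (oracleIdx n k 0)] fun ω => x ω i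
  meas_y : ∀ i, Measurable[sigmaOf X (oracleIdx n k 0)] fun ω => y ω i

namespace OracleRun

variable {c : Constants} {ρ : ℝ} {B : Problem n p q S R} {W : Matrix (Fin n) (Fin n) ℝ} {γ : ℝ}
  {P : Measure Ω} {X : Ω → Samples n S R} {k : ℕ} {x : Ω → Fin n → Vec p} {y : Ω → Fin n → Vec q}

lemma meas_point (h : OracleRun c ρ B W P X k x y) (t : ℕ) (i : Fin n) :
    Measurable[sigmaOf X (oracleIdx n k t)] fun ω => pair (x ω i) (y ω i) :=
  (measurable_pair (h.meas_x i) (h.meas_y i)).mono (sigmaOf_mono (oracleIdx_mono k (Nat.zero_le _)))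
    le_rfl

lemma meas_z (h : OracleRun c ρ B W P X k x y) (t : ℕ) (i : Fin n) :
    Measurable[sigmaOf X (oracleIdx n k t)] fun ω => (oracle B W γ X k x y t ω).z i := by
  have hle := sigmaOf_mono (X := X) (oracleIdx_mono (n := n) k (Nat.zero_le t))
  exact (MeasurableLoss.higp (m := sigmaOf X (oracleIdx n k t)) (xi := fun ω => (X ω).xi k)
    (phi := fun ω => (X ω).phi k) h.stochastic.measurableLoss
    (fun i => (h.meas_x i).mono hle le_rfl) (fun i => (h.meas_y i).mono hle le_rfl) t
    (fun t' ht' h0 i => measurable_xi (Or.inr ⟨rfl, h0, ht'⟩))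
    (fun t' ht' i => measurable_phi (Or.inr ⟨rfl, ht'⟩))).1 i

lemma meas_meanOracle (h : OracleRun c ρ B W P X k x y) (t : ℕ) (i : Fin n) :
    Measurable[sigmaOf X (oracleIdx n k 0)] fun ω => (meanOracle B W γ (x ω) (y ω) t).z i :=
  (MeasurableLoss.higp (m := sigmaOf X (oracleIdx n k 0)) (xi := fun _ _ i => i)
    (phi := fun _ _ i => i) h.smooth.measurableLoss_meanProblem h.meas_x h.meas_y t
    (fun _ _ _ _ => measurable_const) (fun _ _ _ => measurable_const)).1 i

lemma meas_meanHypergrad (h : OracleRun c ρ B W P X k x y) (N : ℕ) (i : Fin n) :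
    Measurable[sigmaOf X (oracleIdx n k 0)] fun ω => meanHypergrad B W γ (x ω) (y ω) N i :=
  (h.smooth.measurableLoss_meanProblem.gradX_F (φ := fun _ => i) measurable_const
    (h.meas_point 0 i)).sub
  (h.smooth.measurableLoss_meanProblem.jacXYMul_G (ξ := fun _ => i) measurable_const
    (h.meas_point 0 i) (h.meas_meanOracle N i))

lemma centered_gradNoise [IsProbabilityMeasure P] (h : OracleRun c ρ B W P X k x y) (t : ℕ)
    (i : Fin n) : Centered P (sigmaOf X (oracleIdx n k t)) (gradNoise B X k x y t i) ∧
      ∫ ω, ‖gradNoise B X k x y t i ω‖ ^ 2 ∂P ≤ c.sigF ^ 2 :=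
  Unbiased.centered_noise (G := fun z s => gradient (B.lossF s) z) (m := gradient (B.f i))
    (h.stochastic.grad_F i) h.stochastic.meas_grad_F (h.smooth.lip_grad_f i).measurable
    (h.sampling.sigmaOf_le _) (h.sampling.meas_phi k t i) (h.sampling.law_phi k t i)
    (h.sampling.indep_sigmaOf (a := Sum.inr (Sum.inr (k, t, i))) (by
      simp [oracleIdx])) (h.meas_point t i)

lemma centered_hessNoise [IsProbabilityMeasure P] (h : OracleRun c ρ B W P X k x y) {t t' : ℕ}
    (ht : t = 0 ∨ t' ≤ t) (i : Fin n) {v : Ω → Vec q}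
    (hv : Measurable[sigmaOf X (oracleIdx n k t')] v) (hv2 : MemLp v 2 P) :
    Centered P (sigmaOf X (oracleIdx n k t')) (hessNoise B X k x y t i v) ∧
      ∫ ω, ‖hessNoise B X k x y t i v ω‖ ^ 2 ∂P ≤ c.sigG2 ^ 2 * ∫ ω, ‖v ω‖ ^ 2 ∂P := by
  have h1 := Unbiased.centered_noise_apply (G := fun z s => hess (B.lossG s) z)
    (m := hess (B.g i)) (h.stochastic.hess_G i) h.stochastic.meas_hess_G
    (h.smooth.lip_hess_g i).measurable (h.sampling.sigmaOf_le _) (h.sampling.meas_xi k t i)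
    (h.sampling.law_xi k t i)
    (h.sampling.indep_sigmaOf (J := oracleIdx n k t') (a := Sum.inr (Sum.inl (k, t, i))) (by
      simp only [oracleIdx, Set.mem_ofPred_eq, Sum.elim_inr, Sum.elim_inl]
      omega)) (h.meas_point t' i) (v := fun ω => pair 0 (v ω))
    ((inrL p q).measurable.comp hv) ((inrL p q).comp_memLp' hv2)
  simp only [norm_pair_zero_left] at h1
  exact h1

lemma memLp_hessYMul [IsProbabilityMeasure P] (h : OracleRun c ρ B W P X k x y) (i : Fin n)
    {v : Ω → Vec q} (hv : MemLp v 2 P) :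
    MemLp (fun ω => hessYMul (B.g i) (pair (x ω i) (y ω i)) (v ω)) 2 P := by
  have happ : Continuous fun a : (Vec q →L[ℝ] Vec q) × Vec q => a.1 a.2 :=
    isBoundedBilinearMap_apply.continuous
  have hT : Measurable fun ω => sndL p q ∘L hess (B.g i) (pair (x ω i) (y ω i)) ∘L inrL p q := by
    have hc : Continuous fun T : Pair p q →L[ℝ] Pair p q => sndL p q ∘L T ∘L inrL p q := by
      fun_prop
    exact hc.measurable.comp ((h.smooth.lip_hess_g i).measurable.comp
      ((h.meas_point 0 i).mono (h.sampling.sigmaOf_le _) le_rfl))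
  refine hv.of_le_mul (c := c.Lg1) ?_ (Filter.Eventually.of_forall fun ω =>
    norm_hessYMul_le (h.smooth.norm_hess_le h.valid i _) _)
  exact happ.comp_aestronglyMeasurable (hT.aestronglyMeasurable.prodMk hv.1)

lemma memLp_of_bound [IsProbabilityMeasure P] {E : Type*} [NormedAddCommGroup E]
    [MeasurableSpace E] [BorelSpace E] [SecondCountableTopology E] {v : Ω → E} (hv : Measurable v)
    {C : ℝ} (hC : ∀ ω, ‖v ω‖ ≤ C) : MemLp v 2 P :=
  MemLp.of_bound hv.aestronglyMeasurable C (Filter.Eventually.of_forall hC)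

lemma meas_point0 (h : OracleRun c ρ B W P X k x y) (i : Fin n) :
    Measurable fun ω => pair (x ω i) (y ω i) :=
  (h.meas_point 0 i).mono (h.sampling.sigmaOf_le _) le_rfl

lemma memLp_gradient_f [IsProbabilityMeasure P] (h : OracleRun c ρ B W P X k x y) (i : Fin n) :
    MemLp (fun ω => gradient (B.f i) (pair (x ω i) (y ω i))) 2 P :=
  memLp_of_bound (v := fun ω => gradient (B.f i) (pair (x ω i) (y ω i)))
    ((h.smooth.lip_grad_f i).measurable.comp (h.meas_point0 i))
    fun _ => (h.smooth.lip_f i).norm_gradient_le h.valid.Lf0_pos.le _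

/-- The noise of the residuals in round `t` is centered given everything drawn before that round. -/
lemma centered_residualNoise [IsProbabilityMeasure P] (h : OracleRun c ρ B W P X k x y) (t : ℕ)
    (i : Fin n) (hz : MemLp (fun ω => (oracle B W γ X k x y t ω).z i) 2 P) :
    Centered P (sigmaOf X (oracleIdx n k t)) fun ω => residualNoise B W γ X k x y t ω i :=
  (((h.centered_hessNoise (Or.inr le_rfl) i (h.meas_z t i) hz).1).clm (h.sampling.sigmaOf_le _)
    (sndL p q)).sub (((h.centered_gradNoise t i).1).clm (h.sampling.sigmaOf_le _) (sndL p q))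

lemma memLp_s [IsProbabilityMeasure P] (h : OracleRun c ρ B W P X k x y) (t : ℕ)
    (i : Fin n) (hz : MemLp (fun ω => (oracle B W γ X k x y t ω).z i) 2 P) :
    MemLp (fun ω => (oracle B W γ X k x y t ω).s i) 2 P := by
  simp only [residual_eq]
  exact ((h.memLp_hessYMul i hz).sub ((sndL p q).comp_memLp' (h.memLp_gradient_f i))).add
    (h.centered_residualNoise t i hz).memLp

lemma memL2_zds [IsProbabilityMeasure P] (h : OracleRun c ρ B W P X k x y) (t : ℕ) :
    MemL2 P (fun ω => (oracle B W γ X k x y t ω).z) ∧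
      MemL2 P (fun ω => (oracle B W γ X k x y t ω).d) ∧
      MemL2 P (fun ω => (oracle B W γ X k x y t ω).s) := by
  induction t with
  | zero =>
    have hz : MemL2 P (fun ω => (oracle B W γ X k x y 0 ω).z) := fun i => MemLp.zero'
    exact ⟨hz, fun i => h.memLp_s 0 i (hz i), fun i => h.memLp_s 0 i (hz i)⟩
  | succ t ih =>
    obtain ⟨hz, hd, hs⟩ := ih
    have hz' : MemL2 P (fun ω => (oracle B W γ X k x y (t + 1) ω).z) :=
      (hz.mix W).sub (hd.smul γ)
    have hs' : MemL2 P (fun ω => (oracle B W γ X k x y (t + 1) ω).s) :=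
      fun i => h.memLp_s (t + 1) i (hz' i)
    exact ⟨hz', ((hd.mix W).add hs').sub hs, hs'⟩

/-- The bound for the data and the additive noise that enters the tracking estimate. -/
def _root_.DSBO.Constants.tau (c : Constants) (n : ℕ) : ℝ := n * (c.Lf0 ^ 2 + 2 * c.sigF ^ 2)

lemma integral_sqn_residualNoise_le [IsProbabilityMeasure P] (h : OracleRun c ρ B W P X k x y)
    (t : ℕ) : ∫ ω, sqn (residualNoise B W γ X k x y t ω) ∂P
      ≤ (2 * c.sigG2) ^ 2 * ∫ ω, sqn ((oracle B W γ X k x y t ω).z) ∂P + c.tau n := by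
  have hz := (h.memL2_zds (γ := γ) t).1
  have hi : ∀ i, ∫ ω, ‖residualNoise B W γ X k x y t ω i‖ ^ 2 ∂P
      ≤ (2 * c.sigG2) ^ 2 * ∫ ω, ‖(oracle B W γ X k x y t ω).z i‖ ^ 2 ∂P + 2 * c.sigF ^ 2 := by
    intro i
    obtain ⟨hH, hHle⟩ := h.centered_hessNoise (Or.inr le_rfl) i (h.meas_z (γ := γ) t i) (hz i)
    obtain ⟨hG, hGle⟩ := h.centered_gradNoise t i
    have h1 := integral_le_of_le₂ (a₁ := 2) (a₂ := 2) (e := 0)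
      (integrable_norm_sq (h.centered_residualNoise (γ := γ) t i (hz i)).memLp)
      (integrable_norm_sq hH.memLp) (integrable_norm_sq hG.memLp) (fun ω => by
        refine (norm_sub_sq_le_two _ _).trans ?_
        rw [add_zero]
        gcongr <;> exact norm_sndBlock_le _)
    have h2 : 0 ≤ c.sigG2 ^ 2 * ∫ ω, ‖(oracle B W γ X k x y t ω).z i‖ ^ 2 ∂P :=
      mul_nonneg (sq_nonneg _) (integral_nonneg fun ω => by positivity)
    nlinarith
  have hres : ∀ i, Integrable (fun ω => ‖residualNoise B W γ X k x y t ω i‖ ^ 2) P := fun i =>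
    integrable_norm_sq (h.centered_residualNoise (γ := γ) t i (hz i)).memLp
  simp only [sqn]
  rw [integral_finsetSum _ fun i _ => hres i,
    integral_finsetSum _ fun i _ => integrable_norm_sq (hz i)]
  refine (Finset.sum_le_sum fun i _ => hi i).trans ?_
  rw [Finset.sum_add_distrib, ← Finset.mul_sum]
  simp only [Finset.sum_const, Finset.card_univ, Fintype.card_fin, nsmul_eq_mul, Constants.tau]
  have : 0 ≤ (n : ℝ) * c.Lf0 ^ 2 := by positivity
  linarith

lemma tau_nonneg : 0 ≤ c.tau n := by unfold Constants.tau; positivity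

lemma sqn_gradY_f_le (h : OracleRun c ρ B W P X k x y) (ω : Ω) :
    sqn (fun i => gradY (B.f i) (pair (x ω i) (y ω i))) ≤ n * c.Lf0 ^ 2 :=
  sqn_le_of_norm_le fun i => h.smooth.norm_gradY_f_le h.valid i _

/-- The stochastic oracle is noisy gradient tracking for the averaged linear system. -/
lemma tracking [IsProbabilityMeasure P] (h : OracleRun c ρ B W P X k x y) :
    Tracking P W γ c.mu c.Lg1 (2 * c.sigG2) (c.tau n)
      (fun ω i => sndL p q ∘L hess (B.g i) (pair (x ω i) (y ω i)) ∘L inrL p q)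
      (fun ω i => gradY (B.f i) (pair (x ω i) (y ω i)))
      (fun t ω => (oracle B W γ X k x y t ω).z) (fun t ω => (oracle B W γ X k x y t ω).d)
      (fun t ω => (oracle B W γ X k x y t ω).s) (residualNoise B W γ X k x y) where
  step_z _ _ _ := rfl
  step_d _ _ _ := rfl
  avg_zero _ := rfl
  residual t ω i := residual_eq B W γ X k x y t ω i
  norm_le _ i v := norm_hessYMul_le (h.smooth.norm_hess_le h.valid i _) v
  coercive ω v := h.smooth.inner_avg_hessYMul_ge h.pos (fun i => pair (x ω i) (y ω i)) v
  sqn_b_le ω := by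
    refine (h.sqn_gradY_f_le ω).trans ?_
    unfold Constants.tau
    have : 0 ≤ (n : ℝ) * (2 * c.sigF ^ 2) := by positivity
    linarith
  memL2_z t := (h.memL2_zds t).1
  memL2_d t := (h.memL2_zds t).2.1
  memL2_s t := (h.memL2_zds t).2.2
  memL2_noise t i := (h.centered_residualNoise t i ((h.memL2_zds t).1 i)).memLp
  noise_le t := h.integral_sqn_residualNoise_le t
  orthogonal t := by
    have hz := (h.memL2_zds (γ := γ) t).1
    have hcen : Centered P (sigmaOf X (oracleIdx n k t))
        fun ω => avg (residualNoise B W γ X k x y t ω) :=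
      (Centered.sum fun i _ => h.centered_residualNoise (γ := γ) t i (hz i)).smul (1 / (n : ℝ))
    have e : ∀ ω i, (oracle B W γ X k x y t ω).s i - residualNoise B W γ X k x y t ω i
        = hessYMul (B.g i) (pair (x ω i) (y ω i)) ((oracle B W γ X k x y t ω).z i)
          - gradY (B.f i) (pair (x ω i) (y ω i)) := fun ω i => by
      rw [residual_eq]; abel
    simp only [e]
    refine hcen.orthogonal _ ?_ (hz.avg.sub (MemLp.const_smul (MemL2.avg fun i =>
      (h.memLp_hessYMul i (hz i)).sub ((sndL p q).comp_memLp' (h.memLp_gradient_f i))) γ))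
    have hle := sigmaOf_mono (X := X) (oracleIdx_mono (n := n) k (Nat.zero_le t))
    refine (measurable_avg (m := sigmaOf X (oracleIdx n k t)) (fun i => h.meas_z t i)).sub
      (Measurable.const_smul (measurable_avg (m := sigmaOf X (oracleIdx n k t)) fun i => ?_) γ)
    exact (h.smooth.measurableLoss_meanProblem.hessYMul_G (ξ := fun _ => i) measurable_const
      (h.meas_point t i) (h.meas_z t i)).sub
      (h.smooth.measurableLoss_meanProblem.gradY_F (φ := fun _ => i) measurable_const
      (h.meas_point t i))

lemma integral_sqn_z_le [IsProbabilityMeasure P] (h : OracleRun c ρ B W P X k x y) {θ A : ℝ}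
    (hθ0 : 0 < θ) (hθ1 : θ < 1) (hA : 0 < A)
    (hT : TrackingBound.{w} c.mu c.Lg1 (2 * c.sigG2) ρ γ θ A) (t : ℕ) :
    ∫ ω, sqn ((oracle B W γ X k x y t ω).z) ∂P ≤ A * (5 * c.tau n) := by
  have h1 := hT P h.pos h.network tau_nonneg (h.tracking (γ := γ)) t
  refine h1.trans (mul_le_mul_of_nonneg_left ?_ hA.le)
  have e0 : ∫ ω, sqn ((oracle B W γ X k x y 0 ω).z) ∂P = 0 := by
    simp [oracle, higp, sqn]
  have ed : ∫ ω, sqn ((oracle B W γ X k x y 0 ω).d) ∂P ≤ 4 * c.tau n := by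
    have hr := h.integral_sqn_residualNoise_le (γ := γ) 0
    rw [e0, mul_zero, zero_add] at hr
    have hpt : ∀ ω, sqn ((oracle B W γ X k x y 0 ω).d)
        ≤ 2 * sqn (residualNoise B W γ X k x y 0 ω) + 2 * (n * c.Lf0 ^ 2) := by
      intro ω
      have e : (oracle B W γ X k x y 0 ω).d = fun i => residualNoise B W γ X k x y 0 ω i
          - gradY (B.f i) (pair (x ω i) (y ω i)) := by
        funext i
        have := residual_eq B W γ X k x y 0 ω i
        change (oracle B W γ X k x y 0 ω).s i = _
        rw [this]
        change hessYMul _ _ 0 - _ + _ = _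
        rw [hessYMul_zero]; abel
      rw [e]
      refine (sqn_sub_le_two _ _).trans ?_
      have := h.sqn_gradY_f_le ω
      linarith
    have hz := (h.memL2_zds (γ := γ) 0).1
    have h2 := integral_le_of_le₁ (h.memL2_zds (γ := γ) 0).2.1.integrable_sqn
      (MemL2.integrable_sqn fun i => (h.centered_residualNoise (γ := γ) 0 i (hz i)).memLp) hpt
    have h4 : (n : ℝ) * c.Lf0 ^ 2 + 2 * (n * c.sigF ^ 2) = c.tau n := by
      unfold Constants.tau; ring
    have h5 : 0 ≤ (n : ℝ) * c.sigF ^ 2 := by positivity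
    linarith
  rw [e0, zero_add]
  have hp : θ ^ t ≤ 1 := pow_le_one₀ hθ0.le hθ1.le
  have h0 : 0 ≤ ∫ ω, sqn ((oracle B W γ X k x y 0 ω).d) ∂P := integral_nonneg fun ω => sqn_nonneg _
  have := mul_le_mul_of_nonneg_right hp h0
  linarith

end OracleRun

end Oracle

universe w

/-! ### The bias of the oracle -/

section MeanOracle

variable {n p q : ℕ} {S : Type*} {R : Type*} [MeasurableSpace S] [MeasurableSpace R]
  {c : Constants} {ρ : ℝ} {B : Problem n p q S R} {W : Matrix (Fin n) (Fin n) ℝ} {γ : ℝ}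

lemma meanOracle_s_eq (B : Problem n p q S R) (W : Matrix (Fin n) (Fin n) ℝ) (γ : ℝ)
    (x : Fin n → Vec p) (y : Fin n → Vec q) (t : ℕ) (i : Fin n) :
    (meanOracle B W γ x y t).s i
      = hessYMul (B.g i) (pair (x i) (y i)) ((meanOracle B W γ x y t).z i)
        - gradY (B.f i) (pair (x i) (y i)) := by
  cases t with
  | zero =>
    change - gradY (B.f i) (pair (x i) (y i)) = hessYMul (B.g i) (pair (x i) (y i)) 0 - _
    rw [hessYMul_zero, zero_sub]
  | succ t => rfl

/-- The error of the noiseless oracle obeys the homogeneous tracking recursion. -/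
lemma Smooth.tracking_meanOracle (hs : Smooth c B) (hc : c.Valid) (hn : 0 < n)
    (hW : Network ρ W) (x : Fin n → Vec p) (y : Fin n → Vec q) :
    Tracking (Measure.dirac (PUnit.unit : PUnit.{w + 1})) W γ c.mu c.Lg1 (2 * c.sigG2) 0
      (fun _ i => sndL p q ∘L hess (B.g i) (points x y i) ∘L inrL p q) (fun _ _ => 0)
      (fun t _ i => (meanOracle B W γ x y t).z i - zSol B (points x y))
      (fun t _ => (meanOracle B W γ x y t).d)
      (fun t _ i => (meanOracle B W γ x y t).s i
        - (hessYMul (B.g i) (points x y i) (zSol B (points x y)) - gradY (B.f i) (points x y i)))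
      (fun _ _ _ => 0) where
  step_z t _ i := by
    have h1 := congrFun (mix_sub (W := W) (meanOracle B W γ x y t).z
      fun _ => zSol B (points x y)) i
    rw [hW.mix_const] at h1
    rw [h1]
    change mix W (meanOracle B W γ x y t).z i - γ • (meanOracle B W γ x y t).d i - _ = _
    abel
  step_d t _ i := by
    change mix W (meanOracle B W γ x y t).d i + (meanOracle B W γ x y (t + 1)).s i
      - (meanOracle B W γ x y t).s i = _
    abel
  avg_zero _ := by
    rw [avg_sub, avg_sub, hs.zSol_spec hc hn, sub_self, sub_zero]
    rfl
  residual t _ i := by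
    rw [meanOracle_s_eq, map_sub]
    simp only [ContinuousLinearMap.comp_apply]
    change _ - (_ - _) = (hessYMul (B.g i) (points x y i) _ - hessYMul (B.g i) (points x y i) _) - 0 + 0
    simp only [points]
    abel
  norm_le _ i v := norm_hessYMul_le (hs.norm_hess_le hc i _) v
  coercive _ v := hs.inner_avg_hessYMul_ge hn (points x y) v
  sqn_b_le _ := by simp [sqn]
  memL2_z _ _ := memLp_const _
  memL2_d _ _ := memLp_const _
  memL2_s _ _ := memLp_const _
  memL2_noise _ _ := memLp_const _
  noise_le t := by
    simp only [sqn, norm_zero]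
    have : 0 ≤ (2 * c.sigG2) ^ 2
        * ∑ i, ‖(meanOracle B W γ x y t).z i - zSol B (points x y)‖ ^ 2 := by positivity
    simpa using this
  orthogonal t := by simp [avg_zero]

/-- The initial error of the noiseless oracle. -/
def Constants.oracleInit (c : Constants) (n : ℕ) : ℝ := n * ((c.Lf0 / c.mu) ^ 2 + c.Lf0 ^ 2)

lemma Smooth.sqn_meanOracle_sub_le (hs : Smooth c B) (hc : c.Valid) (hn : 0 < n)
    (hW : Network ρ W) {θ A : ℝ} (hθ : 0 < θ) (hA : 0 < A)
    (hT : TrackingBound.{w} c.mu c.Lg1 (2 * c.sigG2) ρ γ θ A)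
    (x : Fin n → Vec p) (y : Fin n → Vec q) (t : ℕ) :
    sqn (fun i => (meanOracle B W γ x y t).z i - zSol B (points x y))
      ≤ A * (θ ^ t * c.oracleInit n) := by
  have h := hT (Measure.dirac (PUnit.unit : PUnit.{w + 1})) hn hW le_rfl
    (hs.tracking_meanOracle hc hn hW x y) t
  simp only [integral_dirac, add_zero] at h
  refine h.trans ?_
  have h1 : sqn (fun i => (meanOracle B W γ x y 0).z i - zSol B (points x y))
      ≤ n * (c.Lf0 / c.mu) ^ 2 := sqn_le_of_norm_le fun i => by
    change ‖0 - zSol B (points x y)‖ ≤ _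
    rw [zero_sub, norm_neg]
    exact hs.norm_zSol_le hc hn _
  have h2 : sqn (meanOracle B W γ x y 0).d ≤ n * c.Lf0 ^ 2 :=
    sqn_le_of_norm_le fun i => by
      change ‖- gradY (B.f i) _‖ ≤ _
      rw [norm_neg]
      exact hs.norm_gradY_f_le hc i _
  have h3 : 0 < θ ^ t := pow_pos hθ t
  refine mul_le_mul_of_nonneg_left (mul_le_mul_of_nonneg_left ?_ h3.le) hA.le
  unfold Constants.oracleInit
  linarith

/-- The noiseless hypergradient approximates the hypergradient geometrically fast. -/
lemma Smooth.norm_avg_meanHypergrad_sub_le (hs : Smooth c B) (hc : c.Valid) (hn : 0 < n)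
    (hW : Network ρ W) {θ A : ℝ} (hθ : 0 < θ) (hA : 0 < A)
    (hT : TrackingBound.{w} c.mu c.Lg1 (2 * c.sigG2) ρ γ θ A)
    (x : Fin n → Vec p) (y : Fin n → Vec q) (N : ℕ) :
    ‖avg (meanHypergrad B W γ x y N) - hyperGrad B (points x y)‖ ^ 2
      ≤ c.Lg1 ^ 2 * (A * (θ ^ N * c.oracleInit n)) := by
  have h1 := hs.norm_avg_hypergrad_sub_le hc (points x y) (meanOracle B W γ x y N).z
  have h2 : (1 / (n : ℝ)) * ∑ i, ‖(meanOracle B W γ x y N).z i - zSol B (points x y)‖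
      = meanDist (p := 0) (fun i => pair 0 ((meanOracle B W γ x y N).z i))
        fun _ => pair 0 (zSol B (points x y)) := by
    simp only [meanDist, pair_sub, sub_self, norm_pair_zero_left]
  have h3 := meanDist_sq_le (p := 0) hn (fun i => pair 0 ((meanOracle B W γ x y N).z i))
    fun _ => pair 0 (zSol B (points x y))
  have h4 := hs.sqn_meanOracle_sub_le hc hn hW hθ hA hT x y N
  have h5 : sqn (fun i => pair (0 : Vec 0) ((meanOracle B W γ x y N).z i)
      - pair 0 (zSol B (points x y)))
      = sqn fun i => (meanOracle B W γ x y N).z i - zSol B (points x y) := by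
    simp only [sqn, pair_sub, sub_self, norm_pair_zero_left]
  rw [h2] at h1
  rw [h5] at h3
  refine (pow_le_pow_left₀ (norm_nonneg _) h1 2).trans ?_
  rw [mul_pow]
  exact mul_le_mul_of_nonneg_left (h3.trans h4) (sq_nonneg _)

end MeanOracle

section Oracle

variable {Ω : Type w} {n p q : ℕ} {S : Type*} {R : Type*}
  [mS : MeasurableSpace S] [mR : MeasurableSpace R]
  {B : Problem n p q S R} {W : Matrix (Fin n) (Fin n) ℝ} {γ : ℝ}
  {X : Ω → Samples n S R} {k : ℕ} {x : Ω → Fin n → Vec p} {y : Ω → Fin n → Vec q}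

/-- The stochastic hypergradient of the iteration. -/
def stochHypergrad (B : Problem n p q S R) (W : Matrix (Fin n) (Fin n) ℝ) (γ : ℝ)
    (X : Ω → Samples n S R) (k : ℕ) (x : Ω → Fin n → Vec p) (y : Ω → Fin n → Vec q) (N : ℕ)
    (ω : Ω) : Fin n → Vec p :=
  hypergrad B ((X ω).xi k) ((X ω).phi k) (x ω) (y ω) (oracle B W γ X k x y N ω).z

lemma stochHypergrad_eq (N : ℕ) (ω : Ω) (i : Fin n) :
    stochHypergrad B W γ X k x y N ω i
      = (gradX (B.f i) (pair (x ω i) (y ω i))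
          - jacXYMul (B.g i) (pair (x ω i) (y ω i)) ((oracle B W γ X k x y N ω).z i))
        + (fstBlock (gradNoise B X k x y 0 i ω)
          - fstBlock (hessNoise B X k x y 0 i (fun ω => (oracle B W γ X k x y N ω).z i) ω)) := by
  rw [gradNoise, hessNoise, fstBlock_sub, fstBlock_sub]
  simp only [stochHypergrad, hypergrad, jacXYMul, gradX]
  abel

variable [m0 : MeasurableSpace Ω] {c : Constants} {ρ : ℝ} {P : Measure Ω}

namespace OracleRun

lemma centered_hessYMul (h : OracleRun c ρ B W P X k x y) (i : Fin n) {v : Ω → Vec q}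
    (hv : Centered P (sigmaOf X (oracleIdx n k 0)) v) :
    Centered P (sigmaOf X (oracleIdx n k 0))
      fun ω => hessYMul (B.g i) (pair (x ω i) (y ω i)) (v ω) := by
  have hc : Continuous fun T : Pair p q →L[ℝ] Pair p q => T ∘L inrL p q := by fun_prop
  refine (hv.clm_apply (h.sampling.sigmaOf_le _)
    (T := fun ω => hess (B.g i) (pair (x ω i) (y ω i)) ∘L inrL p q) (C := c.Lg1)
    (hc.measurable.comp ((h.smooth.lip_hess_g i).measurable.comp (h.meas_point 0 i)))
    fun ω => ?_).clm (h.sampling.sigmaOf_le _) (sndL p q)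
  refine ContinuousLinearMap.opNorm_le_bound _ h.valid.Lg1_pos.le fun v => ?_
  exact norm_hess_apply_le (h.smooth.norm_hess_le h.valid i _) v

lemma centered_jacXYMul (h : OracleRun c ρ B W P X k x y) (i : Fin n) {v : Ω → Vec q}
    (hv : Centered P (sigmaOf X (oracleIdx n k 0)) v) :
    Centered P (sigmaOf X (oracleIdx n k 0))
      fun ω => jacXYMul (B.g i) (pair (x ω i) (y ω i)) (v ω) := by
  have hc : Continuous fun T : Pair p q →L[ℝ] Pair p q => T ∘L inrL p q := by fun_prop
  refine (hv.clm_apply (h.sampling.sigmaOf_le _)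
    (T := fun ω => hess (B.g i) (pair (x ω i) (y ω i)) ∘L inrL p q) (C := c.Lg1)
    (hc.measurable.comp ((h.smooth.lip_hess_g i).measurable.comp (h.meas_point 0 i)))
    fun ω => ?_).clm (h.sampling.sigmaOf_le _) (fstL p q)
  refine ContinuousLinearMap.opNorm_le_bound _ h.valid.Lg1_pos.le fun v => ?_
  exact norm_hess_apply_le (h.smooth.norm_hess_le h.valid i _) v

lemma centered_mix {d : ℕ} {𝓕 : MeasurableSpace Ω} {v : Ω → Fin n → Vec d}
    (hv : ∀ i, Centered P 𝓕 fun ω => v ω i) (i : Fin n) : Centered P 𝓕 fun ω => mix W (v ω) i :=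
  Centered.sum fun j _ => (hv j).smul (W i j)

/-- The noiseless oracle computes the conditional expectation of the oracle. -/
lemma centered_oracle_sub [IsProbabilityMeasure P] (h : OracleRun c ρ B W P X k x y) (t : ℕ) :
    (∀ i, Centered P (sigmaOf X (oracleIdx n k 0)) fun ω =>
      (oracle B W γ X k x y t ω).z i - (meanOracle B W γ (x ω) (y ω) t).z i) ∧
    (∀ i, Centered P (sigmaOf X (oracleIdx n k 0)) fun ω =>
      (oracle B W γ X k x y t ω).d i - (meanOracle B W γ (x ω) (y ω) t).d i) ∧
    (∀ i, Centered P (sigmaOf X (oracleIdx n k 0)) fun ω =>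
      (oracle B W γ X k x y t ω).s i - (meanOracle B W γ (x ω) (y ω) t).s i) := by
  have hs : ∀ t, (∀ i, Centered P (sigmaOf X (oracleIdx n k 0)) fun ω =>
      (oracle B W γ X k x y t ω).z i - (meanOracle B W γ (x ω) (y ω) t).z i) → ∀ i,
      Centered P (sigmaOf X (oracleIdx n k 0)) fun ω =>
      (oracle B W γ X k x y t ω).s i - (meanOracle B W γ (x ω) (y ω) t).s i := by
    intro t hz i
    have e : ∀ ω, (oracle B W γ X k x y t ω).s i - (meanOracle B W γ (x ω) (y ω) t).s i
        = hessYMul (B.g i) (pair (x ω i) (y ω i))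
          ((oracle B W γ X k x y t ω).z i - (meanOracle B W γ (x ω) (y ω) t).z i)
          + residualNoise B W γ X k x y t ω i := by
      intro ω
      rw [residual_eq, meanOracle_s_eq, hessYMul_sub]; abel
    simp only [e]
    exact (h.centered_hessYMul i (hz i)).add
      ((h.centered_residualNoise t i ((h.memL2_zds t).1 i)).mono
        (sigmaOf_mono (oracleIdx_mono k (Nat.zero_le t))))
  induction t with
  | zero =>
    have hz : ∀ i, Centered P (sigmaOf X (oracleIdx n k 0)) fun ω =>
        (oracle B W γ X k x y 0 ω).z i - (meanOracle B W γ (x ω) (y ω) 0).z i := by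
      intro i
      have e : ∀ ω, (oracle B W γ X k x y 0 ω).z i - (meanOracle B W γ (x ω) (y ω) 0).z i = 0 :=
        fun ω => sub_self (0 : Vec q)
      simp only [e]
      exact Centered.zero
    exact ⟨hz, hs 0 hz, hs 0 hz⟩
  | succ t ih =>
    obtain ⟨iz, id, is⟩ := ih
    have hz : ∀ i, Centered P (sigmaOf X (oracleIdx n k 0)) fun ω =>
        (oracle B W γ X k x y (t + 1) ω).z i - (meanOracle B W γ (x ω) (y ω) (t + 1)).z i := by
      intro i
      have e : ∀ ω, (oracle B W γ X k x y (t + 1) ω).z i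
          - (meanOracle B W γ (x ω) (y ω) (t + 1)).z i
          = mix W (fun i => (oracle B W γ X k x y t ω).z i
            - (meanOracle B W γ (x ω) (y ω) t).z i) i
            - γ • ((oracle B W γ X k x y t ω).d i - (meanOracle B W γ (x ω) (y ω) t).d i) := by
        intro ω
        rw [mix_sub, smul_sub]
        change (mix W (oracle B W γ X k x y t ω).z i - γ • (oracle B W γ X k x y t ω).d i)
          - (mix W (meanOracle B W γ (x ω) (y ω) t).z i
            - γ • (meanOracle B W γ (x ω) (y ω) t).d i) = _
        exact sub_sub_sub_comm _ _ _ _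
      simp only [e]
      exact (centered_mix iz i).sub ((id i).smul γ)
    refine ⟨hz, fun i => ?_, hs (t + 1) hz⟩
    have e : ∀ ω, (oracle B W γ X k x y (t + 1) ω).d i
        - (meanOracle B W γ (x ω) (y ω) (t + 1)).d i
        = mix W (fun i => (oracle B W γ X k x y t ω).d i
            - (meanOracle B W γ (x ω) (y ω) t).d i) i
          + ((oracle B W γ X k x y (t + 1) ω).s i - (meanOracle B W γ (x ω) (y ω) (t + 1)).s i)
          - ((oracle B W γ X k x y t ω).s i - (meanOracle B W γ (x ω) (y ω) t).s i) := by
      intro ω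
      rw [mix_sub]
      change (mix W (oracle B W γ X k x y t ω).d i + (oracle B W γ X k x y (t + 1) ω).s i
          - (oracle B W γ X k x y t ω).s i)
        - (mix W (meanOracle B W γ (x ω) (y ω) t).d i + (meanOracle B W γ (x ω) (y ω) (t + 1)).s i
          - (meanOracle B W γ (x ω) (y ω) t).s i) = _
      exact (sub_sub_sub_comm _ _ _ _).trans (congrArg (· - _) (add_sub_add_comm _ _ _ _))
    simp only [e]
    exact ((centered_mix id i).add (hs (t + 1) hz i)).sub (is i)

lemma centered_hessNoise_zero [IsProbabilityMeasure P] (h : OracleRun c ρ B W P X k x y) (N : ℕ)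
    (i : Fin n) : Centered P (sigmaOf X (oracleIdx n k 0))
      (hessNoise B X k x y 0 i fun ω => (oracle B W γ X k x y N ω).z i) ∧
      ∫ ω, ‖hessNoise B X k x y 0 i (fun ω => (oracle B W γ X k x y N ω).z i) ω‖ ^ 2 ∂P
        ≤ c.sigG2 ^ 2 * ∫ ω, ‖(oracle B W γ X k x y N ω).z i‖ ^ 2 ∂P := by
  have h1 := h.centered_hessNoise (t := 0) (t' := N) (Or.inl rfl) i (h.meas_z (γ := γ) N i)
    ((h.memL2_zds N).1 i)
  exact ⟨h1.1.mono (sigmaOf_mono (oracleIdx_mono k (Nat.zero_le N))), h1.2⟩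

/-- Given the points, the stochastic hypergradient has the noiseless one as its mean. -/
lemma centered_stochHypergrad_sub [IsProbabilityMeasure P] (h : OracleRun c ρ B W P X k x y)
    (N : ℕ) (i : Fin n) : Centered P (sigmaOf X (oracleIdx n k 0)) fun ω =>
      stochHypergrad B W γ X k x y N ω i - meanHypergrad B W γ (x ω) (y ω) N i := by
  have e : ∀ ω, stochHypergrad B W γ X k x y N ω i - meanHypergrad B W γ (x ω) (y ω) N i
      = (fstL p q (gradNoise B X k x y 0 i ω)
          - fstL p q (hessNoise B X k x y 0 i (fun ω => (oracle B W γ X k x y N ω).z i) ω))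
        - jacXYMul (B.g i) (pair (x ω i) (y ω i))
          ((oracle B W γ X k x y N ω).z i - (meanOracle B W γ (x ω) (y ω) N).z i) := by
    intro ω
    rw [stochHypergrad_eq, jacXYMul_sub]
    have : meanHypergrad B W γ (x ω) (y ω) N i = gradX (B.f i) (pair (x ω i) (y ω i))
      - jacXYMul (B.g i) (pair (x ω i) (y ω i)) ((meanOracle B W γ (x ω) (y ω) N).z i) := rfl
    rw [this, fstL_apply, fstL_apply]
    abel
  simp only [e]
  exact (((h.centered_gradNoise 0 i).1.clm (h.sampling.sigmaOf_le _) (fstL p q)).sub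
    ((h.centered_hessNoise_zero N i).1.clm (h.sampling.sigmaOf_le _) (fstL p q))).sub
    (h.centered_jacXYMul i ((h.centered_oracle_sub N).1 i))

lemma memLp_jacXYMul [IsProbabilityMeasure P] (h : OracleRun c ρ B W P X k x y) (i : Fin n)
    {v : Ω → Vec q} (hv : MemLp v 2 P) :
    MemLp (fun ω => jacXYMul (B.g i) (pair (x ω i) (y ω i)) (v ω)) 2 P := by
  have happ : Continuous fun a : (Vec q →L[ℝ] Vec p) × Vec q => a.1 a.2 :=
    isBoundedBilinearMap_apply.continuous
  have hT : Measurable fun ω => fstL p q ∘L hess (B.g i) (pair (x ω i) (y ω i)) ∘L inrL p q := by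
    have hc : Continuous fun T : Pair p q →L[ℝ] Pair p q => fstL p q ∘L T ∘L inrL p q := by
      fun_prop
    exact hc.measurable.comp ((h.smooth.lip_hess_g i).measurable.comp (h.meas_point0 i))
  refine hv.of_le_mul (c := c.Lg1) ?_ (Filter.Eventually.of_forall fun ω =>
    norm_jacXYMul_le (h.smooth.norm_hess_le h.valid i _) _)
  exact happ.comp_aestronglyMeasurable (hT.aestronglyMeasurable.prodMk hv.1)

lemma memL2_stochHypergrad [IsProbabilityMeasure P] (h : OracleRun c ρ B W P X k x y) (N : ℕ) :
    MemL2 P (stochHypergrad B W γ X k x y N) := by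
  intro i
  simp only [stochHypergrad_eq]
  exact (((fstL p q).comp_memLp' (h.memLp_gradient_f i)).sub
    (h.memLp_jacXYMul i ((h.memL2_zds N).1 i))).add
    (((fstL p q).comp_memLp' (h.centered_gradNoise 0 i).1.memLp).sub
      ((fstL p q).comp_memLp' (h.centered_hessNoise_zero N i).1.memLp))

/-- A bound for the second moment of the stochastic hypergradients. -/
def _root_.DSBO.Constants.Cu (c : Constants) (n : ℕ) (A : ℝ) : ℝ :=
  4 * (c.Lg1 ^ 2 + c.sigG2 ^ 2) * (A * (5 * c.tau n)) + 4 * (n * (c.sigF ^ 2 + c.Lf0 ^ 2))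

lemma integral_sqn_stochHypergrad_le [IsProbabilityMeasure P] (h : OracleRun c ρ B W P X k x y)
    {θ A : ℝ} (hθ0 : 0 < θ) (hθ1 : θ < 1) (hA : 0 < A)
    (hT : TrackingBound.{w} c.mu c.Lg1 (2 * c.sigG2) ρ γ θ A) (N : ℕ) :
    ∫ ω, sqn (stochHypergrad B W γ X k x y N ω) ∂P ≤ c.Cu n A := by
  have hz := (h.memL2_zds (γ := γ) N).1
  have hu := h.memL2_stochHypergrad (γ := γ) N
  have hi : ∀ i, ∫ ω, ‖stochHypergrad B W γ X k x y N ω i‖ ^ 2 ∂P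
      ≤ 4 * (c.Lg1 ^ 2 + c.sigG2 ^ 2) * ∫ ω, ‖(oracle B W γ X k x y N ω).z i‖ ^ 2 ∂P
        + 4 * (c.sigF ^ 2 + c.Lf0 ^ 2) := by
    intro i
    obtain ⟨hH, hHle⟩ := h.centered_hessNoise_zero (γ := γ) N i
    obtain ⟨hG, hGle⟩ := h.centered_gradNoise 0 i
    have h1 := integral_le_of_le₃ (a₁ := 4 * c.Lg1 ^ 2) (a₂ := 4) (a₃ := 4) (e := 4 * c.Lf0 ^ 2)
      (integrable_norm_sq (hu i)) (integrable_norm_sq (hz i)) (integrable_norm_sq hH.memLp)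
      (integrable_norm_sq hG.memLp) (fun ω => by
        rw [stochHypergrad_eq]
        refine (norm_add_sq_le_two _ _).trans ?_
        have e1 := norm_sub_sq_le_two (gradX (B.f i) (pair (x ω i) (y ω i)))
          (jacXYMul (B.g i) (pair (x ω i) (y ω i)) ((oracle B W γ X k x y N ω).z i))
        have e2 := norm_sub_sq_le_two (fstBlock (gradNoise B X k x y 0 i ω))
          (fstBlock (hessNoise B X k x y 0 i (fun ω => (oracle B W γ X k x y N ω).z i) ω))
        have e3 := pow_le_pow_left₀ (norm_nonneg _)
          (h.smooth.norm_gradX_f_le h.valid i (pair (x ω i) (y ω i))) 2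
        have e4 := pow_le_pow_left₀ (norm_nonneg _)
          (norm_jacXYMul_le (h.smooth.norm_hess_le h.valid i (pair (x ω i) (y ω i)))
            ((oracle B W γ X k x y N ω).z i)) 2
        have e5 := pow_le_pow_left₀ (norm_nonneg _)
          (norm_fstBlock_le (gradNoise B X k x y 0 i ω)) 2
        have e6 := pow_le_pow_left₀ (norm_nonneg _) (norm_fstBlock_le
          (hessNoise B X k x y 0 i (fun ω => (oracle B W γ X k x y N ω).z i) ω)) 2
        rw [mul_pow] at e4
        linarith)
    linarith
  simp only [sqn]
  rw [integral_finsetSum _ fun i _ => integrable_norm_sq (hu i)]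
  refine (Finset.sum_le_sum fun i _ => hi i).trans ?_
  rw [Finset.sum_add_distrib, ← Finset.mul_sum,
    ← integral_finsetSum _ fun i _ => integrable_norm_sq (hz i)]
  simp only [Finset.sum_const, Finset.card_univ, Fintype.card_fin, nsmul_eq_mul, Constants.Cu]
  have h2 := h.integral_sqn_z_le hθ0 hθ1 hA hT N
  simp only [sqn] at h2
  have h3 : 0 ≤ 4 * (c.Lg1 ^ 2 + c.sigG2 ^ 2) := by positivity
  have := mul_le_mul_of_nonneg_left h2 h3
  linarith

end OracleRun

end Oracle

/-! ### Pointwise estimates for one iteration -/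

section Pointwise

variable {n p q : ℕ} {S : Type*} {R : Type*} [MeasurableSpace S] [MeasurableSpace R]
  {c : Constants} {B : Problem n p q S R}

lemma sqn_sub_const (hn : 0 < n) {d : ℕ} (v : Fin n → Vec d) (w : Vec d) :
    sqn (fun i => v i - w) = n * ‖avg v - w‖ ^ 2 + sqn (dev v) := by
  rw [sqn_eq_avg_add_dev hn, dev_sub_const hn, avg_sub, avg_const hn]

lemma sqn_points_sub (x : Fin n → Vec p) (y : Fin n → Vec q) (a : Vec p) (b : Vec q) :
    sqn (fun i => points x y i - pair a b)
      = sqn (fun i => x i - a) + sqn (fun i => y i - b) := by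
  simp only [sqn, points, pair_sub, norm_sq_pair, Finset.sum_add_distrib]

namespace Smooth

/-- The distance of the local lower-level gradients from the gradients at the averaged point. -/
lemma sqn_gradY_g_sub_avg_le (hs : Smooth c B) (x : Fin n → Vec p) (y : Fin n → Vec q) :
    sqn (fun i => gradY (B.g i) (points x y i) - gradY (B.g i) (pair (avg x) (avg y)))
      ≤ c.Lg1 ^ 2 * (sqn (dev x) + sqn (dev y)) := by
  have h := sqn_points_sub x y (avg x) (avg y)
  refine (sqn_le_mul fun i => hs.norm_gradY_g_sub_le i _ _).trans_eq ?_
  rw [h]; rfl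

/-- The heterogeneity bound controls the consensus error of the lower-level gradients. -/
lemma sqn_dev_gradY_g_le (hs : Smooth c B) (hn : 0 < n) (hh : Heterogeneity c B)
    (x : Fin n → Vec p) (y : Fin n → Vec q) :
    sqn (dev fun i => gradY (B.g i) (points x y i))
      ≤ 2 * c.Lg1 ^ 2 * (sqn (dev x) + sqn (dev y)) + 2 * (n * c.delta ^ 2) := by
  set a : Fin n → Vec q := fun i => gradY (B.g i) (pair (avg x) (avg y)) with ha
  have h1 : sqn (dev a) ≤ n * c.delta ^ 2 :=
    sqn_le_of_norm_le fun i => hh i (avg x) (avg y)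
  have h2 : dev (fun i => gradY (B.g i) (points x y i))
      = fun i => dev (fun i => gradY (B.g i) (points x y i) - a i) i + dev a i := by
    rw [← dev_add]; simp only [sub_add_cancel]
  rw [h2]
  refine (sqn_add_le_two _ _).trans ?_
  have h3 := (sqn_dev_le hn _).trans (hs.sqn_gradY_g_sub_avg_le x y)
  linarith

/-- One noiseless inner step contracts the distance of the average to the lower-level solution, up
to the consensus errors. -/
lemma norm_inner_step_sq_le (hs : Smooth c B) (hc : c.Valid) (hn : 0 < n) {β : ℝ} (hβ : 0 < β)
    (hβL : β * c.Lg1 ^ 2 ≤ c.mu) (hβμ : β * c.mu ≤ 1) (x : Fin n → Vec p) (y : Fin n → Vec q) :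
    ‖avg y - B.yStar (avg x) - β • avg (fun i => gradY (B.g i) (points x y i))‖ ^ 2
      ≤ (1 - β * c.mu / 2) * ‖avg y - B.yStar (avg x)‖ ^ 2
        + 3 * β / c.mu * (c.Lg1 ^ 2 * (sqn (dev x) + sqn (dev y))) := by
  have hμ := hc.mu_pos
  set e := avg y - B.yStar (avg x) with he
  set a := avg fun i => gradY (B.g i) (pair (avg x) (avg y)) with ha
  set w := avg fun i => gradY (B.g i) (points x y i) - gradY (B.g i) (pair (avg x) (avg y)) with hw
  have e1 : e - β • avg (fun i => gradY (B.g i) (points x y i)) = (e - β • a) + (-β) • w := by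
    rw [hw, avg_sub, ← ha, smul_sub, neg_smul, neg_smul]; abel
  have h0 := hs.avg_gradY_yStar hc hn (avg x)
  have hinner : c.mu * ‖e‖ ^ 2 ≤ inner ℝ e a := by
    have := hs.inner_avg_gradY_sub_ge hn (avg x) (avg y) (B.yStar (avg x))
    rwa [h0, sub_zero] at this
  have ha2 : ‖a‖ ≤ c.Lg1 * ‖e‖ := by
    have h1 : a = avg fun i => gradY (B.g i) (pair (avg x) (avg y))
        - gradY (B.g i) (pair (avg x) (B.yStar (avg x))) := by rw [avg_sub, h0, sub_zero]
    rw [h1]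
    refine norm_avg_le_of_le hn fun i => (hs.norm_gradY_g_sub_le i _ _).trans_eq ?_
    rw [pair_sub, sub_self, norm_pair_zero_left]
  have hu2 : ‖e - β • a‖ ^ 2 ≤ (1 - β * c.mu) * ‖e‖ ^ 2 := by
    rw [norm_sub_sq_real, inner_smul_right, norm_smul, mul_pow, Real.norm_eq_abs, sq_abs]
    have h2 : ‖a‖ ^ 2 ≤ (c.Lg1 * ‖e‖) ^ 2 := pow_le_pow_left₀ (norm_nonneg _) ha2 2
    have h3 : β ^ 2 * ‖a‖ ^ 2 ≤ β ^ 2 * (c.Lg1 * ‖e‖) ^ 2 := by gcongr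
    have h4 : β ^ 2 * (c.Lg1 * ‖e‖) ^ 2 = β * (β * c.Lg1 ^ 2) * ‖e‖ ^ 2 := by ring
    have h5 : β * (β * c.Lg1 ^ 2) * ‖e‖ ^ 2 ≤ β * c.mu * ‖e‖ ^ 2 := by gcongr
    have h6 := mul_le_mul_of_nonneg_left hinner hβ.le
    nlinarith
  have hw2 : ‖w‖ ^ 2 ≤ c.Lg1 ^ 2 * (sqn (dev x) + sqn (dev y)) :=
    (norm_avg_sq_le_sqn hn _).trans (hs.sqn_gradY_g_sub_avg_le x y)
  have hy := norm_add_sq_le_young (show 0 < β * c.mu / 2 by positivity) (e - β • a) ((-β) • w)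
  rw [norm_smul, mul_pow, Real.norm_eq_abs, sq_abs, neg_sq] at hy
  have c1 : (1 + β * c.mu / 2) * ‖e - β • a‖ ^ 2 ≤ (1 - β * c.mu / 2) * ‖e‖ ^ 2 := by
    have := mul_le_mul_of_nonneg_left hu2 (show 0 ≤ 1 + β * c.mu / 2 by positivity)
    have h6 : 0 ≤ (β * c.mu) ^ 2 * ‖e‖ ^ 2 := by positivity
    nlinarith
  have c2 : (1 + 1 / (β * c.mu / 2)) * (β ^ 2 * ‖w‖ ^ 2)
      ≤ 3 * β / c.mu * (c.Lg1 ^ 2 * (sqn (dev x) + sqn (dev y))) := by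
    have h7 : (1 + 1 / (β * c.mu / 2)) * (β ^ 2 * ‖w‖ ^ 2)
        = (β * c.mu + 2) * (β / c.mu * ‖w‖ ^ 2) := by
      field_simp
    have h8 : 3 * β / c.mu * ‖w‖ ^ 2 = 3 * (β / c.mu * ‖w‖ ^ 2) := by ring
    have h9 : 0 ≤ β / c.mu * ‖w‖ ^ 2 := by positivity
    rw [h7]
    refine (mul_le_mul_of_nonneg_right (show β * c.mu + 2 ≤ 3 by linarith) h9).trans ?_
    rw [← h8]
    gcongr
  rw [e1]
  exact hy.trans (add_le_add c1 c2)

/-- Effect of the motion of the lower-level solution. -/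
lemma norm_sub_yStar_sq_le (hs : Smooth c B) (hc : c.Valid) (hn : 0 < n) {a : ℝ} (ha : 0 < a)
    (x x' : Vec p) (y : Vec q) :
    ‖y - B.yStar x'‖ ^ 2 ≤ (1 + a) * ‖y - B.yStar x‖ ^ 2
      + (1 + 1 / a) * ((c.Lg1 / c.mu) ^ 2 * ‖x' - x‖ ^ 2) := by
  have h := norm_add_sq_le_young ha (y - B.yStar x) (B.yStar x - B.yStar x')
  rw [sub_add_sub_cancel] at h
  refine h.trans ?_
  have h2 := pow_le_pow_left₀ (norm_nonneg _) (hs.norm_yStar_sub_le hc hn x x') 2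
  rw [mul_pow, norm_sub_rev x x'] at h2
  gcongr

/-- The hypergradient at the points of the agents approximates `∇Φ` at their average. -/
lemma norm_hyperGrad_points_sub_sq_le (hs : Smooth c B) (hc : c.Valid) (hn : 0 < n)
    (x : Fin n → Vec p) (y : Fin n → Vec q) :
    ‖hyperGrad B (points x y) - gradient B.Phi (avg x)‖ ^ 2
      ≤ c.Lh ^ 2 * (sqn (dev x) + sqn (dev y) + n * ‖avg y - B.yStar (avg x)‖ ^ 2) := by
  rw [hs.gradient_Phi hc hn]
  refine (pow_le_pow_left₀ (norm_nonneg _) (hs.norm_hyperGrad_sub_le hc hn _ _) 2).trans ?_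
  rw [mul_pow]
  refine mul_le_mul_of_nonneg_left ((meanDist_sq_le hn _ _).trans_eq ?_) (sq_nonneg _)
  rw [sqn_points_sub, sqn_sub_const hn y]
  change sqn (dev x) + _ = _
  ring

lemma abs_Phi_sub_le (hs : Smooth c B) (hc : c.Valid) (hn : 0 < n) (x x' : Vec p) :
    |B.Phi x - B.Phi x'| ≤ c.GPhi * ‖x - x'‖ := by
  rw [← Real.norm_eq_abs]
  refine convex_univ.norm_image_sub_le_of_norm_hasFDerivWithin_le (𝕜 := ℝ)
    (f' := fun y => InnerProductSpace.toDual ℝ (Vec p) (gradient B.Phi y))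
    (fun y _ => ((hs.differentiable_Phi hc hn y).hasGradientAt.hasFDerivAt).hasFDerivWithinAt)
    (fun y _ => ?_) (Set.mem_univ x') (Set.mem_univ x)
  rw [LinearIsometryEquiv.norm_map]
  exact hs.norm_gradient_Phi_le hc hn y

end Smooth

end Pointwise

/-! ### The main loop in mean square -/

section FunForm

variable {Ω E : Type*} [MeasurableSpace Ω] {P : Measure Ω} [NormedAddCommGroup E] {Y Z : Ω → E}

lemma memLp_fun_add (hY : MemLp Y 2 P) (hZ : MemLp Z 2 P) : MemLp (fun ω => Y ω + Z ω) 2 P :=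
  hY.add hZ

lemma memLp_fun_sub (hY : MemLp Y 2 P) (hZ : MemLp Z 2 P) : MemLp (fun ω => Y ω - Z ω) 2 P :=
  hY.sub hZ

lemma memLp_fun_smul [NormedSpace ℝ E] (hY : MemLp Y 2 P) (a : ℝ) :
    MemLp (fun ω => a • Y ω) 2 P :=
  hY.const_smul a

end FunForm

lemma memLp_comp_of_lip {Ω V H : Type*} [MeasurableSpace Ω] {P : Measure Ω}
    [IsProbabilityMeasure P] [NormedAddCommGroup V] [NormedAddCommGroup H] {L : ℝ} {f : V → H}
    (hf : IsLip L f) {Y : Ω → V} (hY : MemLp Y 2 P) : MemLp (fun ω => f (Y ω)) 2 P := by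
  have h1 : MemLp (fun ω => f (Y ω) - f 0) 2 P := by
    refine hY.of_le_mul (c := L) ?_ (Filter.Eventually.of_forall fun ω => ?_)
    · exact ((hf.lipschitzWith.continuous.comp_aestronglyMeasurable hY.1)).sub
        aestronglyMeasurable_const
    · simpa using hf (Y ω) 0
  simpa using memLp_fun_add h1 (memLp_const (f 0))

/-- The main loop with one inner step per iteration and constant step sizes, on a probability space:
`η` is the noise of the inner gradients, `u` are the hypergradient estimates, `m` their conditional
means, `Cu` bounds the second moments of `u` and of its noise, and `e` bounds the squared error of
the oracle. Only those consequences of independence are recorded that the analysis uses. -/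
structure MainRun {Ω : Type*} [MeasurableSpace Ω] {n p q : ℕ} {S : Type*} {R : Type*}
    [MeasurableSpace S] [MeasurableSpace R] (c : Constants) (ρ : ℝ) (B : Problem n p q S R)
    (W : Matrix (Fin n) (Fin n) ℝ) (P : Measure Ω) (α β Cu e : ℝ)
    (x r u m : ℕ → Ω → Fin n → Vec p) (y η : ℕ → Ω → Fin n → Vec q) : Prop where
  pos : 0 < n
  valid : c.Valid
  smooth : Smooth c B
  network : Network ρ W
  heterogeneity : Heterogeneity c B
  rho_pos : 0 < ρ
  rho_lt_one : ρ < 1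
  alpha_pos : 0 < α
  alpha_le_one : α ≤ 1
  beta_pos : 0 < β
  beta_le : β * c.Lg1 ^ 2 ≤ c.mu
  beta_mul_mu_le : β * c.mu ≤ 1
  x_zero : ∀ ω, x 0 ω = fun _ => 0
  r_zero : ∀ ω, r 0 ω = fun _ => 0
  y_zero : ∀ ω, y 0 ω = fun _ => 0
  step_x : ∀ k ω, x (k + 1) ω = fun i => mix W (x k ω) i - α • r k ω i
  step_r : ∀ k ω, r (k + 1) ω = fun i => (1 - α) • r k ω i + α • u k ω i
  step_y : ∀ k ω, y (k + 1) ω = fun i =>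
    mix W (y k ω) i - β • (gradY (B.g i) (points (x k ω) (y k ω) i) + η k ω i)
  memL2_u : ∀ k, MemL2 P (u k)
  memL2_m : ∀ k, MemL2 P (m k)
  memL2_noise : ∀ k, MemL2 P (η k)
  noise_le : ∀ k, ∫ ω, sqn (η k ω) ∂P ≤ n * c.sigG1 ^ 2
  u_le : ∀ k, ∫ ω, sqn (u k ω) ∂P ≤ Cu
  u_sub_le : ∀ k, ∫ ω, ‖avg (fun i => u k ω i - m k ω i)‖ ^ 2 ∂P ≤ Cu
  bias_le : ∀ k ω, ‖avg (m k ω) - hyperGrad B (points (x k ω) (y (k + 1) ω))‖ ^ 2 ≤ e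
  orthogonal_y : ∀ k, MemLp (fun ω => avg (y k ω) - B.yStar (avg (x k ω))
    - β • avg (fun i => gradY (B.g i) (points (x k ω) (y k ω) i))) 2 P →
    ∫ ω, inner ℝ (avg (y k ω) - B.yStar (avg (x k ω))
    - β • avg (fun i => gradY (B.g i) (points (x k ω) (y k ω) i))) (avg (η k ω)) ∂P = 0
  orthogonal_r : ∀ k, MemLp (fun ω => avg (r k ω)) 2 P →
    ∫ ω, inner ℝ (avg (r k ω)) (avg fun i => u k ω i - m k ω i) ∂P = 0
  orthogonal_h : ∀ k, MemLp (fun ω => (1 - α) • (avg (r k ω) - gradient B.Phi (avg (x k ω)))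
    + (α • (avg (m k ω) - gradient B.Phi (avg (x k ω)))
      + (gradient B.Phi (avg (x k ω)) - gradient B.Phi (avg (x k ω) - α • avg (r k ω))))) 2 P →
    ∫ ω, inner ℝ ((1 - α) • (avg (r k ω) - gradient B.Phi (avg (x k ω)))
    + (α • (avg (m k ω) - gradient B.Phi (avg (x k ω)))
      + (gradient B.Phi (avg (x k ω)) - gradient B.Phi (avg (x k ω) - α • avg (r k ω)))))
    (avg fun i => u k ω i - m k ω i) ∂P = 0

namespace MainRun

variable {Ω : Type*} [MeasurableSpace Ω] {n p q : ℕ} {S : Type*} {R : Type*}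
    [MeasurableSpace S] [MeasurableSpace R] {c : Constants} {ρ : ℝ} {B : Problem n p q S R}
    {W : Matrix (Fin n) (Fin n) ℝ} {P : Measure Ω} {α β Cu e : ℝ}
    {x r u m : ℕ → Ω → Fin n → Vec p} {y η : ℕ → Ω → Fin n → Vec q}

lemma memLp_point {x : Ω → Fin n → Vec p} {y : Ω → Fin n → Vec q} (hx : MemL2 P x)
    (hy : MemL2 P y) (i : Fin n) : MemLp (fun ω => points (x ω) (y ω) i) 2 P := by
  simp only [points, pair_eq]
  exact ((inlL p q).comp_memLp' (hx i)).add ((inrL p q).comp_memLp' (hy i))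

lemma Cu_nonneg (h : MainRun c ρ B W P α β Cu e x r u m y η) : 0 ≤ Cu :=
  (integral_nonneg fun _ => sqn_nonneg _).trans (h.u_le 0)

lemma avg_x_succ (h : MainRun c ρ B W P α β Cu e x r u m y η) (k : ℕ) (ω : Ω) :
    avg (x (k + 1) ω) = avg (x k ω) - α • avg (r k ω) := by
  rw [h.step_x, avg_sub, avg_smul]
  exact congrArg (· - _) (h.network.avg_mix _)

lemma avg_r_succ (h : MainRun c ρ B W P α β Cu e x r u m y η) (k : ℕ) (ω : Ω) :
    avg (r (k + 1) ω) = (1 - α) • avg (r k ω) + α • avg (u k ω) := by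
  rw [h.step_r, avg_add, avg_smul, avg_smul]

lemma avg_y_succ (h : MainRun c ρ B W P α β Cu e x r u m y η) (k : ℕ) (ω : Ω) :
    avg (y (k + 1) ω) = avg (y k ω)
      - β • avg (fun i => gradY (B.g i) (points (x k ω) (y k ω) i)) - β • avg (η k ω) := by
  rw [h.step_y, avg_sub, avg_smul, avg_add, smul_add, ← sub_sub]
  exact congrArg (· - _ - _) (h.network.avg_mix _)

variable [IsProbabilityMeasure P]

lemma _root_.DSBO.Smooth.memL2_gradY_g (hs : Smooth c B) {x : Ω → Fin n → Vec p}
    {y : Ω → Fin n → Vec q} (hx : MemL2 P x) (hy : MemL2 P y) :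
    MemL2 P fun ω i => gradY (B.g i) (points (x ω) (y ω) i) := fun i =>
  memLp_comp_of_lip (f := gradY (B.g i)) (L := c.Lg1) (hs.norm_gradY_g_sub_le i)
    (memLp_point hx hy i)

lemma memL2 (h : MainRun c ρ B W P α β Cu e x r u m y η) (k : ℕ) :
    MemL2 P (x k) ∧ MemL2 P (r k) ∧ MemL2 P (y k) := by
  induction k with
  | zero =>
    refine ⟨fun i => ?_, fun i => ?_, fun i => ?_⟩
    · simp only [h.x_zero]; exact MemLp.zero'
    · simp only [h.r_zero]; exact MemLp.zero'
    · simp only [h.y_zero]; exact MemLp.zero'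
  | succ k ih =>
    obtain ⟨ix, ir, iy⟩ := ih
    refine ⟨fun i => ?_, fun i => ?_, fun i => ?_⟩
    · simp only [h.step_x]; exact (ix.mix W).sub (ir.smul α) i
    · simp only [h.step_r]; exact (ir.smul _).add ((h.memL2_u k).smul α) i
    · simp only [h.step_y]
      exact (iy.mix W).sub (((h.smooth.memL2_gradY_g ix iy).add (h.memL2_noise k)).smul β) i

/-- The moving averages inherit the bound for the estimates. -/
lemma integral_sqn_r_le (h : MainRun c ρ B W P α β Cu e x r u m y η) (k : ℕ) :
    ∫ ω, sqn (r k ω) ∂P ≤ Cu := by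
  have hα := h.alpha_pos
  have hα1 := h.alpha_le_one
  induction k with
  | zero => simpa [h.r_zero, sqn] using h.Cu_nonneg
  | succ k ih =>
    have hconv : ∀ a b : Vec p, ‖(1 - α) • a + α • b‖ ^ 2 ≤ (1 - α) * ‖a‖ ^ 2 + α * ‖b‖ ^ 2 := by
      intro a b
      have e1 : (1 - α) * ‖a‖ ^ 2 + α * ‖b‖ ^ 2 - ‖(1 - α) • a + α • b‖ ^ 2
          = α * (1 - α) * ‖a - b‖ ^ 2 := by
        simp only [norm_add_sq_real, norm_sub_sq_real, norm_smul, inner_smul_left,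
          inner_smul_right, mul_pow, Real.norm_eq_abs, sq_abs, RCLike.conj_to_real]
        ring
      have : 0 ≤ α * (1 - α) * ‖a - b‖ ^ 2 :=
        mul_nonneg (mul_nonneg hα.le (by linarith)) (sq_nonneg _)
      linarith
    have h1 := integral_le_of_le₂ (P := P) (f := fun ω => sqn (r (k + 1) ω)) (a₁ := 1 - α)
      (a₂ := α) (e := 0) (h.memL2 (k + 1)).2.1.integrable_sqn (h.memL2 k).2.1.integrable_sqn
      (h.memL2_u k).integrable_sqn (fun ω => by
        rw [h.step_r]
        simp only [sqn, Finset.mul_sum, ← Finset.sum_add_distrib, add_zero]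
        exact Finset.sum_le_sum fun i _ => hconv _ _)
    have h2 := mul_le_mul_of_nonneg_left ih (show 0 ≤ 1 - α by linarith)
    have h3 := mul_le_mul_of_nonneg_left (h.u_le k) hα.le
    linarith

lemma integral_norm_avg_r_sq_le (h : MainRun c ρ B W P α β Cu e x r u m y η) (k : ℕ) :
    ∫ ω, ‖avg (r k ω)‖ ^ 2 ∂P ≤ Cu :=
  (integral_mono (integrable_norm_sq (h.memL2 k).2.1.avg) (h.memL2 k).2.1.integrable_sqn
    fun _ => norm_avg_sq_le_sqn h.pos _).trans (h.integral_sqn_r_le k)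

/-- The consensus error of `x` is of order `α²`. -/
lemma integral_dev_x_le (h : MainRun c ρ B W P α β Cu e x r u m y η) (k : ℕ) :
    ∫ ω, sqn (dev (x k ω)) ∂P ≤ Cu / (1 - ρ) ^ 2 * α ^ 2 := by
  have hρ : 0 < 1 - ρ := by linarith [h.rho_lt_one]
  have hstep : ∀ k, ∫ ω, sqn (dev (x (k + 1) ω)) ∂P
      ≤ ρ * ∫ ω, sqn (dev (x k ω)) ∂P + 1 / (1 - ρ) * (α ^ 2 * Cu) := by
    intro k
    have h1 := integral_le_of_le₂ (P := P) (f := fun ω => sqn (dev (x (k + 1) ω))) (a₁ := ρ)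
      (a₂ := 1 / (1 - ρ) * α ^ 2) (e := 0) (h.memL2 (k + 1)).1.dev.integrable_sqn
      (h.memL2 k).1.dev.integrable_sqn (h.memL2 k).2.1.integrable_sqn (fun ω => by
        have e1 : x (k + 1) ω = fun i => mix W (x k ω) i + (-α) • r k ω i := by
          rw [h.step_x]; simp only [neg_smul, sub_eq_add_neg]
        rw [e1]
        refine (h.network.sqn_dev_mix_add_le h.pos h.rho_pos h.rho_lt_one _ _).trans ?_
        have h2 := sqn_dev_le h.pos fun i => (-α) • r k ω i
        rw [sqn_smul, neg_sq] at h2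
        have h3 := mul_le_mul_of_nonneg_left h2 (show 0 ≤ 1 / (1 - ρ) by positivity)
        linarith)
    have h2 := mul_le_mul_of_nonneg_left (h.integral_sqn_r_le k)
      (show 0 ≤ 1 / (1 - ρ) * α ^ 2 by positivity)
    linarith
  have hC := h.Cu_nonneg
  refine (geometric_bound (V := fun k => ∫ ω, sqn (dev (x k ω)) ∂P) h.rho_pos.le
    h.rho_lt_one hstep (by positivity) k).trans_eq ?_
  have h0 : ∫ ω, sqn (dev (x 0 ω)) ∂P = 0 := by simp [h.x_zero, sqn, dev, avg]
  simp only [h0]; field_simp; ring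

/-- The factor in the bound for the consensus error of `y`. -/
def _root_.DSBO.Constants.Cy (c : Constants) (n : ℕ) (ρ Cu : ℝ) : ℝ :=
  2 / (1 - ρ) ^ 2 * (4 * c.Lg1 ^ 2 * (Cu / (1 - ρ) ^ 2) + 4 * (n * c.delta ^ 2)
    + 2 * (n * c.sigG1 ^ 2))

/-- The consensus error of `y` is of order `β²`. -/
lemma integral_dev_y_le (h : MainRun c ρ B W P α β Cu e x r u m y η)
    (hβ : β ^ 2 * (8 * c.Lg1 ^ 2) ≤ (1 - ρ) ^ 2) (k : ℕ) :
    ∫ ω, sqn (dev (y k ω)) ∂P ≤ c.Cy n ρ Cu * β ^ 2 := by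
  have hρ : 0 < 1 - ρ := by linarith [h.rho_lt_one]
  have hρ0 := h.rho_pos
  have hC := h.Cu_nonneg
  set D := 4 * c.Lg1 ^ 2 * (Cu / (1 - ρ) ^ 2) + 4 * (n * c.delta ^ 2) + 2 * (n * c.sigG1 ^ 2)
    with hD
  have hD0 : 0 ≤ D := by positivity
  have hstep : ∀ k, ∫ ω, sqn (dev (y (k + 1) ω)) ∂P
      ≤ (1 + ρ) / 2 * ∫ ω, sqn (dev (y k ω)) ∂P + β ^ 2 / (1 - ρ) * D := by
    intro k
    have hb : 0 ≤ β ^ 2 / (1 - ρ) := by positivity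
    have h1 := integral_le_of_le₃ (P := P) (f := fun ω => sqn (dev (y (k + 1) ω)))
      (a₁ := ρ + β ^ 2 / (1 - ρ) * (4 * c.Lg1 ^ 2)) (a₂ := β ^ 2 / (1 - ρ) * (4 * c.Lg1 ^ 2))
      (a₃ := β ^ 2 / (1 - ρ) * 2) (e := β ^ 2 / (1 - ρ) * (4 * (n * c.delta ^ 2)))
      (h.memL2 (k + 1)).2.2.dev.integrable_sqn
      (h.memL2 k).2.2.dev.integrable_sqn (h.memL2 k).1.dev.integrable_sqn
      (h.memL2_noise k).integrable_sqn (fun ω => by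
        have e1 : y (k + 1) ω = fun i => mix W (y k ω) i
            + (-β) • (gradY (B.g i) (points (x k ω) (y k ω) i) + η k ω i) := by
          rw [h.step_y]; simp only [neg_smul, sub_eq_add_neg]
        rw [e1]
        refine (h.network.sqn_dev_mix_add_le h.pos h.rho_pos h.rho_lt_one _ _).trans ?_
        rw [dev_smul, sqn_smul, neg_sq, dev_add]
        have h2 := sqn_add_le_two (dev fun i => gradY (B.g i) (points (x k ω) (y k ω) i))
          (dev (η k ω))
        have h3 := h.smooth.sqn_dev_gradY_g_le h.pos h.heterogeneity (x k ω) (y k ω)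
        have h4 := sqn_dev_le h.pos (η k ω)
        have h5 : sqn (fun i => dev (fun i => gradY (B.g i) (points (x k ω) (y k ω) i)) i
            + dev (η k ω) i) ≤ 4 * c.Lg1 ^ 2 * (sqn (dev (x k ω)) + sqn (dev (y k ω)))
              + 4 * (n * c.delta ^ 2) + 2 * sqn (η k ω) := by linarith
        have h6 := mul_le_mul_of_nonneg_left h5 hb
        have h7 : 1 / (1 - ρ) * (β ^ 2 * sqn (fun i =>
            dev (fun i => gradY (B.g i) (points (x k ω) (y k ω) i)) i + dev (η k ω) i))
            = β ^ 2 / (1 - ρ) * sqn (fun i =>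
            dev (fun i => gradY (B.g i) (points (x k ω) (y k ω) i)) i + dev (η k ω) i) := by ring
        rw [h7]
        linarith)
    have h2 : β ^ 2 / (1 - ρ) * (4 * c.Lg1 ^ 2) ≤ (1 - ρ) / 2 := by
      rw [div_mul_eq_mul_div, div_le_iff₀ hρ]; linarith
    have h3 : 0 ≤ ∫ ω, sqn (dev (y k ω)) ∂P := integral_nonneg fun _ => sqn_nonneg _
    have h4 := mul_le_mul_of_nonneg_right h2 h3
    have h5 : ∫ ω, sqn (dev (x k ω)) ∂P ≤ Cu / (1 - ρ) ^ 2 :=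
      (h.integral_dev_x_le k).trans (mul_le_of_le_one_right (by positivity)
        (pow_le_one₀ h.alpha_pos.le h.alpha_le_one))
    have h6 := mul_le_mul_of_nonneg_left h5
      (show 0 ≤ β ^ 2 / (1 - ρ) * (4 * c.Lg1 ^ 2) by positivity)
    have h7 := mul_le_mul_of_nonneg_left (h.noise_le k) (show 0 ≤ β ^ 2 / (1 - ρ) * 2 by positivity)
    rw [hD]
    linarith
  have h0 : ∫ ω, sqn (dev (y 0 ω)) ∂P = 0 := by simp [h.y_zero, sqn, dev, avg]
  refine (geometric_bound (V := fun k => ∫ ω, sqn (dev (y k ω)) ∂P) (by linarith)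
    (by linarith [h.rho_lt_one]) hstep (by positivity) k).trans_eq ?_
  simp only [h0, Constants.Cy, ← hD]
  have : 1 - (1 + ρ) / 2 = (1 - ρ) / 2 := by ring
  rw [this]; field_simp; ring

lemma memLp_yStar_avg (h : MainRun c ρ B W P α β Cu e x r u m y η) (k : ℕ) :
    MemLp (fun ω => B.yStar (avg (x k ω))) 2 P :=
  memLp_comp_of_lip (L := c.Lg1 / c.mu) (h.smooth.norm_yStar_sub_le h.valid h.pos)
    (h.memL2 k).1.avg

lemma memLp_gradient_Phi (h : MainRun c ρ B W P α β Cu e x r u m y η) (k : ℕ) :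
    MemLp (fun ω => gradient B.Phi (avg (x k ω))) 2 P :=
  memLp_comp_of_lip (h.smooth.isLip_gradient_Phi h.valid h.pos) (h.memL2 k).1.avg

/-- The inner step contracts the error of the averaged lower-level iterate. -/
lemma integral_inner_step_le (h : MainRun c ρ B W P α β Cu e x r u m y η) (k : ℕ) :
    ∫ ω, ‖avg (y (k + 1) ω) - B.yStar (avg (x k ω))‖ ^ 2 ∂P
      ≤ (1 - β * c.mu / 2) * ∫ ω, ‖avg (y k ω) - B.yStar (avg (x k ω))‖ ^ 2 ∂P
        + 3 * β / c.mu * c.Lg1 ^ 2 * (∫ ω, sqn (dev (x k ω)) ∂P + ∫ ω, sqn (dev (y k ω)) ∂P)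
        + β ^ 2 * (n * c.sigG1 ^ 2) := by
  obtain ⟨ix, -, iy⟩ := h.memL2 k
  have hv := h.smooth.memL2_gradY_g ix iy
  have hY := h.memLp_yStar_avg k
  have hA : MemLp (fun ω => avg (y k ω) - B.yStar (avg (x k ω))
      - β • avg (fun i => gradY (B.g i) (points (x k ω) (y k ω) i))) 2 P :=
    memLp_fun_sub (memLp_fun_sub iy.avg hY) (memLp_fun_smul hv.avg β)
  have hη := (h.memL2_noise k).avg
  have e1 : ∀ ω, avg (y (k + 1) ω) - B.yStar (avg (x k ω))
      = (avg (y k ω) - B.yStar (avg (x k ω))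
        - β • avg (fun i => gradY (B.g i) (points (x k ω) (y k ω) i))) + (-β) • avg (η k ω) := by
    intro ω
    rw [h.avg_y_succ, neg_smul]; abel
  simp only [e1]
  rw [integral_norm_add_sq_of_orthogonal hA (memLp_fun_smul hη (-β)) (by
    simp only [inner_smul_right, integral_const_mul, h.orthogonal_y k hA, mul_zero])]
  have h1 := integral_le_of_le₃ (integrable_norm_sq hA) (integrable_norm_sq (memLp_fun_sub iy.avg hY))
    ix.dev.integrable_sqn iy.dev.integrable_sqn (a₁ := 1 - β * c.mu / 2)
    (a₂ := 3 * β / c.mu * c.Lg1 ^ 2) (a₃ := 3 * β / c.mu * c.Lg1 ^ 2) (e := 0) (fun ω => by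
      have := h.smooth.norm_inner_step_sq_le h.valid h.pos h.beta_pos h.beta_le h.beta_mul_mu_le
        (x k ω) (y k ω)
      linarith)
  have h2 : ∫ ω, ‖(-β) • avg (η k ω)‖ ^ 2 ∂P ≤ β ^ 2 * (n * c.sigG1 ^ 2) := by
    simp only [norm_smul, mul_pow, Real.norm_eq_abs, sq_abs, neg_sq, integral_const_mul]
    refine mul_le_mul_of_nonneg_left ?_ (sq_nonneg _)
    exact (integral_mono (integrable_norm_sq hη) (h.memL2_noise k).integrable_sqn
      fun _ => norm_avg_sq_le_sqn h.pos _).trans (h.noise_le k)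
  linarith

/-- The motion of the lower-level solution, with the parameter of Young's inequality adapted to the
contraction of the inner step. -/
lemma integral_shift_le (h : MainRun c ρ B W P α β Cu e x r u m y η) (k : ℕ) :
    ∫ ω, ‖avg (y (k + 1) ω) - B.yStar (avg (x (k + 1) ω))‖ ^ 2 ∂P
      ≤ (1 + β * c.mu / 4) * ∫ ω, ‖avg (y (k + 1) ω) - B.yStar (avg (x k ω))‖ ^ 2 ∂P
        + 5 / (β * c.mu) * ((c.Lg1 / c.mu) ^ 2 * α ^ 2) * ∫ ω, ‖avg (r k ω)‖ ^ 2 ∂P := by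
  have hμ := h.valid.mu_pos
  have hβ := h.beta_pos
  have iy := (h.memL2 (k + 1)).2.2
  have h1 := integral_le_of_le₂
    (integrable_norm_sq (memLp_fun_sub iy.avg (h.memLp_yStar_avg (k + 1))))
    (integrable_norm_sq (memLp_fun_sub iy.avg (h.memLp_yStar_avg k)))
    (integrable_norm_sq (h.memL2 k).2.1.avg) (a₁ := 1 + β * c.mu / 4)
    (a₂ := 5 / (β * c.mu) * ((c.Lg1 / c.mu) ^ 2 * α ^ 2)) (e := 0) (fun ω => by
      have h2 := h.smooth.norm_sub_yStar_sq_le h.valid h.pos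
        (show 0 < β * c.mu / 4 by positivity) (avg (x k ω)) (avg (x (k + 1) ω)) (avg (y (k + 1) ω))
      have h3 : ‖avg (x (k + 1) ω) - avg (x k ω)‖ ^ 2 = α ^ 2 * ‖avg (r k ω)‖ ^ 2 := by
        rw [h.avg_x_succ, sub_sub_cancel_left, norm_neg, norm_smul, mul_pow, Real.norm_eq_abs,
          sq_abs]
      rw [h3] at h2
      have h4 : 1 + 1 / (β * c.mu / 4) ≤ 5 / (β * c.mu) := by
        have e1 : 5 / (β * c.mu) - (1 + 1 / (β * c.mu / 4)) = (1 - β * c.mu) / (β * c.mu) := by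
          field_simp; ring
        have : 0 ≤ (1 - β * c.mu) / (β * c.mu) :=
          div_nonneg (by linarith [h.beta_mul_mu_le]) (by positivity)
        linarith
      have h5 := mul_le_mul_of_nonneg_right h4
        (show 0 ≤ (c.Lg1 / c.mu) ^ 2 * (α ^ 2 * ‖avg (r k ω)‖ ^ 2) by positivity)
      linarith)
  linarith

/-- The bias of the hypergradient estimates. -/
lemma integral_bias_le (h : MainRun c ρ B W P α β Cu e x r u m y η) (k : ℕ) :
    ∫ ω, ‖avg (m k ω) - gradient B.Phi (avg (x k ω))‖ ^ 2 ∂P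
      ≤ 2 * e + 2 * c.Lh ^ 2 * (∫ ω, sqn (dev (x k ω)) ∂P + ∫ ω, sqn (dev (y (k + 1) ω)) ∂P
        + n * ∫ ω, ‖avg (y (k + 1) ω) - B.yStar (avg (x k ω))‖ ^ 2 ∂P) := by
  have iy := (h.memL2 (k + 1)).2.2
  have h1 := integral_le_of_le₃
    (integrable_norm_sq (memLp_fun_sub (h.memL2_m k).avg (h.memLp_gradient_Phi k)))
    (h.memL2 k).1.dev.integrable_sqn iy.dev.integrable_sqn
    (integrable_norm_sq (memLp_fun_sub iy.avg (h.memLp_yStar_avg k)))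
    (a₁ := 2 * c.Lh ^ 2) (a₂ := 2 * c.Lh ^ 2) (a₃ := 2 * c.Lh ^ 2 * n) (e := 2 * e) (fun ω => by
      have h2 := norm_add_sq_le_two
        (avg (m k ω) - hyperGrad B (points (x k ω) (y (k + 1) ω)))
        (hyperGrad B (points (x k ω) (y (k + 1) ω)) - gradient B.Phi (avg (x k ω)))
      rw [sub_add_sub_cancel] at h2
      have h3 := h.bias_le k ω
      have h4 := h.smooth.norm_hyperGrad_points_sub_sq_le h.valid h.pos (x k ω) (y (k + 1) ω)
      linarith)
  linarith

lemma integrable_Phi (h : MainRun c ρ B W P α β Cu e x r u m y η) (k : ℕ) :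
    Integrable (fun ω => B.Phi (avg (x k ω))) P := by
  refine (memLp_comp_of_lip (L := c.GPhi) (f := B.Phi) (fun z z' => ?_)
    (h.memL2 k).1.avg).integrable one_le_two
  exact h.smooth.abs_Phi_sub_le h.valid h.pos z z'

/-- Descent of the potential `Φ(x̄) + ‖r̄‖² / 2`. -/
lemma potential_descent (h : MainRun c ρ B W P α β Cu e x r u m y η) (k : ℕ) :
    ∫ ω, B.Phi (avg (x (k + 1) ω)) ∂P + 1 / 2 * ∫ ω, ‖avg (r (k + 1) ω)‖ ^ 2 ∂P
      ≤ ∫ ω, B.Phi (avg (x k ω)) ∂P + 1 / 2 * ∫ ω, ‖avg (r k ω)‖ ^ 2 ∂P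
        - α / 2 * ∫ ω, ‖avg (r k ω)‖ ^ 2 ∂P
        + α / 2 * ∫ ω, ‖avg (m k ω) - gradient B.Phi (avg (x k ω))‖ ^ 2 ∂P
        + α ^ 2 * ((c.LPhi + 2) * Cu) := by
  have hα := h.alpha_pos
  have hL := h.valid.LPhi_pos
  obtain ⟨ix, ir, -⟩ := h.memL2 k
  have ir' := (h.memL2 (k + 1)).2.1
  have hu := (h.memL2_u k).avg
  have hb := memLp_fun_sub (h.memL2_m k).avg (h.memLp_gradient_Phi k)
  have hq := integrable_inner ir.avg ((h.memL2_u k).sub (h.memL2_m k)).avg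
  have iP := h.integrable_Phi k
  have iR := integrable_norm_sq ir.avg
  have iU := integrable_norm_sq hu
  have iB := integrable_norm_sq hb
  have hpt : ∀ ω, B.Phi (avg (x (k + 1) ω)) + 1 / 2 * ‖avg (r (k + 1) ω)‖ ^ 2
      - B.Phi (avg (x k ω)) - α * inner ℝ (avg (r k ω)) (avg fun i => u k ω i - m k ω i)
      ≤ (1 / 2 - α / 2 + α ^ 2 * (c.LPhi + 1)) * ‖avg (r k ω)‖ ^ 2
        + α / 2 * ‖avg (m k ω) - gradient B.Phi (avg (x k ω))‖ ^ 2
        + α ^ 2 * ‖avg (u k ω)‖ ^ 2 + 0 := by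
    intro ω
    set a := avg (r k ω)
    set g := gradient B.Phi (avg (x k ω))
    have h1 := h.smooth.Phi_le h.valid h.pos (avg (x k ω)) (avg (x (k + 1) ω))
    rw [h.avg_x_succ, sub_sub_cancel_left, inner_neg_right, inner_smul_right, norm_neg, norm_smul,
      mul_pow, Real.norm_eq_abs, sq_abs, ← h.avg_x_succ] at h1
    have e1 : avg (r (k + 1) ω) = a + α • (avg (u k ω) - a) := by
      rw [h.avg_r_succ, sub_smul, one_smul, smul_sub]; abel
    have h2 : ‖avg (r (k + 1) ω)‖ ^ 2
        = ‖a‖ ^ 2 + 2 * α * (inner ℝ a (avg (u k ω)) - ‖a‖ ^ 2)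
          + α ^ 2 * ‖avg (u k ω) - a‖ ^ 2 := by
      rw [e1, norm_add_sq_real, inner_smul_right, inner_sub_right, real_inner_self_eq_norm_sq,
        norm_smul, mul_pow, Real.norm_eq_abs, sq_abs]
      ring
    have h3 := mul_le_mul_of_nonneg_left (norm_sub_sq_le_two (avg (u k ω)) a) (sq_nonneg α)
    have h4 : inner ℝ a (avg fun i => u k ω i - m k ω i)
        = inner ℝ a (avg (u k ω)) - inner ℝ a (avg (m k ω)) := by
      rw [avg_sub, inner_sub_right]
    have h5 : inner ℝ a (avg (m k ω)) - inner ℝ g a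
        ≤ 1 / 2 * ‖a‖ ^ 2 + 1 / 2 * ‖avg (m k ω) - g‖ ^ 2 := by
      rw [real_inner_comm a g, ← inner_sub_right]
      have := real_inner_le_norm a (avg (m k ω) - g)
      nlinarith [sq_nonneg (‖a‖ - ‖avg (m k ω) - g‖)]
    have h6 := mul_le_mul_of_nonneg_left h5 hα.le
    rw [h4]
    nlinarith
  have i1 : Integrable (fun ω => B.Phi (avg (x (k + 1) ω)) + 1 / 2 * ‖avg (r (k + 1) ω)‖ ^ 2) P :=
    (h.integrable_Phi (k + 1)).add ((integrable_norm_sq ir'.avg).const_mul _)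
  have i2 : Integrable (fun ω => B.Phi (avg (x (k + 1) ω)) + 1 / 2 * ‖avg (r (k + 1) ω)‖ ^ 2
      - B.Phi (avg (x k ω))) P := i1.sub iP
  have i3 : Integrable (fun ω => B.Phi (avg (x (k + 1) ω)) + 1 / 2 * ‖avg (r (k + 1) ω)‖ ^ 2
      - B.Phi (avg (x k ω)) - α * inner ℝ (avg (r k ω)) (avg fun i => u k ω i - m k ω i)) P :=
    i2.sub (hq.const_mul α)
  have h1 := integral_le_of_le₃ i3 iR iB iU hpt
  rw [integral_sub i2 (hq.const_mul α), integral_sub i1 iP,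
    integral_add (h.integrable_Phi (k + 1)) ((integrable_norm_sq ir'.avg).const_mul _),
    integral_const_mul, integral_const_mul, h.orthogonal_r k ir.avg] at h1
  have h2 : ∫ ω, ‖avg (u k ω)‖ ^ 2 ∂P ≤ Cu :=
    (integral_mono iU (h.memL2_u k).integrable_sqn
      fun _ => norm_avg_sq_le_sqn h.pos _).trans (h.u_le k)
  have h3 := mul_le_mul_of_nonneg_left h2 (sq_nonneg α)
  have h4 := mul_le_mul_of_nonneg_left (h.integral_norm_avg_r_sq_le k)
    (show 0 ≤ α ^ 2 * (c.LPhi + 1) by positivity)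
  linarith

/-- The error of the moving average as an estimate of `∇Φ(x̄)`. -/
lemma integral_momentum_error_le (h : MainRun c ρ B W P α β Cu e x r u m y η) (k : ℕ) :
    ∫ ω, ‖avg (r (k + 1) ω) - gradient B.Phi (avg (x (k + 1) ω))‖ ^ 2 ∂P
      ≤ (1 - α) * ∫ ω, ‖avg (r k ω) - gradient B.Phi (avg (x k ω))‖ ^ 2 ∂P
        + 2 * α * ∫ ω, ‖avg (m k ω) - gradient B.Phi (avg (x k ω))‖ ^ 2 ∂P
        + 2 * α * c.LPhi ^ 2 * ∫ ω, ‖avg (r k ω)‖ ^ 2 ∂P + α ^ 2 * Cu := by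
  have hα := h.alpha_pos
  have hα1 := h.alpha_le_one
  obtain ⟨ix, ir, -⟩ := h.memL2 k
  have hg := h.memLp_gradient_Phi k
  have hg' := h.memLp_gradient_Phi (k + 1)
  have hb := memLp_fun_sub (h.memL2_m k).avg hg
  have hh := memLp_fun_sub ir.avg hg
  have hw := ((h.memL2_u k).sub (h.memL2_m k)).avg
  simp only [h.avg_x_succ] at hg'
  have hA := memLp_fun_add (memLp_fun_smul hh (1 - α))
    (memLp_fun_add (memLp_fun_smul hb α) (memLp_fun_sub hg hg'))
  have e1 : ∀ ω, avg (r (k + 1) ω) - gradient B.Phi (avg (x (k + 1) ω))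
      = ((1 - α) • (avg (r k ω) - gradient B.Phi (avg (x k ω)))
        + (α • (avg (m k ω) - gradient B.Phi (avg (x k ω)))
          + (gradient B.Phi (avg (x k ω)) - gradient B.Phi (avg (x k ω) - α • avg (r k ω)))))
        + α • (avg fun i => u k ω i - m k ω i) := by
    intro ω
    rw [h.avg_r_succ, h.avg_x_succ, avg_sub]
    module
  have h1 : ∫ ω, ‖avg (r (k + 1) ω) - gradient B.Phi (avg (x (k + 1) ω))‖ ^ 2 ∂P = _ :=
    (integral_congr_ae (Filter.Eventually.of_forall fun ω => by
      simp only [e1])).trans (integral_norm_add_sq_of_orthogonal hA (memLp_fun_smul hw α) (by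
      simp only [inner_smul_right, integral_const_mul]
      exact (mul_eq_zero_of_right _ (h.orthogonal_h k hA))))
  rw [h1]
  have h2 : ∫ ω, ‖α • (avg fun i => u k ω i - m k ω i)‖ ^ 2 ∂P ≤ α ^ 2 * Cu := by
    simp only [norm_smul, mul_pow, Real.norm_eq_abs, sq_abs, integral_const_mul]
    exact mul_le_mul_of_nonneg_left (h.u_sub_le k) (sq_nonneg _)
  have h3 := integral_le_of_le₃ (integrable_norm_sq hA) (integrable_norm_sq hh)
    (integrable_norm_sq hb) (integrable_norm_sq ir.avg) (a₁ := 1 - α) (a₂ := 2 * α)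
    (a₃ := 2 * α * c.LPhi ^ 2) (e := 0) (fun ω => by
      set a := avg (r k ω) - gradient B.Phi (avg (x k ω))
      set b := avg (m k ω) - gradient B.Phi (avg (x k ω))
      set d := gradient B.Phi (avg (x k ω)) - gradient B.Phi (avg (x k ω) - α • avg (r k ω))
      have hd : ‖d‖ ≤ α * (c.LPhi * ‖avg (r k ω)‖) := by
        refine (h.smooth.isLip_gradient_Phi h.valid h.pos _ _).trans_eq ?_
        rw [sub_sub_cancel, norm_smul, Real.norm_eq_abs, abs_of_pos hα]; ring
      have hn0 : ‖(1 - α) • a + (α • b + d)‖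
          ≤ (1 - α) * ‖a‖ + α * (‖b‖ + c.LPhi * ‖avg (r k ω)‖) := by
        refine (norm_add_le _ _).trans ?_
        have := norm_add_le (α • b) d
        rw [norm_smul, Real.norm_eq_abs, abs_of_pos hα] at this
        rw [norm_smul, Real.norm_eq_abs, abs_of_nonneg (by linarith : 0 ≤ 1 - α)]
        linarith
      have hsq := pow_le_pow_left₀ (norm_nonneg _) hn0 2
      change ‖(1 - α) • a + (α • b + d)‖ ^ 2 ≤ _
      refine hsq.trans ?_
      set A := ‖a‖
      set C := ‖b‖
      set E := c.LPhi * ‖avg (r k ω)‖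
      have hE : c.LPhi ^ 2 * ‖avg (r k ω)‖ ^ 2 = E ^ 2 := (mul_pow _ _ _).symm
      have h5 : ((1 - α) * A + α * (C + E)) ^ 2 + α * (1 - α) * (A - (C + E)) ^ 2
          = (1 - α) * A ^ 2 + α * (C + E) ^ 2 := by ring
      have h6 : 0 ≤ α * (1 - α) * (A - (C + E)) ^ 2 :=
        mul_nonneg (mul_nonneg hα.le (by linarith)) (sq_nonneg _)
      have h7 : α * (C + E) ^ 2 ≤ α * (2 * C ^ 2 + 2 * E ^ 2) :=
        mul_le_mul_of_nonneg_left (by nlinarith [sq_nonneg (C - E)]) hα.le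
      have h8 : 2 * α * c.LPhi ^ 2 * ‖avg (r k ω)‖ ^ 2 = 2 * α * E ^ 2 := by rw [← hE]; ring
      rw [h8]
      linarith)
  exact (add_le_add h3 h2).trans_eq (by ring)

end MainRun

/-! ### Summation over the iterations -/

/-- The coupled recursions of the analysis: `H` and `E` are the lower-level errors after the inner
step and after the motion of the solution, `Bi` is the bias, `Ψ` the potential, `M` the error of the
moving average and `Rb` its squared norm. The feedback of `Rb` through `H` into the bias is
absorbed by the descent of the potential. -/
lemma sum_le_of_recursions {Rb Bi H E Ψ M : ℕ → ℝ} {α b κ d s C D L2 U gap : ℝ} (K : ℕ)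
    (hα : 0 < α) (hb : 0 < b) (hb1 : b ≤ 1) (hκ : 0 ≤ κ) (hC : 0 ≤ C)
    (hL2 : 0 ≤ L2) (hs : 0 ≤ s) (hd : 0 ≤ d)
    (hRb : ∀ k, 0 ≤ Rb k) (hH0 : ∀ k, 0 ≤ H k) (hE0 : ∀ k, 0 ≤ E k) (hM0 : ∀ k, 0 ≤ M k)
    (hH : ∀ k, H k ≤ (1 - b) * E k + d) (hE : ∀ k, E (k + 1) ≤ (1 + b / 2) * H k + κ * Rb k)
    (hBi : ∀ k, Bi k ≤ s + C * H k)
    (hΨ : ∀ k, Ψ (k + 1) ≤ Ψ k - α / 2 * Rb k + α / 2 * Bi k + α ^ 2 * D)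
    (hM : ∀ k, M (k + 1) ≤ (1 - α) * M k + 2 * α * Bi k + 2 * α * L2 * Rb k + α ^ 2 * U)
    (hgap : Ψ 0 - gap ≤ Ψ K) (hsmall : C * (2 * κ / b) ≤ 1 / 2) :
    ∑ k ∈ Finset.range K, (2 * M k + 2 * Rb k)
      ≤ 2 * (M 0 / α) + 2 * (K * (α * U)) + (16 + 16 * L2)
        * (K * s + 2 * C / b * (E 0 + (K + 1) * d) + gap / α + K * (α * D)) := by
  have sumH : ∀ K : ℕ, H K + b / 2 * ∑ k ∈ Finset.range K, H k
      ≤ H 0 + κ * ∑ k ∈ Finset.range K, Rb k + K * d := by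
    intro K
    induction K with
    | zero => simp
    | succ K ih =>
      have h1 := mul_le_mul_of_nonneg_left (hE K) (show 0 ≤ 1 - b by linarith)
      have h2 := hH (K + 1)
      have h3 : 0 ≤ b ^ 2 / 2 * H K := mul_nonneg (by positivity) (hH0 K)
      have h4 : 0 ≤ b * (κ * Rb K) := mul_nonneg hb.le (mul_nonneg hκ (hRb K))
      rw [Finset.sum_range_succ, Finset.sum_range_succ]
      push_cast
      linarith
  have sumΨ : ∀ K : ℕ, Ψ K + α / 2 * ∑ k ∈ Finset.range K, Rb k
      ≤ Ψ 0 + α / 2 * ∑ k ∈ Finset.range K, Bi k + K * (α ^ 2 * D) := by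
    intro K
    induction K with
    | zero => simp
    | succ K ih =>
      have := hΨ K
      rw [Finset.sum_range_succ, Finset.sum_range_succ]
      push_cast
      linarith
  have sumM : ∀ K : ℕ, M K + α * ∑ k ∈ Finset.range K, M k
      ≤ M 0 + 2 * α * ∑ k ∈ Finset.range K, Bi k + 2 * α * L2 * ∑ k ∈ Finset.range K, Rb k
        + K * (α ^ 2 * U) := by
    intro K
    induction K with
    | zero => simp
    | succ K ih =>
      have := hM K
      rw [Finset.sum_range_succ, Finset.sum_range_succ, Finset.sum_range_succ]
      push_cast
      linarith
  have sumB : ∑ k ∈ Finset.range K, Bi k ≤ K * s + C * ∑ k ∈ Finset.range K, H k := by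
    refine (Finset.sum_le_sum fun k _ => hBi k).trans_eq ?_
    rw [Finset.sum_add_distrib, ← Finset.mul_sum]; simp
  have h1 := sumH K
  have h2 := sumΨ K
  have h3 := sumM K
  have hR : 0 ≤ ∑ k ∈ Finset.range K, Rb k := Finset.sum_nonneg fun k _ => hRb k
  rw [Finset.sum_add_distrib, ← Finset.mul_sum, ← Finset.mul_sum]
  set SR := ∑ k ∈ Finset.range K, Rb k
  set SB := ∑ k ∈ Finset.range K, Bi k
  set SM := ∑ k ∈ Finset.range K, M k
  set SH := ∑ k ∈ Finset.range K, H k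
  set Q := K * s + 2 * C / b * (E 0 + (K + 1) * d) with hQ
  have hH1 : H 0 ≤ E 0 + d := by
    have := hH 0
    have := mul_nonneg hb.le (hE0 0)
    linarith
  have hSH : SH ≤ 2 / b * (E 0 + (K + 1) * d + κ * SR) := by
    rw [div_mul_eq_mul_div, le_div_iff₀ hb]
    have := hH0 K
    linarith
  have hSB : SB ≤ Q + 1 / 2 * SR := by
    have e1 := mul_le_mul_of_nonneg_left hSH hC
    have e2 := mul_le_mul_of_nonneg_right hsmall hR
    have e3 : C * (2 / b * (E 0 + (K + 1) * d + κ * SR))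
        = 2 * C / b * (E 0 + (K + 1) * d) + C * (2 * κ / b) * SR := by ring
    rw [e3] at e1
    linarith
  set V := Q + gap / α + K * (α * D) with hV
  have hSR' : SR ≤ 2 * Q + 4 * (gap / α) + 4 * (K * (α * D)) := by
    have e1 : α * SR ≤ α * (2 * (gap / α) + SB + 2 * (K * (α * D))) := by
      have e2 : α * (2 * (gap / α) + SB + 2 * (K * (α * D)))
          = 2 * gap + α * SB + 2 * (K * (α ^ 2 * D)) := by field_simp
      rw [e2]; linarith
    have := le_of_mul_le_mul_left e1 hα
    linarith
  have hSR : SR ≤ 4 * V := by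
    have hQ0 : 0 ≤ Q := by
      have := hE0 0
      positivity
    linarith
  have hSM : SM ≤ M 0 / α + 2 * SB + 2 * L2 * SR + K * (α * U) := by
    have e1 : α * SM ≤ α * (M 0 / α + 2 * SB + 2 * L2 * SR + K * (α * U)) := by
      have e2 : α * (M 0 / α + 2 * SB + 2 * L2 * SR + K * (α * U))
          = M 0 + 2 * α * SB + 2 * α * L2 * SR + K * (α ^ 2 * U) := by field_simp
      rw [e2]
      have := hM0 K
      linarith
    exact le_of_mul_le_mul_left e1 hα
  have hL := mul_le_mul_of_nonneg_left hSR hL2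
  linarith

/-! ### The rate of the main loop -/

/-- The coefficient of the lower-level error in the bias. -/
def Constants.cBias (c : Constants) (n : ℕ) : ℝ := 2 * c.Lh ^ 2 * n

/-- A bound for the ratio `α / β` for which the feedback of the upper level on the lower level is
absorbed. -/
def Constants.ratio (c : Constants) (n : ℕ) : ℝ :=
  c.mu ^ 2 / (c.mu ^ 2 + 9 * (n * c.Lh * c.Lg1))

/-- The sum of the factors in the bounds for the two consensus errors. -/
def Constants.cCons (c : Constants) (n : ℕ) (ρ Cu : ℝ) : ℝ := Cu / (1 - ρ) ^ 2 + c.Cy n ρ Cu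

/-- The factor of `β²` in the additive error of the inner step. -/
def Constants.cInner (c : Constants) (n : ℕ) (ρ Cu : ℝ) : ℝ :=
  3 / c.mu * c.Lg1 ^ 2 * c.cCons n ρ Cu + n * c.sigG1 ^ 2

/-- The constant of the initial errors in the rate. -/
def Constants.rateInit (c : Constants) (n : ℕ) : ℝ :=
  2 * c.GPhi ^ 2 + (16 + 16 * c.LPhi ^ 2) * (4 * c.cBias n / c.mu * c.y0 ^ 2 + c.gap)

/-- The constant of the noise in the rate. -/
def Constants.rateNoise (c : Constants) (n : ℕ) (ρ Cu : ℝ) : ℝ :=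
  2 * Cu + (16 + 16 * c.LPhi ^ 2) * (2 * c.Lh ^ 2 * c.cCons n ρ Cu
    + 8 * c.cBias n / c.mu * c.cInner n ρ Cu + (c.LPhi + 2) * Cu)

lemma Constants.Valid.ratio_pos {c : Constants} (hc : c.Valid) (n : ℕ) : 0 < c.ratio n := by
  have := hc.mu_pos; have := hc.Lh_pos; have := hc.Lg1_pos
  unfold Constants.ratio; positivity

lemma Constants.Valid.ratio_le_one {c : Constants} (hc : c.Valid) (n : ℕ) : c.ratio n ≤ 1 := by
  have := hc.mu_pos; have := hc.Lh_pos; have := hc.Lg1_pos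
  unfold Constants.ratio
  rw [div_le_one (by positivity)]
  have : 0 ≤ 9 * (n * c.Lh * c.Lg1) := by positivity
  linarith

/-- The feedback of the upper level on the lower level is small. -/
lemma Constants.Valid.feedback_le {c : Constants} (hc : c.Valid) {n : ℕ} (hn : 0 < n) {α β : ℝ}
    (hα : 0 < α) (hβ : 0 < β) (h : α ≤ c.ratio n * β) :
    c.cBias n * (2 * (5 / (β * c.mu) * ((c.Lg1 / c.mu) ^ 2 * α ^ 2)) / (β * c.mu / 2)) ≤ 1 / 2 := by
  have hμ := hc.mu_pos; have hLh := hc.Lh_pos; have hLg := hc.Lg1_pos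
  have hn' : (1 : ℝ) ≤ n := by exact_mod_cast hn
  have h1 : α * (9 * (n * c.Lh * c.Lg1)) ≤ c.mu ^ 2 * β := by
    have h2 := mul_le_mul_of_nonneg_right h
      (show 0 ≤ c.mu ^ 2 + 9 * (n * c.Lh * c.Lg1) by positivity)
    have h3 : c.ratio n * β * (c.mu ^ 2 + 9 * (n * c.Lh * c.Lg1)) = c.mu ^ 2 * β := by
      unfold Constants.ratio; field_simp
    have h4 : 0 ≤ α * c.mu ^ 2 := by positivity
    linarith
  have h2 := pow_le_pow_left₀ (by positivity) h1 2
  have e1 : c.cBias n * (2 * (5 / (β * c.mu) * ((c.Lg1 / c.mu) ^ 2 * α ^ 2)) / (β * c.mu / 2))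
      = 40 * n * c.Lh ^ 2 * c.Lg1 ^ 2 * α ^ 2 / (c.mu ^ 2 * β) ^ 2 := by
    unfold Constants.cBias; field_simp; norm_num
  rw [e1, div_le_iff₀ (by positivity)]
  have h3 : 0 ≤ c.Lh ^ 2 * c.Lg1 ^ 2 * α ^ 2 * n := by positivity
  nlinarith

namespace MainRun

variable {Ω : Type*} [MeasurableSpace Ω] {n p q : ℕ} {S : Type*} {R : Type*}
    [MeasurableSpace S] [MeasurableSpace R] {c : Constants} {ρ : ℝ} {B : Problem n p q S R}
    {W : Matrix (Fin n) (Fin n) ℝ} {P : Measure Ω} [IsProbabilityMeasure P] {α β Cu e : ℝ}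
    {x r u m : ℕ → Ω → Fin n → Vec p} {y η : ℕ → Ω → Fin n → Vec q}

/-- The rate of the main loop, for the sum of the squared gradient norms. -/
theorem sum_norm_gradient_le (h : MainRun c ρ B W P α β Cu e x r u m y η)
    (hβ : β ^ 2 * (8 * c.Lg1 ^ 2) ≤ (1 - ρ) ^ 2) (hβ1 : β ≤ 1) (hr : α ≤ c.ratio n * β)
    (hbd : ∀ x, B.Phi 0 - c.gap ≤ B.Phi x) (hy0 : ‖B.yStar 0‖ ≤ c.y0) {K : ℕ} (hK : 0 < K) :
    ∑ k ∈ Finset.range K, ∫ ω, ‖gradient B.Phi (avg (x k ω))‖ ^ 2 ∂P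
      ≤ c.rateInit n / α + K * (c.rateNoise n ρ Cu * β)
        + K * ((16 + 16 * c.LPhi ^ 2) * (2 * e)) := by
  have hμ := h.valid.mu_pos
  have hβ0 := h.beta_pos
  have hα0 := h.alpha_pos
  have hρ : 0 < 1 - ρ := by linarith [h.rho_lt_one]
  have hρ0 := h.rho_pos
  have hC := h.Cu_nonneg
  have hLPhi := h.valid.LPhi_pos
  have he : 0 ≤ e := (sq_nonneg _).trans (h.bias_le 0 (Classical.choice P.nonempty_of_neZero))
  have hαβ : α ≤ β := hr.trans (mul_le_of_le_one_left hβ0.le (h.valid.ratio_le_one n))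
  have hCy : 0 ≤ c.Cy n ρ Cu := by unfold Constants.Cy; positivity
  have hcons0 : 0 ≤ c.cCons n ρ Cu := by unfold Constants.cCons; positivity
  have hinner0 : 0 ≤ c.cInner n ρ Cu := by unfold Constants.cInner; positivity
  have hbias0 : 0 ≤ c.cBias n := by unfold Constants.cBias; positivity
  have hα2 : α ^ 2 ≤ β ^ 2 := pow_le_pow_left₀ hα0.le hαβ 2
  have hβ2 : β ^ 2 ≤ β := by nlinarith
  have hcons : ∀ j k, ∫ ω, sqn (dev (x j ω)) ∂P + ∫ ω, sqn (dev (y k ω)) ∂P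
      ≤ c.cCons n ρ Cu * β ^ 2 := by
    intro j k
    have h1 := h.integral_dev_x_le j
    have h2 := h.integral_dev_y_le hβ k
    have h3 := mul_le_mul_of_nonneg_left hα2 (show 0 ≤ Cu / (1 - ρ) ^ 2 by positivity)
    unfold Constants.cCons
    linarith
  have hx0 : ∀ ω, avg (x 0 ω) = 0 := fun ω => by rw [h.x_zero]; exact avg_const h.pos 0
  have hr0 : ∀ ω, avg (r 0 ω) = 0 := fun ω => by rw [h.r_zero]; exact avg_const h.pos 0
  have hy0' : ∀ ω, avg (y 0 ω) = 0 := fun ω => by rw [h.y_zero]; exact avg_const h.pos 0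
  have key := sum_le_of_recursions (K := K)
    (Rb := fun k => ∫ ω, ‖avg (r k ω)‖ ^ 2 ∂P)
    (Bi := fun k => ∫ ω, ‖avg (m k ω) - gradient B.Phi (avg (x k ω))‖ ^ 2 ∂P)
    (H := fun k => ∫ ω, ‖avg (y (k + 1) ω) - B.yStar (avg (x k ω))‖ ^ 2 ∂P)
    (E := fun k => ∫ ω, ‖avg (y k ω) - B.yStar (avg (x k ω))‖ ^ 2 ∂P)
    (Ψ := fun k => ∫ ω, B.Phi (avg (x k ω)) ∂P + 1 / 2 * ∫ ω, ‖avg (r k ω)‖ ^ 2 ∂P)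
    (M := fun k => ∫ ω, ‖avg (r k ω) - gradient B.Phi (avg (x k ω))‖ ^ 2 ∂P)
    (b := β * c.mu / 2) (κ := 5 / (β * c.mu) * ((c.Lg1 / c.mu) ^ 2 * α ^ 2))
    (d := β ^ 2 * c.cInner n ρ Cu) (s := 2 * e + 2 * c.Lh ^ 2 * c.cCons n ρ Cu * β)
    (C := c.cBias n) (D := (c.LPhi + 2) * Cu) (L2 := c.LPhi ^ 2) (U := Cu) (gap := c.gap)
    hα0 (by positivity) (by linarith [h.beta_mul_mu_le]) (by positivity) hbias0 (sq_nonneg _)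
    (by positivity) (by positivity)
    (fun k => integral_nonneg fun _ => sq_nonneg _) (fun k => integral_nonneg fun _ => sq_nonneg _)
    (fun k => integral_nonneg fun _ => sq_nonneg _) (fun k => integral_nonneg fun _ => sq_nonneg _)
    (fun k => by
      have h1 := h.integral_inner_step_le k
      have h2 := mul_le_mul_of_nonneg_left (hcons k k)
        (show 0 ≤ 3 * β / c.mu * c.Lg1 ^ 2 by positivity)
      have h3 : 3 * β / c.mu * c.Lg1 ^ 2 * (c.cCons n ρ Cu * β ^ 2)
          ≤ β ^ 2 * (3 / c.mu * c.Lg1 ^ 2 * c.cCons n ρ Cu) := by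
        have h4 : 3 * β / c.mu * c.Lg1 ^ 2 * (c.cCons n ρ Cu * β ^ 2)
          = β * (β ^ 2 * (3 / c.mu * c.Lg1 ^ 2 * c.cCons n ρ Cu)) := by ring
        rw [h4]
        exact mul_le_of_le_one_left (by positivity) hβ1
      simp only [Constants.cInner]
      linarith)
    (fun k => (h.integral_shift_le k).trans_eq (by ring))
    (fun k => by
      have h1 := h.integral_bias_le k
      have h2 := mul_le_mul_of_nonneg_left ((hcons k (k + 1)).trans
        (mul_le_mul_of_nonneg_left hβ2 hcons0)) (show 0 ≤ 2 * c.Lh ^ 2 by positivity)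
      simp only [Constants.cBias]
      linarith)
    h.potential_descent h.integral_momentum_error_le
    (by
      have h1 : B.Phi 0 - c.gap ≤ ∫ ω, B.Phi (avg (x K ω)) ∂P := by
        have := integral_mono (integrable_const (B.Phi 0 - c.gap)) (h.integrable_Phi K)
          (fun ω => hbd _)
        simpa using this
      have h2 : 0 ≤ ∫ ω, ‖avg (r K ω)‖ ^ 2 ∂P := integral_nonneg fun _ => sq_nonneg _
      simp only [hx0, hr0, norm_zero, integral_const, probReal_univ]
      norm_num
      linarith)
    (h.valid.feedback_le h.pos hα0 hβ0 hr)
  have hgrad : ∀ k, ∫ ω, ‖gradient B.Phi (avg (x k ω))‖ ^ 2 ∂P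
      ≤ 2 * ∫ ω, ‖avg (r k ω) - gradient B.Phi (avg (x k ω))‖ ^ 2 ∂P
        + 2 * ∫ ω, ‖avg (r k ω)‖ ^ 2 ∂P := fun k => by
    have h1 := integral_le_of_le₂ (e := 0) (integrable_norm_sq (h.memLp_gradient_Phi k))
      (integrable_norm_sq (memLp_fun_sub (h.memL2 k).2.1.avg (h.memLp_gradient_Phi k)))
      (integrable_norm_sq (h.memL2 k).2.1.avg) (a₁ := 2) (a₂ := 2) (fun ω => by
        have h2 := norm_sub_sq_le_two (avg (r k ω))
          (avg (r k ω) - gradient B.Phi (avg (x k ω)))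
        rw [sub_sub_cancel] at h2
        linarith)
    linarith
  refine (Finset.sum_le_sum fun k _ => hgrad k).trans (key.trans ?_)
  have hM0 : ∫ ω, ‖avg (r 0 ω) - gradient B.Phi (avg (x 0 ω))‖ ^ 2 ∂P ≤ c.GPhi ^ 2 := by
    simp only [hx0, hr0, zero_sub, norm_neg, integral_const, probReal_univ, smul_eq_mul, one_mul]
    exact pow_le_pow_left₀ (norm_nonneg _) (h.smooth.norm_gradient_Phi_le h.valid h.pos 0) 2
  have hE0 : ∫ ω, ‖avg (y 0 ω) - B.yStar (avg (x 0 ω))‖ ^ 2 ∂P ≤ c.y0 ^ 2 := by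
    simp only [hx0, hy0', zero_sub, norm_neg, integral_const, probReal_univ, smul_eq_mul, one_mul]
    exact pow_le_pow_left₀ (norm_nonneg _) hy0 2
  have hK' : (1 : ℝ) ≤ K := by exact_mod_cast hK
  have t1 : 2 * ((∫ ω, ‖avg (r 0 ω) - gradient B.Phi (avg (x 0 ω))‖ ^ 2 ∂P) / α)
      ≤ 2 * c.GPhi ^ 2 / α := by
    rw [← mul_div_assoc]; gcongr
  have t2 : 2 * (K * (α * Cu)) ≤ K * (2 * Cu * β) := by
    have : 2 * (K * (α * Cu)) = K * (2 * Cu * α) := by ring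
    rw [this]; gcongr
  have t3 : 2 * c.cBias n / (β * c.mu / 2) * (∫ ω, ‖avg (y 0 ω) - B.yStar (avg (x 0 ω))‖ ^ 2 ∂P
      + (K + 1) * (β ^ 2 * c.cInner n ρ Cu))
      ≤ 4 * c.cBias n / c.mu * c.y0 ^ 2 / α
        + K * (8 * c.cBias n / c.mu * c.cInner n ρ Cu * β) := by
    have e1 : 2 * c.cBias n / (β * c.mu / 2) = 4 * c.cBias n / c.mu * (1 / β) := by
      field_simp; ring
    have e2 : 4 * c.cBias n / c.mu * (1 / β) * (c.y0 ^ 2 + 2 * K * (β ^ 2 * c.cInner n ρ Cu))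
        = 4 * c.cBias n / c.mu * c.y0 ^ 2 / β
          + K * (8 * c.cBias n / c.mu * c.cInner n ρ Cu * β) := by field_simp; ring
    have h1 : 4 * c.cBias n / c.mu * c.y0 ^ 2 / β ≤ 4 * c.cBias n / c.mu * c.y0 ^ 2 / α := by
      gcongr
    rw [e1]
    refine (mul_le_mul_of_nonneg_left (add_le_add hE0 (mul_le_mul_of_nonneg_right
      (show (K : ℝ) + 1 ≤ 2 * K by linarith) (by positivity))) (by positivity)).trans ?_
    rw [e2]
    linarith
  have t4 : K * (α * ((c.LPhi + 2) * Cu)) ≤ K * ((c.LPhi + 2) * Cu * β) := by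
    have : K * (α * ((c.LPhi + 2) * Cu)) = K * ((c.LPhi + 2) * Cu * α) := by ring
    rw [this]; gcongr
  have t5 := mul_le_mul_of_nonneg_left (add_le_add t3 t4)
    (show 0 ≤ 16 + 16 * c.LPhi ^ 2 by positivity)
  have e1 : c.rateInit n / α = 2 * c.GPhi ^ 2 / α + (16 + 16 * c.LPhi ^ 2)
      * (4 * c.cBias n / c.mu * c.y0 ^ 2 / α + c.gap / α) := by
    unfold Constants.rateInit; ring
  rw [e1]
  unfold Constants.rateNoise
  linarith

end MainRun

/-! ### The algorithm as a run of the main loop -/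

/-- Constant step sizes and one inner step per iteration. -/
abbrev constConfig (α β γ : ℝ) (N : ℕ) : Config :=
  { alpha := fun _ => α, beta := fun _ => β, gamma := γ, T := 1, N := N }

section Samples

variable {n p q : ℕ} {S : Type*} {R : Type*} [MeasurableSpace S] [MeasurableSpace R]

lemma higp_samples (B : Problem n p q S R) (W : Matrix (Fin n) (Fin n) ℝ) (γ : ℝ)
    (xi : ℕ → Fin n → R) (phi : ℕ → Fin n → S) (x : Fin n → Vec p) (y : Fin n → Vec q) (t : ℕ) :
    (higp B W γ xi phi x y t).samples = (t + 1) * (2 * n) := by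
  induction t with
  | zero => simp [higp]
  | succ t ih => simp only [higp, ih]; ring

lemma maDsbo_samples (B : Problem n p q S R) (W : Matrix (Fin n) (Fin n) ℝ) (α β γ : ℝ) (N : ℕ)
    (X : Samples n S R) (K : ℕ) :
    (maDsbo B W (constConfig α β γ N) X K).samples = K * (n * (2 * N + 3)) := by
  induction K with
  | zero => simp [maDsbo]
  | succ K ih => simp only [maDsbo, ih, higp_samples, innerLoop]; ring

end Samples

section Run

variable {Ω : Type w} {n p q : ℕ} {S : Type*} {R : Type*}
  [mS : MeasurableSpace S] [mR : MeasurableSpace R]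
  {c : Constants} {B : Problem n p q S R} {W : Matrix (Fin n) (Fin n) ℝ}
  {X : Ω → Samples n S R} {α β γ : ℝ} {N : ℕ}

/-- The noise of the inner gradients in iteration `k`. -/
def innerNoise (B : Problem n p q S R) (W : Matrix (Fin n) (Fin n) ℝ) (cfg : Config)
    (X : Ω → Samples n S R) (k : ℕ) (ω : Ω) (i : Fin n) : Vec q :=
  sndBlock (gradient (B.lossG ((X ω).xiTilde k 0 i))
      (points (maDsbo B W cfg (X ω) k).x (maDsbo B W cfg (X ω) k).y i)
    - gradient (B.g i) (points (maDsbo B W cfg (X ω) k).x (maDsbo B W cfg (X ω) k).y i))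

lemma Stochastic.measurable_maDsbo (hs : Stochastic c B) (cfg : Config) (k : ℕ) (i : Fin n) :
    (Measurable[sigmaOf X (pastIdx n k)] fun ω => (maDsbo B W cfg (X ω) k).x i) ∧
    (Measurable[sigmaOf X (pastIdx n k)] fun ω => (maDsbo B W cfg (X ω) k).r i) ∧
    (Measurable[sigmaOf X (pastIdx n k)] fun ω => (maDsbo B W cfg (X ω) k).y i) :=
  MeasurableLoss.maDsbo (m := sigmaOf X (pastIdx n k)) hs.measurableLoss k
    (fun _ hk _ _ => measurable_xiTilde hk) (fun _ hk _ _ => measurable_xi hk)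
    (fun _ hk _ _ => measurable_phi hk) i

variable [m0 : MeasurableSpace Ω] {P : Measure Ω}

/-- The oracle of iteration `k` starts at points that only depend on earlier samples. -/
lemma Assumptions.oracleRun (hA : Assumptions c B W) (hc : c.Valid) (hn : 0 < n)
    (hX : Sampling P B X) {ρ : ℝ} (hρ : c.rho ≤ ρ) (α β γ : ℝ) (N k : ℕ) :
    OracleRun c ρ B W P X k (fun ω => (maDsbo B W (constConfig α β γ N) (X ω) k).x)
      (fun ω => (maDsbo B W (constConfig α β γ N) (X ω) (k + 1)).y) := by
  have hle := sigmaOf_mono (X := X) (pastIdx_subset_oracleIdx (n := n) k 0)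
  have hx := fun i => ((hA.stochastic.measurable_maDsbo (W := W) (X := X)
    (constConfig α β γ N) k i).1).mono hle le_rfl
  have hy := fun i => ((hA.stochastic.measurable_maDsbo (W := W) (X := X)
    (constConfig α β γ N) k i).2.2).mono hle le_rfl
  exact
  { pos := hn
    valid := hc
    smooth := hA.smooth
    network := hA.network.mono hρ
    stochastic := hA.stochastic
    sampling := hX
    meas_x := hx
    meas_y := MeasurableLoss.innerLoop (m := sigmaOf X (oracleIdx n k 0))
      hA.stochastic.measurableLoss (xi := fun ω => (X ω).xiTilde k) hx hy 1
      (fun _ _ i => measurable_xiTilde (le_refl k)) }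

lemma centered_avg {d : ℕ} {𝓕 : MeasurableSpace Ω} {v : Ω → Fin n → Vec d}
    (hv : ∀ i, Centered P 𝓕 fun ω => v ω i) : Centered P 𝓕 fun ω => avg (v ω) :=
  (Centered.sum fun i _ => hv i).smul (1 / (n : ℝ))

lemma Assumptions.centered_innerNoise [IsProbabilityMeasure P] (hA : Assumptions c B W)
    (hX : Sampling P B X) (cfg : Config) (k : ℕ) (i : Fin n) :
    Centered P (sigmaOf X (pastIdx n k)) (fun ω => innerNoise B W cfg X k ω i) ∧
      ∫ ω, ‖innerNoise B W cfg X k ω i‖ ^ 2 ∂P ≤ c.sigG1 ^ 2 := by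
  have hm := hA.stochastic.measurable_maDsbo (W := W) (X := X) cfg k i
  have h := Unbiased.centered_noise (G := fun z s => gradient (B.lossG s) z)
    (m := gradient (B.g i)) (hA.stochastic.grad_G i) hA.stochastic.meas_grad_G
    (hA.smooth.lip_grad_g i).measurable (hX.sigmaOf_le _) (hX.meas_xiTilde k 0 i)
    (hX.law_xiTilde k 0 i)
    (hX.indep_sigmaOf (J := pastIdx n k) (a := Sum.inl (k, 0, i)) (by simp [pastIdx]))
    (measurable_pair (m := sigmaOf X (pastIdx n k)) hm.1 hm.2.2)
  have hc := h.1.clm (hX.sigmaOf_le _) (sndL p q)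
  refine ⟨hc, (integral_mono (integrable_norm_sq hc.memLp) (integrable_norm_sq h.1.memLp)
    fun ω => ?_).trans h.2⟩
  exact pow_le_pow_left₀ (norm_nonneg _) (norm_sndBlock_le _) 2

/-- The algorithm satisfies the recursions of the analysis. -/
lemma Assumptions.mainRun [IsProbabilityMeasure P] (hA : Assumptions c B W) (hc : c.Valid)
    (hn : 0 < n) (hX : Sampling P B X) {ρ : ℝ} (hρ : c.rho ≤ ρ) (hρ0 : 0 < ρ) (hρ1 : ρ < 1)
    {θ A : ℝ} (hθ0 : 0 < θ) (hθ1 : θ < 1) (hA0 : 0 < A)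
    (hT : TrackingBound.{w} c.mu c.Lg1 (2 * c.sigG2) ρ γ θ A) (hα : 0 < α) (hα1 : α ≤ 1)
    (hβ : 0 < β) (hβL : β * c.Lg1 ^ 2 ≤ c.mu) (hβμ : β * c.mu ≤ 1) :
    MainRun c ρ B W P α β (c.Cu n A) (c.Lg1 ^ 2 * (A * (θ ^ N * c.oracleInit n)))
      (fun k ω => (maDsbo B W (constConfig α β γ N) (X ω) k).x)
      (fun k ω => (maDsbo B W (constConfig α β γ N) (X ω) k).r)
      (fun k => stochHypergrad B W γ X k
        (fun ω => (maDsbo B W (constConfig α β γ N) (X ω) k).x)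
        (fun ω => (maDsbo B W (constConfig α β γ N) (X ω) (k + 1)).y) N)
      (fun k ω => meanHypergrad B W γ (maDsbo B W (constConfig α β γ N) (X ω) k).x
        (maDsbo B W (constConfig α β γ N) (X ω) (k + 1)).y N)
      (fun k ω => (maDsbo B W (constConfig α β γ N) (X ω) k).y)
      (innerNoise B W (constConfig α β γ N) X) := by
  set cfg := constConfig α β γ N with hcfg
  have hor := fun k => hA.oracleRun hc hn hX hρ α β γ N k
  rw [← hcfg] at hor
  have hηc := fun k i => hA.centered_innerNoise (P := P) hX cfg k i
  have hpast := fun k i => hA.stochastic.measurable_maDsbo (W := W) (X := X) cfg k i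
  have hle := fun k => sigmaOf_mono (X := X) (pastIdx_subset_oracleIdx (n := n) k 0)
  have hcen := fun k => centered_avg fun i => (hor k).centered_stochHypergrad_sub (γ := γ) N i
  have hu := fun k => (hor k).memL2_stochHypergrad (γ := γ) N
  have hule := fun k => (hor k).integral_sqn_stochHypergrad_le hθ0 hθ1 hA0 hT N
  have hmm := fun k i => (hor k).meas_meanHypergrad (γ := γ) N i
  have hm : ∀ k, MemL2 P fun ω => meanHypergrad B W γ (maDsbo B W cfg (X ω) k).x
      (maDsbo B W cfg (X ω) (k + 1)).y N := fun k i => by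
    have := memLp_fun_sub (hu k i) ((hor k).centered_stochHypergrad_sub (γ := γ) N i).memLp
    simpa only [sub_sub_cancel] using this
  have hxm := fun k => measurable_avg (m := sigmaOf X (oracleIdx n k 0))
    fun i => (hpast k i).1.mono (hle k) le_rfl
  have hrm := fun k => measurable_avg (m := sigmaOf X (oracleIdx n k 0))
    fun i => (hpast k i).2.1.mono (hle k) le_rfl
  have hΦ := (hA.smooth.isLip_gradient_Phi hc hn).measurable
  exact
  { pos := hn
    valid := hc
    smooth := hA.smooth
    network := hA.network.mono hρ
    heterogeneity := hA.heterogeneity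
    rho_pos := hρ0
    rho_lt_one := hρ1
    alpha_pos := hα
    alpha_le_one := hα1
    beta_pos := hβ
    beta_le := hβL
    beta_mul_mu_le := hβμ
    x_zero := fun _ => rfl
    r_zero := fun _ => rfl
    y_zero := fun _ => rfl
    step_x := fun _ _ => rfl
    step_r := fun _ _ => rfl
    step_y := fun k ω => by
      funext i
      change mix W (maDsbo B W cfg (X ω) k).y i
        - β • gradY (B.lossG ((X ω).xiTilde k 0 i))
          (points (maDsbo B W cfg (X ω) k).x (maDsbo B W cfg (X ω) k).y i) = _
      rw [innerNoise, sndBlock_sub]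
      simp only [gradY, add_sub_cancel]
    memL2_u := hu
    memL2_m := hm
    memL2_noise := fun k i => (hηc k i).1.memLp
    noise_le := fun k => by
      simp only [sqn]
      rw [integral_finsetSum _ fun i _ => integrable_norm_sq (hηc k i).1.memLp]
      refine (Finset.sum_le_sum fun i _ => (hηc k i).2).trans_eq ?_
      simp
    u_le := hule
    u_sub_le := fun k => by
      have h1 := integral_norm_add_sq_of_orthogonal (hm k).avg (hcen k).memLp
        ((hcen k).orthogonal _ (measurable_avg (m := sigmaOf X (oracleIdx n k 0)) (hmm k))
          (hm k).avg)
      simp only [avg_sub, add_sub_cancel] at h1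
      have h2 : 0 ≤ ∫ ω, ‖avg (meanHypergrad B W γ (maDsbo B W cfg (X ω) k).x
          (maDsbo B W cfg (X ω) (k + 1)).y N)‖ ^ 2 ∂P := integral_nonneg fun _ => sq_nonneg _
      have h3 := (integral_mono (integrable_norm_sq (hu k).avg) (hu k).integrable_sqn
        fun _ => norm_avg_sq_le_sqn hn _).trans (hule k)
      simp only [avg_sub]
      linarith
    bias_le := fun k ω =>
      hA.smooth.norm_avg_meanHypergrad_sub_le hc hn (hA.network.mono hρ) hθ0 hA0 hT _ _ N
    orthogonal_y := fun k h2 => by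
      refine (centered_avg fun i => (hηc k i).1).orthogonal _ ?_ h2
      have hx := measurable_avg (m := sigmaOf X (pastIdx n k)) fun i => (hpast k i).1
      have hy := measurable_avg (m := sigmaOf X (pastIdx n k)) fun i => (hpast k i).2.2
      have hys : Measurable B.yStar :=
        IsLip.measurable (L := c.Lg1 / c.mu) (hA.smooth.norm_yStar_sub_le hc hn)
      have hg := measurable_avg (m := sigmaOf X (pastIdx n k))
        (v := fun ω i => gradY (B.g i) (points (maDsbo B W cfg (X ω) k).x
          (maDsbo B W cfg (X ω) k).y i)) fun i =>
        (IsLip.measurable (L := c.Lg1) (hA.smooth.norm_gradY_g_sub_le i)).comp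
          (measurable_pair (hpast k i).1 (hpast k i).2.2)
      exact (hy.sub (hys.comp hx)).sub (hg.const_smul β)
    orthogonal_r := fun k h2 => (hcen k).orthogonal _ (hrm k) h2
    orthogonal_h := fun k h2 => by
      refine (hcen k).orthogonal _ ?_ h2
      exact (((hrm k).sub (hΦ.comp (hxm k))).const_smul (1 - α)).add
        ((((measurable_avg (m := sigmaOf X (oracleIdx n k 0)) (hmm k)).sub
          (hΦ.comp (hxm k))).const_smul α).add ((hΦ.comp (hxm k)).sub
            (hΦ.comp ((hxm k).sub ((hrm k).const_smul α))))) }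

end Run

/-! ### Choice of the parameters -/

/-- The conditions on `β` hold for all small step sizes. -/
lemma Constants.Valid.exists_beta {c : Constants} (hc : c.Valid) {ρ : ℝ} (hρ1 : ρ < 1) :
    ∃ β₀ : ℝ, 0 < β₀ ∧ ∀ β, 0 < β → β ≤ β₀ → β ≤ 1 ∧ β * c.Lg1 ^ 2 ≤ c.mu ∧ β * c.mu ≤ 1 ∧
      β ^ 2 * (8 * c.Lg1 ^ 2) ≤ (1 - ρ) ^ 2 := by
  have hμ := hc.mu_pos
  have hL := hc.Lg1_pos
  have hρ : 0 < 1 - ρ := by linarith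
  refine ⟨min (min 1 (c.mu / c.Lg1 ^ 2)) (min (1 / c.mu) ((1 - ρ) / (3 * c.Lg1))), by positivity,
    fun β h0 h => ?_⟩
  obtain ⟨h1, h2⟩ := le_min_iff.1 h
  obtain ⟨h3, h4⟩ := le_min_iff.1 h1
  obtain ⟨h5, h6⟩ := le_min_iff.1 h2
  refine ⟨h3, (le_div_iff₀ (by positivity)).1 h4, (le_div_iff₀ hμ).1 h5, ?_⟩
  have h7 := pow_le_pow_left₀ (by positivity) ((le_div_iff₀ (by positivity)).1 h6) 2
  have h8 : 0 ≤ β ^ 2 * c.Lg1 ^ 2 := by positivity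
  linarith

lemma log_two_le_log_one_div {ε : ℝ} (h0 : 0 < ε) (h1 : ε ≤ 1 / 2) :
    Real.log 2 ≤ Real.log (1 / ε) :=
  Real.log_le_log two_pos (by rw [le_div_iff₀ h0]; linarith)

/-- Logarithmically many steps of a linearly convergent method suffice for accuracy `ε`. -/
lemma exists_log_factor {θ a : ℝ} (h0 : 0 < θ) (h1 : θ < 1) (ha : 0 ≤ a) :
    ∃ C : ℝ, 0 < C ∧ ∀ (ε : ℝ) (N : ℕ), 0 < ε → ε ≤ 1 / 2 → C * Real.log (1 / ε) ≤ N →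
      a * θ ^ N ≤ ε / 2 := by
  have hl : 0 < -Real.log θ := by linarith [Real.log_neg h0 h1]
  have h2 : 0 < Real.log 2 := Real.log_pos one_lt_two
  have h3 : 0 ≤ Real.log (1 + 2 * a) := Real.log_nonneg (by linarith)
  refine ⟨(1 + Real.log (1 + 2 * a) / Real.log 2) / (-Real.log θ), by positivity,
    fun ε N hε hε1 hN => ?_⟩
  rw [div_mul_eq_mul_div, div_le_iff₀ hl] at hN
  have h4 : Real.log (1 + 2 * a) ≤ Real.log (1 + 2 * a) / Real.log 2 * Real.log (1 / ε) := by
    rw [div_mul_eq_mul_div, le_div_iff₀ h2]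
    exact mul_le_mul_of_nonneg_left (log_two_le_log_one_div hε hε1) h3
  have h5 : Real.log (θ ^ N) ≤ Real.log (ε / (1 + 2 * a)) := by
    rw [Real.log_pow, Real.log_div hε.ne' (by positivity)]
    rw [one_div, Real.log_inv] at hN h4
    linarith
  have h6 := (Real.log_le_log_iff (by positivity) (by positivity)).1 h5
  refine (mul_le_mul_of_nonneg_left h6 ha).trans ?_
  rw [mul_div_assoc', div_le_div_iff₀ (by positivity) two_pos]
  linarith

universe u v

/-- The main result with the universe levels named, so that the step-size bound can be chosen for
probability spaces of a fixed universe. -/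
theorem exists_stationary_constants (n : ℕ) (hn : 0 < n) (c : Constants) (hc : c.Valid) :
    ∃ c₁ c₂ : ℝ, 0 < c₁ ∧ c₁ < c₂ ∧ ∀ γ : ℝ, c₁ < γ → γ < c₂ →
    ∃ r : ℝ, 0 < r ∧
    ∀ a₁ a₂ b₁ b₂ : ℝ, 0 < a₁ → 0 < b₁ →
    ∃ CK CN : ℝ, 0 < CK ∧ 0 < CN ∧
    ∀ CK' CN' : ℝ,
    ∃ M : ℝ, 0 < M ∧
    ∀ (p q : ℕ) (S : Type u) (R : Type v) [MeasurableSpace S] [MeasurableSpace R]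
      (B : Problem n p q S R) (W : Matrix (Fin n) (Fin n) ℝ), Assumptions c B W →
    ∀ (Ω : Type w) [MeasurableSpace Ω] (Pr : Measure Ω)
      [IsProbabilityMeasure Pr] (X : Ω → Samples n S R), Sampling Pr B X →
    ∀ (ε : ℝ), 0 < ε → ε ≤ 1 / 2 →
    ∀ (K N : ℕ) (α β : ℝ),
      CK * ε⁻¹ ^ 2 ≤ (K : ℝ) → (K : ℝ) ≤ CK' * ε⁻¹ ^ 2 →
      CN * Real.log (1 / ε) ≤ (N : ℝ) → (N : ℝ) ≤ CN' * Real.log (1 / ε) →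
      a₁ / √(K : ℝ) ≤ α → α ≤ a₂ / √(K : ℝ) →
      b₁ / √(K : ℝ) ≤ β → β ≤ b₂ / √(K : ℝ) → α ≤ r * β →
      FindsStationary Pr B W (constConfig α β γ N) X K ε ∧
        ∀ ω, ((maDsbo B W (constConfig α β γ N) (X ω) K).samples : ℝ)
          ≤ M * (ε⁻¹ ^ 2 * Real.log (1 / ε)) := by
  -- the tracking estimate needs a positive contraction factor, and `c.rho` may vanish
  set ρ := (1 + c.rho) / 2 with hρ
  have hρ0 : 0 < ρ := by have := hc.rho_nonneg; positivity
  have hρ1 : ρ < 1 := by linarith [hc.rho_lt_one]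
  have hρc : c.rho ≤ ρ := by linarith [hc.rho_lt_one]
  obtain ⟨γ₀, hγ₀, hγ⟩ := exists_trackingBound.{w} (σ := 2 * c.sigG2) hc.mu_pos hc.Lg1_pos hρ0 hρ1
  refine ⟨γ₀ / 2, γ₀, by positivity, by linarith, fun γ h1 h2 => ?_⟩
  obtain ⟨θ, A, hθ0, hθ1, hA0, hT⟩ := hγ γ (by linarith) h2.le
  refine ⟨c.ratio n, hc.ratio_pos n, fun a₁ a₂ b₁ b₂ ha₁ hb₁ => ?_⟩
  obtain ⟨β₀, hβ₀, hβ⟩ := hc.exists_beta hρ1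
  set D := |c.rateInit n| / a₁ + |c.rateNoise n ρ (c.Cu n A)| * |b₂| with hD
  have hD0 : 0 ≤ D := by positivity
  have hinit : 0 ≤ c.oracleInit n := by unfold Constants.oracleInit; positivity
  obtain ⟨CN, hCN0, hCN⟩ := exists_log_factor (a := (16 + 16 * c.LPhi ^ 2)
    * (2 * (c.Lg1 ^ 2 * (A * c.oracleInit n)))) hθ0 hθ1 (by positivity)
  set s := 1 + 2 * D + |b₂| / β₀ with hs
  have hs0 : 0 < s := by positivity
  refine ⟨s ^ 2, CN, by positivity, hCN0, fun CK' CN' => ?_⟩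
  refine ⟨|CK'| * (n * (2 * |CN'| + 6)) + 1, by positivity, ?_⟩
  intro p q S R _ _ B W hA Ω _ Pr _ X hX ε hε hε1 K N α β hK1 hK2 hN1 hN2 hα1 _ hβ1 hβ2 hαβ
  have hℓ := log_two_le_log_one_div hε hε1
  have hℓ2 := Real.log_two_gt_d9
  have hK0 : (0 : ℝ) < K := lt_of_lt_of_le (by positivity) hK1
  have hKn : 0 < K := by exact_mod_cast hK0
  have hq0 : 0 < √(K : ℝ) := Real.sqrt_pos.2 hK0
  have hq : s * ε⁻¹ ≤ √(K : ℝ) := Real.le_sqrt_of_sq_le (by rw [mul_pow]; exact hK1)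
  have hq' : s ≤ ε * √(K : ℝ) := by
    have := mul_le_mul_of_nonneg_left hq hε.le
    rwa [mul_comm s, ← mul_assoc, mul_inv_cancel₀ hε.ne', one_mul] at this
  have hα0 : 0 < α := lt_of_lt_of_le (by positivity) hα1
  have hβ0 : 0 < β := lt_of_lt_of_le (by positivity) hβ1
  have hb2 : β ≤ |b₂| / √(K : ℝ) := hβ2.trans (by gcongr; exact le_abs_self b₂)
  have hβs : β ≤ β₀ := by
    refine hb2.trans ?_
    rw [div_le_iff₀ hq0]
    have h3 : |b₂| / β₀ ≤ √(K : ℝ) := by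
      have : ε * √(K : ℝ) ≤ √(K : ℝ) := mul_le_of_le_one_left hq0.le (by linarith)
      linarith
    rw [div_le_iff₀ hβ₀] at h3
    linarith
  obtain ⟨hβa, hβb, hβc, hβd⟩ := hβ β hβ0 hβs
  have hα1' : α ≤ 1 :=
    (hαβ.trans (mul_le_of_le_one_left hβ0.le (hc.ratio_le_one n))).trans hβa
  have hrun := hA.mainRun hc hn hX hρc hρ0 hρ1 hθ0 hθ1 hA0 hT hα0 hα1' hβ0 hβb hβc (N := N)
  refine ⟨⟨hA.smooth.differentiable_Phi hc hn,
    fun k _ => integrable_norm_sq (hrun.memLp_gradient_Phi k), ?_⟩, fun ω => ?_⟩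
  · have hsum := hrun.sum_norm_gradient_le hβd hβa hαβ hA.bounded_below hA.y0_bound hKn
    set F : ℕ → ℝ := fun k =>
      ∫ ω, ‖gradient B.Phi (xBar B W (constConfig α β γ N) (X ω) k)‖ ^ 2 ∂Pr with hF
    set m := (Finset.range (K + 1)).inf' Finset.nonempty_range_add_one F with hm
    have h3 : K * m ≤ ∑ k ∈ Finset.range K, F k := by
      have := Finset.card_nsmul_le_sum (Finset.range K) F m fun k hk =>
        Finset.inf'_le F (Finset.mem_range.2 ((Finset.mem_range.1 hk).trans K.lt_succ_self))
      simpa using this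
    have h4 : c.rateInit n / α ≤ K * (|c.rateInit n| / a₁ / √(K : ℝ)) := by
      have e1 : K * (|c.rateInit n| / a₁ / √(K : ℝ)) = |c.rateInit n| / (a₁ / √(K : ℝ)) := by
        nth_rewrite 1 [← Real.mul_self_sqrt hK0.le]
        field_simp
      rw [e1]
      exact (div_le_div_of_nonneg_right (le_abs_self _) hα0.le).trans
        (div_le_div_of_nonneg_left (abs_nonneg _) (by positivity) hα1)
    have h5 : c.rateNoise n ρ (c.Cu n A) * β
        ≤ |c.rateNoise n ρ (c.Cu n A)| * |b₂| / √(K : ℝ) := by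
      rw [mul_div_assoc]
      exact (mul_le_mul_of_nonneg_right (le_abs_self _) hβ0.le).trans
        (mul_le_mul_of_nonneg_left hb2 (abs_nonneg _))
    have h6 : D / √(K : ℝ) ≤ ε / 2 := by
      rw [div_le_iff₀ hq0]
      have : 0 ≤ |b₂| / β₀ := by positivity
      linarith
    have h7 := hCN ε N hε hε1 hN1
    have h8 : D / √(K : ℝ) = |c.rateInit n| / a₁ / √(K : ℝ)
        + |c.rateNoise n ρ (c.Cu n A)| * |b₂| / √(K : ℝ) := add_div _ _ _
    have h9 : K * (c.rateNoise n ρ (c.Cu n A) * β)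
        ≤ K * (|c.rateNoise n ρ (c.Cu n A)| * |b₂| / √(K : ℝ)) :=
      mul_le_mul_of_nonneg_left h5 hK0.le
    have h10 : K * m ≤ K * (D / √(K : ℝ) + (16 + 16 * c.LPhi ^ 2)
        * (2 * (c.Lg1 ^ 2 * (A * c.oracleInit n))) * θ ^ N) := by
      rw [h8]
      refine (h3.trans hsum).trans ?_
      linarith
    exact (le_of_mul_le_mul_left h10 hK0).trans (by linarith)
  · rw [maDsbo_samples]
    push_cast
    set ℓ := Real.log (1 / ε)
    have hℓ0 : 0 < ℓ := by linarith
    have h3 : (K : ℝ) ≤ |CK'| * ε⁻¹ ^ 2 := hK2.trans (by gcongr; exact le_abs_self _)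
    have h4 : (N : ℝ) ≤ |CN'| * ℓ := hN2.trans (by gcongr; exact le_abs_self _)
    have h5 : (2 * N + 3 : ℝ) ≤ (2 * |CN'| + 6) * ℓ := by linarith
    calc (K : ℝ) * (n * (2 * N + 3)) ≤ |CK'| * ε⁻¹ ^ 2 * (n * ((2 * |CN'| + 6) * ℓ)) := by gcongr
      _ = |CK'| * (n * (2 * |CN'| + 6)) * (ε⁻¹ ^ 2 * ℓ) := by ring
      _ ≤ _ := by
        have : 0 ≤ ε⁻¹ ^ 2 * ℓ := by positivity
        linarith

end DSBO

end

theorem corollary1 (n : ℕ) (hn : 0 < n) (c : Constants) (hc : c.Valid) :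
    -- an interval of step sizes for the inner oracle
    ∃ c₁ c₂ : ℝ, 0 < c₁ ∧ c₁ < c₂ ∧ ∀ γ : ℝ, c₁ < γ → γ < c₂ →
    -- an upper bound for the ratio of the two outer step sizes
    ∃ r : ℝ, 0 < r ∧
    -- the constants in `α = Θ(1/√K)` and `β = Θ(1/√K)`
    ∀ a₁ a₂ b₁ b₂ : ℝ, 0 < a₁ → 0 < b₁ →
    -- the lower constants in the choice of `K` and of `N`
    ∃ CK CN : ℝ, 0 < CK ∧ 0 < CN ∧
    -- the upper constants in `K = O(ε⁻²)` and `N = Θ(log (1/ε))`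
    ∀ CK' CN' : ℝ,
    -- the constant in the sample complexity
    ∃ M : ℝ, 0 < M ∧
    ∀ (p q : ℕ) (S : Type*) (R : Type*) [MeasurableSpace S] [MeasurableSpace R]
      (B : Problem n p q S R) (W : Matrix (Fin n) (Fin n) ℝ), Assumptions c B W →
    ∀ (Ω : Type*) [MeasurableSpace Ω] (Pr : MeasureTheory.Measure Ω)
      [MeasureTheory.IsProbabilityMeasure Pr] (X : Ω → Samples n S R), Sampling Pr B X →
    ∀ (ε : ℝ), 0 < ε → ε ≤ 1 / 2 →
    ∀ (K N : ℕ) (α β : ℝ),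
      CK * ε⁻¹ ^ 2 ≤ (K : ℝ) → (K : ℝ) ≤ CK' * ε⁻¹ ^ 2 →
      CN * Real.log (1 / ε) ≤ (N : ℝ) → (N : ℝ) ≤ CN' * Real.log (1 / ε) →
      a₁ / √(K : ℝ) ≤ α → α ≤ a₂ / √(K : ℝ) →
      b₁ / √(K : ℝ) ≤ β → β ≤ b₂ / √(K : ℝ) → α ≤ r * β →
      FindsStationary Pr B W
          { alpha := fun _ => α, beta := fun _ => β, gamma := γ, T := 1, N := N } X K ε ∧
        ∀ ω, ((maDsbo B W
          { alpha := fun _ => α, beta := fun _ => β, gamma := γ, T := 1, N := N }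
          (X ω) K).samples : ℝ) ≤ M * (ε⁻¹ ^ 2 * Real.log (1 / ε)) :=
  exists_stationary_constants n hn c hc
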